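/- Theorem 4.2. Let $p,q\ge 2$ be integers. On $\mathbb{C}^{p+q}=\mathbb{C}^p\oplus\mathbb{C}^q$ consider the Hermitian form $$((z,w),(z',w'))_{p,q}=\sum_{j=1}^p z_j\overline{z_j'}-\sum_{j=1}^q w_j\overline{w_j'},$$ let $U(p,q)$ be the group of its complex-linear isometries, and let $O(2p,2q)\supseteq U(p,q)$ be the group of real-linear isometries of its real part. Let $X^0=\{\eta\in\mathbb{C}^{p+q}\setminus\{0\} : (\eta,\eta)_{p,q}=0\}$ be the light cone, and let $C^\infty(X^0)$ be the space of smooth complex-valued functions on $X^0$ with its usual Fréchet topology (uniform convergence of all derivatives on compact sets), on which $O(2p,2q)$ acts by $(\rho(g)f)(\eta)=f(g^{-1}\eta)$. For $a\in\mathbb{C}$ let $$S^a(X^0)=\{f\in C^\infty(X^0) : f(t\eta)=t^a f(\eta)\ \text{for all real } t>0 \text{ and } \eta\in X^0\},$$ and for $\alpha,\beta\in\mathbb{C}$ with $\alpha-\beta\in\mathbb{Z}$ let $$S^{\alpha,\beta}(X^0)=\{f\in S^{\alpha+\beta}(X^0) : f(t\eta)=\psi^{\alpha,\beta}(t)f(\eta)\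 \text{for all } t\in\mathbb{C}^\times \text{ and } \eta\in X^0\},\qquad \psi^{\alpha,\beta}(t)=|t|^{\alpha+\beta}\left(\frac{t}{|t|}\right)^{\alpha-\beta}.$$ The space $S^{\alpha+\beta}(X^0)$ is invariant under $O(2p,2q)$, and $S^{\alpha,\beta}(X^0)$ is invariant under $U(p,q)$. Call a representation of a group on a topological vector space irreducible if the space is nonzero and its only closed invariant subspaces are $0$ and the whole space. Let $W\subseteq V\subseteq S^{\alpha+\beta}(X^0)$ be closed $O(2p,2q)$-invariant subspaces such that $V/W$, with the quotient topology, is an irreducible representation of $O(2p,2q)$ (an irreducible constituent of $S^{\alpha+\beta}(X^0)$). Then the image of $V\cap S^{\alpha,\beta}(X^0)$ in $V/W$, with the subspace topology, is either $0$ or an irreducible representation of $U(p,q)$. -/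

import Mathlib

open scoped ContDiff ComplexConjugate

noncomputable section

namespace LightCone

/-- `ℂ^{p+q} = ℂ^p ⊕ ℂ^q`, with elements `(z, w)`. As a real vector space it is `ℝ^{2p+2q}`. -/
abbrev Vec (p q : ℕ) : Type := EuclideanSpace ℂ (Fin p) × EuclideanSpace ℂ (Fin q)

/-- The Hermitian form `∑ z_j conj z'_j - ∑ w_j conj w'_j` of signature `(p, q)`. -/
def herm {p q : ℕ} (u v : Vec p q) : ℂ :=
  ∑ j, u.1 j * conj (v.1 j) - ∑ j, u.2 j * conj (v.2 j)

/-- The light cone `X⁰`: the nonzero null vectors. -/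
def cone (p q : ℕ) : Set (Vec p q) := {v | v ≠ 0 ∧ herm v v = 0}

/-- `O(2p,2q)`: the real-linear isometries of the real part of the Hermitian form, which is the
standard real inner product of signature `(2p, 2q)` on `ℝ^{2p+2q} = ℂ^{p+q}`. -/
def orthogonalGroup (p q : ℕ) : Subgroup (Vec p q ≃ₗ[ℝ] Vec p q) where
  carrier := {g | ∀ u v, (herm (g u) (g v)).re = (herm u v).re}
  one_mem' := fun _ _ => rfl
  mul_mem' := fun {g h} hg hh u v => (hg (h u) (h v)).trans (hh u v)
  inv_mem' := fun {g} hg u v => by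
    have h := hg (g⁻¹ u) (g⁻¹ v)
    have e : ∀ x, g (g⁻¹ x) = x := fun x => g.apply_symm_apply x
    rw [e, e] at h
    exact h.symm

/-- `U(p,q)`: the complex-linear isometries of the Hermitian form. -/
def unitaryGroup (p q : ℕ) : Subgroup (Vec p q ≃ₗ[ℂ] Vec p q) where
  carrier := {g | ∀ u v, herm (g u) (g v) = herm u v}
  one_mem' := fun _ _ => rfl
  mul_mem' := fun {g h} hg hh u v => (hg (h u) (h v)).trans (hh u v)
  inv_mem' := fun {g} hg u v => by
    have h := hg (g⁻¹ u) (g⁻¹ v)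
    have e : ∀ x, g (g⁻¹ x) = x := fun x => g.apply_symm_apply x
    rw [e, e] at h
    exact h.symm

/-- The inclusion `U(p,q) ⊆ O(2p,2q)`. -/
def unitaryToOrthogonal (p q : ℕ) : unitaryGroup p q →* orthogonalGroup p q where
  toFun g := ⟨(g : Vec p q ≃ₗ[ℂ] Vec p q).restrictScalars ℝ,
    fun u v => congrArg Complex.re (g.2 u v)⟩
  map_one' := rfl
  map_mul' _ _ := rfl

theorem herm_self {p q : ℕ} (v : Vec p q) :
    herm v v = ((‖v.1‖ ^ 2 - ‖v.2‖ ^ 2 : ℝ) : ℂ) := by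
  simp [herm, EuclideanSpace.norm_sq_eq, Complex.mul_conj, Complex.normSq_eq_norm_sq]

theorem mem_cone_iff {p q : ℕ} (v : Vec p q) : v ∈ cone p q ↔ v ≠ 0 ∧ ‖v.1‖ = ‖v.2‖ := by
  rw [cone, Set.mem_ofPred_eq, herm_self, Complex.ofReal_eq_zero, sub_eq_zero,
    sq_eq_sq₀ (norm_nonneg _) (norm_nonneg _)]

/-- The cone is stable under `O(2p,2q)`. -/
theorem apply_mem_cone {p q : ℕ} (g : orthogonalGroup p q) {v : Vec p q} (hv : v ∈ cone p q) :
    (g : Vec p q ≃ₗ[ℝ] Vec p q) v ∈ cone p q := by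
  refine ⟨(LinearEquiv.map_ne_zero_iff _).2 hv.1, ?_⟩
  have h := g.2 v v
  rw [hv.2, herm_self, Complex.ofReal_re, Complex.zero_re] at h
  rw [herm_self, h, Complex.ofReal_zero]

/-- The cone is stable under complex scalar dilations. -/
theorem smul_mem_cone {p q : ℕ} (t : ℂˣ) {v : Vec p q} (hv : v ∈ cone p q) :
    (t : ℂ) • v ∈ cone p q := by
  rw [mem_cone_iff] at hv ⊢
  refine ⟨smul_ne_zero t.ne_zero hv.1, ?_⟩
  simp [norm_smul, hv.2]

/-- The action of `O(2p,2q)` on the points of the cone. -/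
def act {p q : ℕ} (g : orthogonalGroup p q) (x : cone p q) : cone p q :=
  ⟨(g : Vec p q ≃ₗ[ℝ] Vec p q) x, apply_mem_cone g x.2⟩

/-- The dilation of a point of the cone by `t ∈ ℂˣ`. -/
def dilate {p q : ℕ} (t : ℂˣ) (x : cone p q) : cone p q :=
  ⟨(t : ℂ) • (x : Vec p q), smul_mem_cone t x.2⟩

/-- A positive real number as an element of `ℂˣ`. -/
def posUnit (t : ℝ) (ht : 0 < t) : ℂˣ := Units.mk0 (t : ℂ) (Complex.ofReal_ne_zero.2 ht.ne')

/-- The smooth complex-valued functions on the cone, a closed submanifold of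
`ℝ^{2p+2q} - {0}`: the restrictions of smooth functions on `ℝ^{2p+2q} - {0}`. -/
def smoothFunctions (p q : ℕ) : Submodule ℂ (cone p q → ℂ) where
  carrier := {f | ∃ F : Vec p q → ℂ, ContDiffOn ℝ ∞ F {0}ᶜ ∧ ∀ x : cone p q, F x = f x}
  zero_mem' := ⟨fun _ => 0, contDiffOn_const, fun _ => rfl⟩
  add_mem' := by
    rintro f g ⟨F, hF, hf⟩ ⟨G, hG, hg⟩
    exact ⟨fun v => F v + G v, hF.add hG, fun x => by simp [hf x, hg x]⟩
  smul_mem' := by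
    rintro c f ⟨F, hF, hf⟩
    exact ⟨fun v => c * F v, contDiffOn_const.mul hF, fun x => by simp [hf x]⟩

/-- The space `C^∞(X⁰)` (a type of its own, since it carries its own topology, below). -/
def SmoothFun (p q : ℕ) : Type := smoothFunctions p q

instance (p q : ℕ) : AddCommGroup (SmoothFun p q) :=
  inferInstanceAs (AddCommGroup (smoothFunctions p q))

instance (p q : ℕ) : Module ℂ (SmoothFun p q) :=
  inferInstanceAs (Module ℂ (smoothFunctions p q))

instance (p q : ℕ) : CoeFun (SmoothFun p q) (fun _ => cone p q → ℂ) :=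
  ⟨fun f => (Subtype.val f : cone p q → ℂ)⟩

/-- The open set of all `(z, w)` with `z ≠ 0` and `w ≠ 0`; it contains the cone. -/
def polarDomain (p q : ℕ) : Set (Vec p q) := {v | v.1 ≠ 0 ∧ v.2 ≠ 0}

/-- The smooth retraction `(z, w) ↦ (z, (‖z‖ / ‖w‖) w)` of `polarDomain` onto the cone. -/
def retraction {p q : ℕ} (v : Vec p q) : Vec p q := (v.1, (‖v.1‖ / ‖v.2‖) • v.2)

theorem retraction_mem_cone {p q : ℕ} {v : Vec p q} (hv : v ∈ polarDomain p q) :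
    retraction v ∈ cone p q := by
  rw [mem_cone_iff]
  refine ⟨fun h => hv.1 (congrArg Prod.fst h), ?_⟩
  have h2 : ‖v.2‖ ≠ 0 := norm_ne_zero_iff.2 hv.2
  simp only [retraction, norm_smul, norm_div, norm_norm]
  field_simp

open Classical in
/-- The pullback of a function on the cone to `polarDomain` along the retraction (and `0` off
`polarDomain`). -/
def pullback {p q : ℕ} (f : cone p q → ℂ) (v : Vec p q) : ℂ :=
  if hv : v ∈ polarDomain p q then f ⟨retraction v, retraction_mem_cone hv⟩ else 0

/-- The usual Fréchet topology of `C^∞(X⁰)`, uniform convergence of all derivatives on compact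
sets. Pulling back along the smooth retraction embeds `C^∞(X⁰)` into `C^∞` of the open set
`polarDomain`, and the topology is the one induced from there: for every `k`, the `k`-th
derivatives of the pullbacks converge uniformly on the compact subsets of `polarDomain`. -/
instance (p q : ℕ) : TopologicalSpace (SmoothFun p q) :=
  ⨅ k : ℕ, TopologicalSpace.induced
    (fun f : SmoothFun p q =>
      UniformOnFun.ofFun {K : Set (Vec p q) | IsCompact K ∧ K ⊆ polarDomain p q}
        (iteratedFDeriv ℝ k (pullback f)))
    inferInstance

/-- The representation `(ρ(g) f)(x) = f(g⁻¹ x)` of `O(2p,2q)` on `C^∞(X⁰)`. -/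
def rho (p q : ℕ) : Representation ℂ (orthogonalGroup p q) (SmoothFun p q) where
  toFun g :=
    { toFun := fun f => ⟨fun x => f (act g⁻¹ x), by
        obtain ⟨F, hF, hf⟩ := f.2
        refine ⟨fun v => F ((g⁻¹ : orthogonalGroup p q).1 v), ?_, fun x => hf (act g⁻¹ x)⟩
        have hg : ContDiff ℝ ∞ fun v => (g⁻¹ : orthogonalGroup p q).1 v :=
          (LinearMap.toContinuousLinearMap
            ((g⁻¹ : orthogonalGroup p q).1 : Vec p q →ₗ[ℝ] Vec p q)).contDiff
        refine hF.comp hg.contDiffOn fun v hv => ?_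
        simpa using hv⟩
      map_add' := fun _ _ => rfl
      map_smul' := fun _ _ => rfl }
  map_one' := by
    ext f
    apply Subtype.ext
    funext x
    change f (act 1⁻¹ x) = f x
    rw [inv_one]
    rfl
  map_mul' g h := by
    ext f
    apply Subtype.ext
    funext x
    change f (act (g * h)⁻¹ x) = f (act h⁻¹ (act g⁻¹ x))
    rw [mul_inv_rev]
    rfl

/-- `S^a(X⁰)`: the smooth functions on the cone with `f(tx) = t^a f(x)` for all real `t > 0`,
as a representation of `O(2p,2q)`. -/
def S (p q : ℕ) (a : ℂ) : Subrepresentation (rho p q) where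
  toSubmodule :=
    { carrier := {f | ∀ (t : ℝ) (ht : 0 < t) (x : cone p q),
        f (dilate (posUnit t ht) x) = (t : ℂ) ^ a * f x}
      zero_mem' := fun t ht x => (mul_zero _).symm
      add_mem' := fun {f g} hf hg t ht x =>
        (congrArg₂ (· + ·) (hf t ht x) (hg t ht x)).trans (mul_add _ _ _).symm
      smul_mem' := fun c f hf t ht x =>
        (congrArg (c * ·) (hf t ht x)).trans (mul_left_comm _ _ _) }
  apply_mem_toSubmodule g f hf t ht x := by
    refine Eq.trans (congrArg f ?_) (hf t ht (act g⁻¹ x))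
    apply Subtype.ext
    change (g⁻¹).1 ((t : ℂ) • (x : Vec p q)) = (t : ℂ) • (g⁻¹).1 x
    rw [Complex.coe_smul, Complex.coe_smul, map_smul]

/-- The character `ψ^{α,β}(t) = t^α conj(t)^β = |t|^{α+β} (t/|t|)^{α-β}` of `ℂˣ`, for complex
`α, β` with `α - β` an integer. -/
def psi (α β : ℂ) (t : ℂˣ) : ℂ :=
  (‖(t : ℂ)‖ : ℂ) ^ (α + β) * ((t : ℂ) / ‖(t : ℂ)‖) ^ (α - β)

/-- `S^{α,β}(X⁰)`: the `ψ^{α,β}`-eigenspace of `S^{α+β}(X⁰)` for the complex scalar dilations, as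
a representation of `U(p,q)`. -/
def Sab (p q : ℕ) (α β : ℂ) :
    Subrepresentation ((rho p q).comp (unitaryToOrthogonal p q)) where
  toSubmodule := (S p q (α + β)).toSubmodule ⊓
    { carrier := {f | ∀ (t : ℂˣ) (x : cone p q), f (dilate t x) = psi α β t * f x}
      zero_mem' := fun t x => (mul_zero _).symm
      add_mem' := fun {f g} hf hg t x =>
        (congrArg₂ (· + ·) (hf t x) (hg t x)).trans (mul_add _ _ _).symm
      smul_mem' := fun c f hf t x =>
        (congrArg (c * ·) (hf t x)).trans (mul_left_comm _ _ _) }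
  apply_mem_toSubmodule g f hf := by
    refine ⟨(S p q (α + β)).apply_mem_toSubmodule _ hf.1, fun t x => ?_⟩
    refine Eq.trans (congrArg f ?_) (hf.2 t (act (unitaryToOrthogonal p q g)⁻¹ x))
    apply Subtype.ext
    exact map_smul (g⁻¹).1 (t : ℂ) (x : Vec p q)

/-- An irreducible representation on a topological vector space: it is nonzero and has no closed
invariant subspaces other than `0` and the whole space. -/
def IsTopIrreducible {G M : Type*} [Group G] [AddCommGroup M] [Module ℂ M] [TopologicalSpace M]
    (σ : Representation ℂ G M) : Prop :=
  Nontrivial M ∧ ∀ N : Subrepresentation σ, IsClosed (N.toSubmodule : Set M) →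
    N.toSubmodule = ⊥ ∨ N.toSubmodule = ⊤

/-- The subquotient `V / W`, for invariant subspaces `W ⊆ V` of `C^∞(X⁰)`, with the quotient of the
subspace topology. -/
abbrev Subquotient {p q : ℕ} (V W : Subrepresentation (rho p q)) : Type :=
  V.toSubmodule ⧸ W.toSubmodule.submoduleOf V.toSubmodule

/-- The representation of `O(2p,2q)` on the subquotient `V / W`. -/
def subquotientRep {p q : ℕ} (V W : Subrepresentation (rho p q)) :
    Representation ℂ (orthogonalGroup p q) (Subquotient V W) :=
  V.toRepresentation.quotient (W.toSubmodule.submoduleOf V.toSubmodule)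
    fun g _ hv => W.apply_mem_toSubmodule g hv

/-- The image of `S^{α,β}(X⁰)` in the subquotient `V / W`, that is, the image of
`V ∩ S^{α,β}(X⁰)` under `V → V / W`, as a representation of `U(p,q)`. -/
def imageSab {p q : ℕ} (V W : Subrepresentation (rho p q)) (α β : ℂ) :
    Subrepresentation ((subquotientRep V W).comp (unitaryToOrthogonal p q)) where
  toSubmodule := ((Sab p q α β).toSubmodule.submoduleOf V.toSubmodule).map
    (W.toSubmodule.submoduleOf V.toSubmodule).mkQ
  apply_mem_toSubmodule g := by
    rintro _ ⟨v, hv, rfl⟩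
    exact ⟨V.toRepresentation (unitaryToOrthogonal p q g) v,
      (Sab p q α β).apply_mem_toSubmodule g hv, rfl⟩

end LightCone

end

open scoped ContDiff ComplexConjugate Topology Quaternion
open MeasureTheory Set

noncomputable section
set_option linter.unusedSectionVars false

namespace LightCone

/-! Since V lies in S^{α+β}, the functions of V in S^{α,β} are those of weight n = α - β under the
unit complex scalars (`mem_Sab_iff`). So the theorem concerns closed U(p,q)-invariant spaces N
between W ∩ `wt p q n` and V ∩ `wt p q n`. It suffices to find a closed O(2p,2q)-invariant space M
that contains W and N and whose functions of weight n all lie in N (`exists_invariant_hull`):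
irreducibility of V/W then forces V ∩ M ≤ W or V ≤ M, so the subspace given by N is zero or
everything.

Modulo u(p,q), the complexified Lie algebra of O(2p,2q) is spanned by the raising and lowering
operators `op 1 u v` and `op (-1) u v`, which shift weights by 2 and -2. The space M is `hull`: a
function of V belongs to it when, for each sign σ and each j, all products of j operators of sign -σ
take its component of weight n + 2σj into N. This is stable under the operators because a raising
operator times a lowering one is a quadratic expression in u(p,q) (`op_one_op_neg_one`,
`op_neg_one_op_one`): a step away from n followed by a step back never leaves a closed
U(p,q)-invariant space.

It remains to pass from the Lie algebra to the group (`precomp_mem`). For closed spaces of smooth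
functions this is not automatic, since Taylor series along orbits need not converge. Reflections
generate O(2p,2q) (`forall_of_reflections`), and U(p,q) moves any anisotropic vector to a real
multiple of the first vector of a definite complex plane; both signs are available because p, q ≥ 2.
Identify the plane with ℍ so that complex scalars act from the right. Left multiplication by unit
quaternions is then in U(p,q), and the reflection is h ↦ -conj h, so only quaternionic conjugation
is left, which is y ↦ -y on the imaginary part.

Averages of f over the unit quaternions against powers of 1 + Re u approximate f, stay in M, and
restrict to polynomials of bounded degree in the imaginary part on each sphere of fixed norm and
real part. On such polynomials the Casimir operator of so(3) separates the degrees l of spherical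
harmonics, on which y ↦ -y is (-1)^l. By interpolation y ↦ -y is a polynomial in the Casimir
operator, and the rotations involved preserve M. Passing to the limit gives the reflection on all of
M. -/

/-! ### Differentiation under the integral sign over a compact parameter space -/

/-- Currying of multilinear maps in the first variable. -/
def curryLeftIso (X E : Type*) [NormedAddCommGroup X] [NormedSpace ℝ X] [NormedAddCommGroup E]
    [NormedSpace ℝ E] (k : ℕ) : (X [×(k + 1)]→L[ℝ] E) ≃L[ℝ] (X →L[ℝ] X [×k]→L[ℝ] E) :=
  (continuousMultilinearCurryLeftEquiv ℝ (fun _ : Fin (k + 1) => X) E).toContinuousLinearEquiv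

/-- The derivative in the second variable is the full derivative composed with the inclusion of the
second factor, so joint smoothness survives each differentiation. This gives joint continuity of all
derivatives when the parameter is a group element. -/
theorem contDiffOn_iteratedFDeriv_snd {P X E : Type*} [NormedAddCommGroup P] [NormedSpace ℝ P]
    [NormedAddCommGroup X] [NormedSpace ℝ X] [NormedAddCommGroup E] [NormedSpace ℝ E]
    {Θ : P → X → E} {Ω : Set (P × X)} (hΩ : IsOpen Ω)
    (h : ContDiffOn ℝ ∞ (fun z : P × X => Θ z.1 z.2) Ω) (k : ℕ) :
    ContDiffOn ℝ ∞ (fun z : P × X => iteratedFDeriv ℝ k (Θ z.1) z.2) Ω := by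
  induction k with
  | zero =>
    simp only [iteratedFDeriv_zero_eq_comp, Function.comp_apply]
    exact (continuousMultilinearCurryFin0 ℝ X E).symm.contDiff.comp_contDiffOn h
  | succ k ih =>
    simp only [iteratedFDeriv_succ_eq_comp_left, Function.comp_apply]
    have hcurry : ContDiff ℝ ∞ fun l : X →L[ℝ] X [×k]→L[ℝ] E =>
        (continuousMultilinearCurryLeftEquiv ℝ (fun _ : Fin (k + 1) => X) E).symm l :=
      LinearIsometryEquiv.contDiff _
    refine hcurry.comp_contDiffOn
      (f := fun z : P × X => fderiv ℝ (iteratedFDeriv ℝ k (Θ z.1)) z.2) ?_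
    have h1 : ContDiffOn ℝ ∞ (fun z : P × X =>
        (fderiv ℝ (fun z : P × X => iteratedFDeriv ℝ k (Θ z.1) z.2) z).comp
          (ContinuousLinearMap.inr ℝ P X)) Ω :=
      (ih.fderiv_of_isOpen hΩ (by simp)).clm_comp contDiffOn_const
    refine h1.congr fun z hz => ?_
    have hd := ((ih.contDiffAt (hΩ.mem_nhds hz)).differentiableAt (by simp)).hasFDerivAt
    have hg : HasFDerivAt (fun x : X => ((z.1, x) : P × X)) (ContinuousLinearMap.inr ℝ P X) z.2 :=
      hasFDerivAt_prodMk_right z.1 z.2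
    exact (HasFDerivAt.comp (g := fun z : P × X => iteratedFDeriv ℝ k (Θ z.1) z.2)
      (f := fun x => (z.1, x)) z.2 hd hg).fderiv

section ParametricIntegral

variable {G X E : Type*} [TopologicalSpace G] [CompactSpace G] [SecondCountableTopology G]
  [MeasurableSpace G] [BorelSpace G] {μ : Measure G} [IsFiniteMeasure μ]
  [NormedAddCommGroup X] [NormedSpace ℝ X] [NormedAddCommGroup E] [NormedSpace ℝ E]

theorem integrable_of_continuous_of_compactSpace {f : G → E} (hf : Continuous f) :
    Integrable f μ := by
  obtain ⟨C, hC⟩ := isCompact_univ.exists_bound_of_continuousOn hf.continuousOn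
  exact Integrable.of_bound hf.aestronglyMeasurable C (Filter.Eventually.of_forall
    fun g => hC g (mem_univ g))

theorem continuous_of_continuousOn_prod {Ψ : G → X → E} {U : Set X}
    (hc : ContinuousOn (fun z : G × X => Ψ z.1 z.2) (univ ×ˢ U)) {x : X} (hx : x ∈ U) :
    Continuous fun g => Ψ g x :=
  continuousOn_univ.1 (hc.comp (f := fun g => (g, x)) (by fun_prop)
    fun g _ => ⟨mem_univ _, hx⟩)

/-- By compactness of `G` the bound at `x` persists, up to 1, on a neighbourhood of `x` that serves
all `g` at once. The constant is the dominating function for differentiation under the integral. -/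
theorem exists_bound_nhds_of_continuousOn_prod {Ψ : G → X → E} {U : Set X} (hU : IsOpen U)
    (hc : ContinuousOn (fun z : G × X => Ψ z.1 z.2) (univ ×ˢ U)) {x : X} (hx : x ∈ U) :
    ∃ C : ℝ, ∀ᶠ y in 𝓝 x, ∀ g, ‖Ψ g y‖ ≤ C := by
  obtain ⟨C, hC⟩ := isCompact_univ.exists_bound_of_continuousOn
    (continuous_of_continuousOn_prod hc hx).continuousOn
  refine ⟨C + 1, ?_⟩
  have key : ∀ g ∈ (univ : Set G), ∀ᶠ z : X × G in 𝓝 x ×ˢ 𝓝 g, ‖Ψ z.2 z.1‖ ≤ C + 1 := by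
    intro g _
    have h1 : ContinuousAt (fun z : X × G => Ψ z.2 z.1) (x, g) := by
      have h2 := (hc.continuousAt (x := (g, x)) ((isOpen_univ.prod hU).mem_nhds ⟨mem_univ _, hx⟩))
      exact ContinuousAt.comp (g := fun z : G × X => Ψ z.1 z.2) (f := Prod.swap) h2
        continuous_swap.continuousAt
    have h3 := h1.norm.eventually (Iio_mem_nhds
      (lt_of_le_of_lt (hC g (mem_univ g)) (lt_add_one C)))
    rw [nhds_prod_eq] at h3
    exact h3.mono fun z hz => le_of_lt hz
  have := isCompact_univ.eventually_forall_of_forall_eventually (x₀ := x)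
    (P := fun y g => ‖Ψ g y‖ ≤ C + 1) (fun g hg => by
      rw [nhds_prod_eq]; exact key g hg)
  exact this.mono fun y hy g => hy g (mem_univ g)

theorem hasFDerivAt_integral_of_continuousOn {Ψ : G → X → E} {U : Set X} (hU : IsOpen U)
    (hd : ∀ g, DifferentiableOn ℝ (Ψ g) U)
    (hc : ContinuousOn (fun z : G × X => Ψ z.1 z.2) (univ ×ˢ U))
    (hc' : ContinuousOn (fun z : G × X => fderiv ℝ (Ψ z.1) z.2) (univ ×ˢ U))
    {x : X} (hx : x ∈ U) :
    HasFDerivAt (fun y => ∫ g, Ψ g y ∂μ) (∫ g, fderiv ℝ (Ψ g) x ∂μ) x := by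
  obtain ⟨C, hC⟩ := exists_bound_nhds_of_continuousOn_prod (Ψ := fun g y => fderiv ℝ (Ψ g) y)
    hU hc' hx
  obtain ⟨s, hs, hsU⟩ := (hC.and (hU.mem_nhds hx)).exists_mem
  refine hasFDerivAt_integral_of_dominated_of_fderiv_le (𝕜 := ℝ)
    (F' := fun y g => fderiv ℝ (Ψ g) y) (bound := fun _ => C) hs ?_ ?_ ?_ ?_ ?_ ?_
  · filter_upwards [hU.mem_nhds hx] with y hy
    exact (continuous_of_continuousOn_prod hc hy).aestronglyMeasurable
  · exact integrable_of_continuous_of_compactSpace (continuous_of_continuousOn_prod hc hx)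
  · exact (continuous_of_continuousOn_prod (Ψ := fun g y => fderiv ℝ (Ψ g) y) hc'
      hx).aestronglyMeasurable
  · exact Filter.Eventually.of_forall fun g y hy => (hsU y hy).1 g
  · exact integrable_const C
  · exact Filter.Eventually.of_forall fun g y hy =>
      ((hd g).differentiableAt (hU.mem_nhds (hsU y hy).2)).hasFDerivAt

variable [CompleteSpace E]

/-- Each order follows from the first-order case applied to the previous derivative; currying is a
continuous linear equivalence and therefore commutes with the integral. -/
theorem hasFTaylorSeriesUpToOn_integral {Ψ : G → X → E} {U : Set X} (hU : IsOpen U)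
    (hd : ∀ g, ContDiffOn ℝ ∞ (Ψ g) U)
    (hc : ∀ k : ℕ, ContinuousOn (fun z : G × X => iteratedFDeriv ℝ k (Ψ z.1) z.2) (univ ×ˢ U)) :
    HasFTaylorSeriesUpToOn ∞ (fun y => ∫ g, Ψ g y ∂μ)
      (fun y k => ∫ g, iteratedFDeriv ℝ k (Ψ g) y ∂μ) U := by
  have hder : ∀ (m : ℕ) (x : X), x ∈ U →
      HasFDerivAt (fun y => ∫ g, iteratedFDeriv ℝ m (Ψ g) y ∂μ)
        (∫ g, iteratedFDeriv ℝ (m + 1) (Ψ g) x ∂μ).curryLeft x := by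
    intro m x hx
    have e : ∀ (g : G) (y : X), fderiv ℝ (iteratedFDeriv ℝ m (Ψ g)) y =
        continuousMultilinearCurryLeftEquiv ℝ (fun _ : Fin (m + 1) => X) E
          (iteratedFDeriv ℝ (m + 1) (Ψ g) y) := by
      intro g y
      rw [iteratedFDeriv_succ_eq_comp_left, Function.comp_apply,
        LinearIsometryEquiv.apply_symm_apply]
    have h := hasFDerivAt_integral_of_continuousOn (μ := μ)
      (Ψ := fun g => iteratedFDeriv ℝ m (Ψ g)) hU
      (fun g y hy => (((hd g).contDiffAt (hU.mem_nhds hy)).differentiableAt_iteratedFDeriv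
        (by exact_mod_cast WithTop.coe_lt_top m)).differentiableWithinAt)
      (hc m) (by
        simp only [e]
        exact (continuousMultilinearCurryLeftEquiv ℝ (fun _ : Fin (m + 1) => X)
          E).continuous.comp_continuousOn (hc (m + 1))) hx
    simp only [e] at h
    have h2 := ContinuousLinearEquiv.integral_comp_comm (𝕜 := ℝ) (E := X [×(m + 1)]→L[ℝ] E)
      (F := X →L[ℝ] X [×m]→L[ℝ] E) (curryLeftIso X E m) (μ := μ) fun g => iteratedFDeriv ℝ (m + 1) (Ψ g) x
    exact h.congr_fderiv h2
  refine ⟨fun x hx => ?_, fun m _ x hx => (hder m x hx).hasFDerivWithinAt,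
    fun m _ x hx => (hder m x hx).continuousAt.continuousWithinAt⟩
  have h2 := (continuousMultilinearCurryFin0 ℝ X E).toContinuousLinearEquiv.integral_comp_comm
    (μ := μ) fun g => iteratedFDeriv ℝ 0 (Ψ g) x
  refine h2.symm.trans (integral_congr_ae (Filter.Eventually.of_forall fun g => ?_))
  rfl

theorem contDiffOn_integral {Ψ : G → X → E} {U : Set X} (hU : IsOpen U)
    (hd : ∀ g, ContDiffOn ℝ ∞ (Ψ g) U)
    (hc : ∀ k : ℕ, ContinuousOn (fun z : G × X => iteratedFDeriv ℝ k (Ψ z.1) z.2) (univ ×ˢ U)) :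
    ContDiffOn ℝ ∞ (fun y => ∫ g, Ψ g y ∂μ) U :=
  (hasFTaylorSeriesUpToOn_integral hU hd hc).contDiffOn

theorem iteratedFDeriv_integral {Ψ : G → X → E} {U : Set X} (hU : IsOpen U)
    (hd : ∀ g, ContDiffOn ℝ ∞ (Ψ g) U)
    (hc : ∀ k : ℕ, ContinuousOn (fun z : G × X => iteratedFDeriv ℝ k (Ψ z.1) z.2) (univ ×ˢ U))
    (k : ℕ) {x : X} (hx : x ∈ U) :
    iteratedFDeriv ℝ k (fun y => ∫ g, Ψ g y ∂μ) x = ∫ g, iteratedFDeriv ℝ k (Ψ g) x ∂μ := by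
  rw [← iteratedFDerivWithin_of_isOpen k hU hx]
  exact ((hasFTaylorSeriesUpToOn_integral hU hd hc).eq_iteratedFDerivWithin_of_uniqueDiffOn
    (by exact_mod_cast le_top) hU.uniqueDiffOn hx).symm

end ParametricIntegral

/-! ### The Fréchet topology in terms of jets of pullbacks -/

variable {p q : ℕ}

theorem SmoothFun.ext {f g : SmoothFun p q} (h : ∀ x, f x = g x) : f = g :=
  Subtype.ext (funext h)

@[simp] theorem SmoothFun.add_apply (f g : SmoothFun p q) (x : cone p q) :
    (f + g) x = f x + g x := rfl

@[simp] theorem SmoothFun.sub_apply (f g : SmoothFun p q) (x : cone p q) :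
    (f - g) x = f x - g x := rfl

@[simp] theorem SmoothFun.smul_apply (c : ℂ) (f : SmoothFun p q) (x : cone p q) :
    (c • f) x = c * f x := rfl

theorem isOpen_polarDomain : IsOpen (polarDomain p q) :=
  (isOpen_ne.preimage continuous_fst).inter (isOpen_ne.preimage continuous_snd)

theorem cone_subset_polarDomain : cone p q ⊆ polarDomain p q := by
  intro v hv
  obtain ⟨h0, h⟩ := (mem_cone_iff v).1 hv
  constructor
  · intro h1
    rw [h1, norm_zero, eq_comm, norm_eq_zero] at h
    exact h0 (Prod.ext h1 h)
  · intro h2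
    rw [h2, norm_zero, norm_eq_zero] at h
    exact h0 (Prod.ext h h2)

theorem retraction_eq_self {v : Vec p q} (hv : v ∈ cone p q) : retraction v = v := by
  have h2 : ‖v.2‖ ≠ 0 := norm_ne_zero_iff.2 (cone_subset_polarDomain hv).2
  rw [retraction, ((mem_cone_iff v).1 hv).2, div_self h2, one_smul]

theorem pullback_of_mem (f : cone p q → ℂ) {v : Vec p q} (hv : v ∈ polarDomain p q) :
    pullback f v = f ⟨retraction v, retraction_mem_cone hv⟩ := dif_pos hv

theorem pullback_of_notMem (f : cone p q → ℂ) {v : Vec p q} (hv : v ∉ polarDomain p q) :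
    pullback f v = 0 := dif_neg hv

theorem pullback_coe (f : cone p q → ℂ) (x : cone p q) : pullback f x = f x := by
  rw [pullback_of_mem f (cone_subset_polarDomain x.2)]
  congr 1
  exact Subtype.ext (retraction_eq_self x.2)

theorem contDiffOn_retraction : ContDiffOn ℝ ∞ (retraction (p := p) (q := q))
    (polarDomain p q) := by
  intro v hv
  refine ContDiffAt.contDiffWithinAt ?_
  have h1 : ContDiffAt ℝ ∞ (fun v : Vec p q => ‖v.1‖) v := contDiffAt_fst.norm ℂ hv.1
  have h2 : ContDiffAt ℝ ∞ (fun v : Vec p q => ‖v.2‖) v := contDiffAt_snd.norm ℂ hv.2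
  exact contDiffAt_fst.prodMk ((h1.div h2 (norm_ne_zero_iff.2 hv.2)).smul contDiffAt_snd)

theorem retraction_mapsTo :
    MapsTo (retraction (p := p) (q := q)) (polarDomain p q) (polarDomain p q) :=
  fun _ hv => cone_subset_polarDomain (retraction_mem_cone hv)

theorem SmoothFun.contDiffOn_pullback (f : SmoothFun p q) :
    ContDiffOn ℝ ∞ (pullback f) (polarDomain p q) := by
  obtain ⟨F, hF, hf⟩ := f.2
  refine (hF.comp contDiffOn_retraction fun v hv => (retraction_mem_cone hv).1).congr fun v hv => ?_
  rw [pullback_of_mem _ hv]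
  exact (hf _).symm

theorem SmoothFun.contDiffAt_pullback (f : SmoothFun p q) {v : Vec p q}
    (hv : v ∈ polarDomain p q) : ContDiffAt ℝ ∞ (pullback f) v :=
  f.contDiffOn_pullback.contDiffAt (isOpen_polarDomain.mem_nhds hv)

theorem pullback_add (f g : SmoothFun p q) :
    pullback (f + g : SmoothFun p q) = pullback f + pullback g := by
  ext v
  by_cases hv : v ∈ polarDomain p q
  · simp [pullback_of_mem _ hv]
  · simp [pullback_of_notMem _ hv]

theorem pullback_sub (f g : SmoothFun p q) :
    pullback (f - g : SmoothFun p q) = pullback f - pullback g := by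
  ext v
  by_cases hv : v ∈ polarDomain p q
  · simp [pullback_of_mem _ hv]
  · simp [pullback_of_notMem _ hv]

theorem pullback_smul (c : ℂ) (f : SmoothFun p q) :
    pullback (c • f : SmoothFun p q) = c • pullback f := by
  ext v
  by_cases hv : v ∈ polarDomain p q
  · simp [pullback_of_mem _ hv]
  · simp [pullback_of_notMem _ hv]

/-- All derivatives of `F` up to order `k` are smaller than `δ` on `K`. -/
def JetBound {X E : Type*} [NormedAddCommGroup X] [NormedSpace ℝ X] [NormedAddCommGroup E]
    [NormedSpace ℝ E] (k : ℕ) (K : Set X) (δ : ℝ) (F : X → E) : Prop :=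
  ∀ i ≤ k, ∀ x ∈ K, ‖iteratedFDeriv ℝ i F x‖ < δ

theorem JetBound.mono {X E : Type*} [NormedAddCommGroup X] [NormedSpace ℝ X]
    [NormedAddCommGroup E] [NormedSpace ℝ E] {k k' : ℕ} {K K' : Set X} {δ δ' : ℝ} {F : X → E}
    (h : JetBound k' K' δ' F) (hk : k ≤ k') (hK : K ⊆ K') (hδ : δ' ≤ δ) : JetBound k K δ F :=
  fun i hi x hx => (h i (hi.trans hk) x (hK hx)).trans_le hδ

theorem iteratedFDeriv_pullback_sub (f g : SmoothFun p q) (i : ℕ) {x : Vec p q}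
    (hx : x ∈ polarDomain p q) :
    iteratedFDeriv ℝ i (pullback (f - g : SmoothFun p q)) x =
      iteratedFDeriv ℝ i (pullback f) x - iteratedFDeriv ℝ i (pullback g) x := by
  rw [pullback_sub]
  exact iteratedFDeriv_sub_apply ((f.contDiffAt_pullback hx).of_le (by exact_mod_cast le_top))
    ((g.contDiffAt_pullback hx).of_le (by exact_mod_cast le_top))

/-- The filter of jet neighbourhoods of `f`. -/
def jetFilter (f : SmoothFun p q) : Filter (SmoothFun p q) where
  sets := {s | ∃ (k : ℕ) (K : Set (Vec p q)) (ε : ℝ), IsCompact K ∧ K ⊆ polarDomain p q ∧ 0 < ε ∧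
    ∀ h : SmoothFun p q, JetBound k K ε (pullback (h - f : SmoothFun p q)) → h ∈ s}
  univ_sets := ⟨0, ∅, 1, isCompact_empty, empty_subset _, one_pos, fun _ _ => mem_univ _⟩
  sets_of_superset := by
    rintro s t ⟨k, K, ε, h1, h2, h3, h4⟩ hst
    exact ⟨k, K, ε, h1, h2, h3, fun h hh => hst (h4 h hh)⟩
  inter_sets := by
    rintro s t ⟨k, K, ε, h1, h2, h3, h4⟩ ⟨k', K', ε', h1', h2', h3', h4'⟩
    exact ⟨max k k', K ∪ K', min ε ε', h1.union h1', union_subset h2 h2', lt_min h3 h3',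
      fun h hh => ⟨h4 h (hh.mono (le_max_left _ _) subset_union_left (min_le_left _ _)),
        h4' h (hh.mono (le_max_right _ _) subset_union_right (min_le_right _ _))⟩⟩

/-- The defining topology controls one order of differentiation at a time. Finite intersections
bound all orders up to `k`, and compact sets are directed under union, so the triples of order,
compact set and bound suffice. -/
theorem nhds_eq_jetFilter (f : SmoothFun p q) : 𝓝 f = jetFilter f := by
  have hne : {K : Set (Vec p q) | IsCompact K ∧ K ⊆ polarDomain p q}.Nonempty :=
    ⟨∅, isCompact_empty, empty_subset _⟩
  have hdir : DirectedOn (· ⊆ ·) {K : Set (Vec p q) | IsCompact K ∧ K ⊆ polarDomain p q} :=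
    fun K hK L hL => ⟨K ∪ L, ⟨hK.1.union hL.1, union_subset hK.2 hL.2⟩, subset_union_left,
      subset_union_right⟩
  have hb : ∀ k : ℕ, (Filter.comap (fun f : SmoothFun p q =>
      UniformOnFun.ofFun {K : Set (Vec p q) | IsCompact K ∧ K ⊆ polarDomain p q}
        (iteratedFDeriv ℝ k (pullback f))) (𝓝 (UniformOnFun.ofFun _
        (iteratedFDeriv ℝ k (pullback f))))).HasBasis
      (fun z : Set (Vec p q) × ℝ => (IsCompact z.1 ∧ z.1 ⊆ polarDomain p q) ∧ 0 < z.2)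
      (fun z => {h | ∀ x ∈ z.1, ‖iteratedFDeriv ℝ k (pullback (h - f : SmoothFun p q)) x‖ < z.2}) := by
    intro k
    refine ((UniformOnFun.hasBasis_nhds_of_basis _ _ _ _ hne hdir
      Metric.uniformity_basis_dist).comap _).to_hasBasis ?_ ?_
    · rintro ⟨K, ε⟩ ⟨hK, hε⟩
      refine ⟨⟨K, ε⟩, ⟨hK, hε⟩, fun h hh x hx => ?_⟩
      have := hh x hx
      rw [iteratedFDeriv_pullback_sub _ _ _ (hK.2 hx), ← dist_eq_norm] at this
      exact this
    · rintro ⟨K, ε⟩ ⟨hK, hε⟩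
      refine ⟨⟨K, ε⟩, ⟨hK, hε⟩, fun h hh x hx => ?_⟩
      rw [iteratedFDeriv_pullback_sub _ _ _ (hK.2 hx), ← dist_eq_norm]
      exact hh x hx
  have hn : 𝓝 f = ⨅ k : ℕ, Filter.comap (fun f : SmoothFun p q =>
      UniformOnFun.ofFun {K : Set (Vec p q) | IsCompact K ∧ K ⊆ polarDomain p q}
        (iteratedFDeriv ℝ k (pullback f))) (𝓝 (UniformOnFun.ofFun _
        (iteratedFDeriv ℝ k (pullback f)))) := by
    refine (nhds_iInf).trans (iInf_congr fun k => ?_)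
    exact nhds_induced _ _
  rw [hn]
  refine le_antisymm ?_ (le_iInf fun k => ?_)
  · rintro s ⟨k, K, ε, h1, h2, h3, h4⟩
    have : (⋂ i ∈ Finset.range (k + 1), {h : SmoothFun p q |
        ∀ x ∈ K, ‖iteratedFDeriv ℝ i (pullback (h - f : SmoothFun p q)) x‖ < ε}) ∈ 𝓝 f := by
      rw [Filter.biInter_finset_mem, hn]
      exact fun i _ => Filter.mem_iInf_of_mem i ((hb i).mem_of_mem (i := (K, ε)) ⟨⟨h1, h2⟩, h3⟩)
    rw [← hn]
    refine Filter.mem_of_superset this fun h hh => h4 h fun i hi x hx => ?_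
    exact mem_iInter₂.1 hh i (Finset.mem_range.2 (Nat.lt_succ_of_le hi)) x hx
  · intro s hs
    obtain ⟨⟨K, ε⟩, ⟨⟨h1, h2⟩, h3⟩, h4⟩ := (hb k).mem_iff.1 hs
    exact ⟨k, K, ε, h1, h2, h3, fun h hh => h4 fun x hx => hh k le_rfl x hx⟩

theorem mem_nhds_iff_jetBound {f : SmoothFun p q} {s : Set (SmoothFun p q)} :
    s ∈ 𝓝 f ↔ ∃ (k : ℕ) (K : Set (Vec p q)) (ε : ℝ), IsCompact K ∧ K ⊆ polarDomain p q ∧ 0 < ε ∧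
    ∀ h : SmoothFun p q, JetBound k K ε (pullback (h - f : SmoothFun p q)) → h ∈ s := by
  rw [nhds_eq_jetFilter]; rfl

theorem mem_closure_iff_jetBound {f : SmoothFun p q} {s : Set (SmoothFun p q)} :
    f ∈ closure s ↔ ∀ (k : ℕ) (K : Set (Vec p q)) (ε : ℝ), IsCompact K → K ⊆ polarDomain p q →
      0 < ε → ∃ h ∈ s, JetBound k K ε (pullback (h - f : SmoothFun p q)) := by
  rw [mem_closure_iff_nhds]
  constructor
  · intro H k K ε h1 h2 h3
    obtain ⟨h, hh, hs⟩ := H _ (mem_nhds_iff_jetBound.2 ⟨k, K, ε, h1, h2, h3, fun h hh => hh⟩)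
    exact ⟨h, hs, hh⟩
  · intro H t ht
    obtain ⟨k, K, ε, h1, h2, h3, h4⟩ := mem_nhds_iff_jetBound.1 ht
    obtain ⟨h, hs, hh⟩ := H k K ε h1 h2 h3
    exact ⟨h, h4 h hh, hs⟩

/-- The usual seminorm criterion for linear maps, stated with strict bounds and scaled by `δ` so
that no suprema over compact sets are needed. -/
theorem continuous_of_jetBound (T : SmoothFun p q →ₗ[ℂ] SmoothFun p q)
    (hT : ∀ (k : ℕ) (K : Set (Vec p q)), IsCompact K → K ⊆ polarDomain p q →
      ∃ (k' : ℕ) (K' : Set (Vec p q)) (C : ℝ), IsCompact K' ∧ K' ⊆ polarDomain p q ∧ 0 < C ∧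
        ∀ (f : SmoothFun p q) (δ : ℝ), 0 < δ → JetBound k' K' δ (pullback f) →
          JetBound k K (C * δ) (pullback (T f))) : Continuous T := by
  refine continuous_iff_continuousAt.2 fun f s hs => ?_
  obtain ⟨k, K, ε, h1, h2, h3, h4⟩ := mem_nhds_iff_jetBound.1 hs
  obtain ⟨k', K', C, h1', h2', h3', h4'⟩ := hT k K h1 h2
  refine mem_nhds_iff_jetBound.2 ⟨k', K', ε / C, h1', h2', div_pos h3 h3', fun h hh => ?_⟩
  refine h4 _ ?_
  have := h4' (h - f) (ε / C) (div_pos h3 h3') hh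
  rwa [mul_div_cancel₀ _ h3'.ne', map_sub] at this

instance : ContinuousConstSMul ℂ (SmoothFun p q) where
  continuous_const_smul c := by
    refine continuous_of_jetBound (LinearMap.lsmul ℂ (SmoothFun p q) c) fun k K h1 h2 => ?_
    refine ⟨k, K, ‖c‖ + 1, h1, h2, by positivity, fun f δ hδ hf i hi x hx => ?_⟩
    rw [LinearMap.lsmul_apply, pullback_smul, iteratedFDeriv_const_smul_apply
      ((f.contDiffAt_pullback (h2 hx)).of_le (by exact_mod_cast le_top)), norm_smul]
    have := hf i hi x hx
    nlinarith [norm_nonneg c, norm_nonneg (iteratedFDeriv ℝ i (pullback f) x)]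

instance : ContinuousAdd (SmoothFun p q) where
  continuous_add := by
    refine continuous_iff_continuousAt.2 fun z s hs => ?_
    obtain ⟨k, K, ε, h1, h2, h3, h4⟩ := mem_nhds_iff_jetBound.1 hs
    have hn : ∀ f : SmoothFun p q, {h : SmoothFun p q |
        JetBound k K (ε / 2) (pullback (h - f : SmoothFun p q))} ∈ 𝓝 f := fun f =>
      mem_nhds_iff_jetBound.2 ⟨k, K, ε / 2, h1, h2, half_pos h3, fun h hh => hh⟩
    refine Filter.mem_map.2 (Filter.mem_of_superset (prod_mem_nhds (hn z.1) (hn z.2)) ?_)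
    rintro w ⟨hw1, hw2⟩
    refine h4 _ fun i hi x hx => ?_
    have e : w.1 + w.2 - (z.1 + z.2) = (w.1 - z.1) + (w.2 - z.2) := by abel
    rw [e, pullback_add, iteratedFDeriv_add_apply
      (((w.1 - z.1).contDiffAt_pullback (h2 hx)).of_le (by exact_mod_cast le_top))
      (((w.2 - z.2).contDiffAt_pullback (h2 hx)).of_le (by exact_mod_cast le_top))]
    exact (norm_add_le _ _).trans_lt ((add_lt_add (hw1 i hi x hx) (hw2 i hi x hx)).trans_eq
      (add_halves ε))

theorem continuous_eval (x : cone p q) : Continuous fun f : SmoothFun p q => f x := by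
  refine continuous_iff_continuousAt.2 fun f => ?_
  rw [ContinuousAt, Metric.tendsto_nhds]
  intro ε hε
  refine mem_nhds_iff_jetBound.2 ⟨0, {(x : Vec p q)}, ε, isCompact_singleton,
    singleton_subset_iff.2 (cone_subset_polarDomain x.2), hε, fun h hh => ?_⟩
  have := hh 0 le_rfl x rfl
  rw [norm_iteratedFDeriv_zero, pullback_coe] at this
  rw [mem_ofPred_eq, dist_eq_norm]
  exact this

/-- The estimate for derivatives of a composite, with constants uniform in the compact parameter:
`K'` is the image of `G × K`, and the derivatives of `Φ` are bounded on `G × K` by compactness. -/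
theorem JetBound.comp {X Y E G : Type*} [NormedAddCommGroup X] [NormedSpace ℝ X]
    [NormedAddCommGroup Y] [NormedSpace ℝ Y] [NormedAddCommGroup E] [NormedSpace ℝ E]
    [TopologicalSpace G] [CompactSpace G]
    {U : Set X} {U' : Set Y} (hU : IsOpen U) (hU' : IsOpen U') (Φ : G → X → Y)
    (hΦ : ∀ g, ContDiffOn ℝ ∞ (Φ g) U) (hmaps : ∀ g, MapsTo (Φ g) U U')
    (hc : ∀ k : ℕ, ContinuousOn (fun z : G × X => iteratedFDeriv ℝ k (Φ z.1) z.2) (univ ×ˢ U))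
    (k : ℕ) {K : Set X} (hK : IsCompact K) (hKU : K ⊆ U) :
    ∃ (K' : Set Y) (C : ℝ), IsCompact K' ∧ K' ⊆ U' ∧ 0 < C ∧
      ∀ (H : Y → E), ContDiffOn ℝ ∞ H U' → ∀ δ : ℝ, 0 < δ → JetBound k K' δ H →
        ∀ g, JetBound k K (C * δ) (H ∘ Φ g) := by
  have hcomp : IsCompact ((univ : Set G) ×ˢ K) := isCompact_univ.prod hK
  have hsub : (univ : Set G) ×ˢ K ⊆ univ ×ˢ U := prod_mono le_rfl hKU
  have hc0 : ContinuousOn (fun z : G × X => Φ z.1 z.2) (univ ×ˢ U) := by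
    have := (continuousMultilinearCurryFin0 ℝ X Y).continuous.comp_continuousOn (hc 0)
    exact this
  choose B hB using fun i => hcomp.exists_bound_of_continuousOn ((hc i).mono hsub)
  let D : ℝ := 1 + ∑ i ∈ Finset.range (k + 1), |B i|
  have hD1 : 1 ≤ D := le_add_of_nonneg_right (Finset.sum_nonneg fun i _ => abs_nonneg _)
  have hBD : ∀ i ≤ k, B i ≤ D := fun i hi => (le_abs_self _).trans
    ((Finset.single_le_sum (f := fun i => |B i|) (fun i _ => abs_nonneg _)
      (Finset.mem_range.2 (Nat.lt_succ_of_le hi))).trans (le_add_of_nonneg_left zero_le_one))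
  -- `D ≥ 1` gives `D ≤ D ^ j` for `j ≥ 1` and `D ^ i ≤ D ^ k`; the extra 1 turns the weak estimate
  -- of the composite into a strict one.
  refine ⟨(fun z : G × X => Φ z.1 z.2) '' (univ ×ˢ K), (k.factorial : ℝ) * D ^ k + 1,
    hcomp.image_of_continuousOn (hc0.mono hsub), ?_, by positivity, ?_⟩
  · rintro _ ⟨z, hz, rfl⟩
    exact hmaps z.1 (hKU hz.2)
  intro H hH δ hδ hJ g i hi x hx
  have h1 : ‖iteratedFDerivWithin ℝ i (H ∘ Φ g) U x‖ ≤ i.factorial * δ * D ^ i := by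
    refine norm_iteratedFDerivWithin_comp_le (N := ∞) hH (hΦ g) (by exact_mod_cast le_top)
      hU'.uniqueDiffOn hU.uniqueDiffOn (hmaps g) (hKU hx) (fun j hj => ?_) (fun j hj1 hj => ?_)
    · rw [iteratedFDerivWithin_of_isOpen j hU' (hmaps g (hKU hx))]
      exact (hJ j (hj.trans hi) _ ⟨(g, x), ⟨mem_univ _, hx⟩, rfl⟩).le
    · rw [iteratedFDerivWithin_of_isOpen j hU (hKU hx)]
      refine ((hB j (g, x) ⟨mem_univ _, hx⟩).trans (hBD j (hj.trans hi))).trans ?_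
      exact le_self_pow₀ hD1 (by omega)
  rw [iteratedFDerivWithin_of_isOpen i hU (hKU hx)] at h1
  refine h1.trans_lt ?_
  have h2 : (i.factorial : ℝ) * D ^ i ≤ k.factorial * D ^ k := by
    gcongr
  nlinarith


/-! ### Composition with isometries and averages over compact groups -/

variable {p q : ℕ}

/-- An element of `O(2p,2q)` as a continuous linear map. -/
def toCLM (g : orthogonalGroup p q) : Vec p q →L[ℝ] Vec p q :=
  LinearMap.toContinuousLinearMap (g.1 : Vec p q →ₗ[ℝ] Vec p q)

@[simp] theorem toCLM_apply (g : orthogonalGroup p q) (v : Vec p q) : toCLM g v = g.1 v := rfl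

/-- Composition with an element of `O(2p,2q)`. -/
def precomp (g : orthogonalGroup p q) : SmoothFun p q →ₗ[ℂ] SmoothFun p q := rho p q g⁻¹

theorem precomp_apply (g : orthogonalGroup p q) (f : SmoothFun p q) (x : cone p q) :
    precomp g f x = f (act g x) := by
  change f (act g⁻¹⁻¹ x) = _
  rw [inv_inv]

theorem rho_eq_precomp (g : orthogonalGroup p q) : rho p q g = precomp g⁻¹ := by
  rw [precomp, inv_inv]

theorem precomp_one (f : SmoothFun p q) : precomp 1 f = f := by
  rw [precomp, inv_one, map_one]; rfl

theorem precomp_precomp (g h : orthogonalGroup p q) (f : SmoothFun p q) :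
    precomp g (precomp h f) = precomp (h * g) f := by
  rw [precomp, precomp, precomp, mul_inv_rev, map_mul]; rfl

theorem apply_retraction_mem_cone (g : orthogonalGroup p q) {x : Vec p q}
    (hx : x ∈ polarDomain p q) : g.1 (retraction x) ∈ cone p q :=
  apply_mem_cone g (retraction_mem_cone hx)

/-- The retraction is not equivariant under all of O(2p,2q), so a translate is pulled back through
`A (retraction x)`. This makes sense for all linear maps `A` near the group and is jointly smooth in
`A` and `x` on `orbitDomain`. -/
theorem pullback_precomp (g : orthogonalGroup p q) (f : SmoothFun p q) {x : Vec p q}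
    (hx : x ∈ polarDomain p q) :
    pullback (precomp g f) x = pullback f (toCLM g (retraction x)) := by
  rw [pullback_of_mem _ hx, precomp_apply]
  exact (pullback_coe f ⟨_, apply_retraction_mem_cone g hx⟩).symm

theorem iteratedFDeriv_pullback_precomp (g : orthogonalGroup p q) (f : SmoothFun p q) (k : ℕ)
    {x : Vec p q} (hx : x ∈ polarDomain p q) :
    iteratedFDeriv ℝ k (pullback (precomp g f)) x =
      iteratedFDeriv ℝ k (fun y => pullback f (toCLM g (retraction y))) x :=
  (Filter.EventuallyEq.iteratedFDeriv ℝ (Filter.eventuallyEq_of_mem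
    (isOpen_polarDomain.mem_nhds hx) fun _ hy => pullback_precomp g f hy) k).self_of_nhds

/-- The pairs `(A, x)` for which `A (retraction x)` is in the domain of pullbacks. -/
def orbitDomain (p q : ℕ) : Set ((Vec p q →L[ℝ] Vec p q) × Vec p q) :=
  (univ ×ˢ polarDomain p q) ∩ (fun z => z.1 (retraction z.2)) ⁻¹' polarDomain p q

theorem contDiffOn_apply_retraction :
    ContDiffOn ℝ ∞ (fun z : (Vec p q →L[ℝ] Vec p q) × Vec p q => z.1 (retraction z.2))
      (univ ×ˢ polarDomain p q) :=
  contDiffOn_fst.clm_apply (contDiffOn_retraction.comp contDiffOn_snd fun _ hz => hz.2)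

theorem isOpen_orbitDomain : IsOpen (orbitDomain p q) :=
  contDiffOn_apply_retraction.continuousOn.isOpen_inter_preimage
    (isOpen_univ.prod isOpen_polarDomain) isOpen_polarDomain

theorem contDiffOn_orbit (f : SmoothFun p q) :
    ContDiffOn ℝ ∞ (fun z : (Vec p q →L[ℝ] Vec p q) × Vec p q => pullback f (z.1 (retraction z.2)))
      (orbitDomain p q) :=
  f.contDiffOn_pullback.comp (contDiffOn_apply_retraction.mono inter_subset_left)
    fun _ hz => hz.2

theorem mem_orbitDomain (g : orthogonalGroup p q) {x : Vec p q} (hx : x ∈ polarDomain p q) :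
    (toCLM g, x) ∈ orbitDomain p q :=
  ⟨⟨mem_univ _, hx⟩, cone_subset_polarDomain (apply_retraction_mem_cone g hx)⟩

section Family

variable {G : Type*} [TopologicalSpace G] {a : G → orthogonalGroup p q}

theorem continuousOn_iteratedFDeriv_family {P X E : Type*} [NormedAddCommGroup P]
    [NormedSpace ℝ P] [NormedAddCommGroup X] [NormedSpace ℝ X] [NormedAddCommGroup E]
    [NormedSpace ℝ E] {Θ : P → X → E} {Ω : Set (P × X)} (hΩ : IsOpen Ω)
    (h : ContDiffOn ℝ ∞ (fun z : P × X => Θ z.1 z.2) Ω) {b : G → P} (hb : Continuous b)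
    {U : Set X} (hbU : ∀ g, ∀ x ∈ U, (b g, x) ∈ Ω) (k : ℕ) :
    ContinuousOn (fun z : G × X => iteratedFDeriv ℝ k (Θ (b z.1)) z.2) (univ ×ˢ U) :=
  (contDiffOn_iteratedFDeriv_snd hΩ h k).continuousOn.comp
    (f := fun z : G × X => (b z.1, z.2)) (by fun_prop) fun z hz => hbU z.1 z.2 hz.2

theorem continuousOn_iteratedFDeriv_precomp (ha : Continuous fun g => toCLM (a g))
    (f : SmoothFun p q) (k : ℕ) :
    ContinuousOn (fun z : G × Vec p q => iteratedFDeriv ℝ k (pullback (precomp (a z.1) f)) z.2)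
      (univ ×ˢ polarDomain p q) :=
  (continuousOn_iteratedFDeriv_family (Θ := fun A x => pullback f (A (retraction x)))
    isOpen_orbitDomain (contDiffOn_orbit f) ha (fun g _ hx => mem_orbitDomain (a g) hx) k).congr
    fun z hz => iteratedFDeriv_pullback_precomp (a z.1) f k hz.2

theorem jetBound_precomp [CompactSpace G] (ha : Continuous fun g => toCLM (a g)) (k : ℕ)
    {K : Set (Vec p q)} (hK : IsCompact K) (hKU : K ⊆ polarDomain p q) :
    ∃ (K' : Set (Vec p q)) (C : ℝ), IsCompact K' ∧ K' ⊆ polarDomain p q ∧ 0 < C ∧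
      ∀ (f : SmoothFun p q) (δ : ℝ), 0 < δ → JetBound k K' δ (pullback f) →
        ∀ g, JetBound k K (C * δ) (pullback (precomp (a g) f)) := by
  obtain ⟨K', C, h1, h2, h3, h4⟩ := JetBound.comp (E := ℂ) isOpen_polarDomain
    (isOpen_polarDomain (p := p) (q := q)) (fun g x => toCLM (a g) (retraction x))
    (fun g => (toCLM (a g)).contDiff.comp_contDiffOn contDiffOn_retraction)
    (fun g x hx => cone_subset_polarDomain (apply_retraction_mem_cone (a g) hx))
    (continuousOn_iteratedFDeriv_family (Θ := fun A x => A (retraction x))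
      (isOpen_univ.prod isOpen_polarDomain) contDiffOn_apply_retraction ha
      (fun g x hx => ⟨mem_univ _, hx⟩)) k hK hKU
  refine ⟨K', C, h1, h2, h3, fun f δ hδ hf g i hi x hx => ?_⟩
  rw [iteratedFDeriv_pullback_precomp _ _ _ (hKU hx)]
  exact h4 _ f.contDiffOn_pullback δ hδ hf g i hi x hx

end Family

theorem continuous_precomp (g : orthogonalGroup p q) : Continuous (precomp g) := by
  refine continuous_of_jetBound _ fun k K hK hKU => ?_
  obtain ⟨K', C, h1, h2, h3, h4⟩ := jetBound_precomp (G := Unit) (a := fun _ => g)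
    continuous_const k hK hKU
  exact ⟨k, K', C, h1, h2, h3, fun f δ hδ hf => h4 f δ hδ hf ()⟩

section Average

variable {G : Type*} [TopologicalSpace G] [CompactSpace G] [SecondCountableTopology G]
  [MeasurableSpace G] [BorelSpace G] (μ : Measure G) [IsFiniteMeasure μ]
  {a : G → orthogonalGroup p q} (ha : Continuous fun g => toCLM (a g))
  {φ : G → ℂ} (hφ : Continuous φ)

/-- The average `x ↦ ∫ φ(g) f(a(g) x) dμ(g)`. -/
def average : SmoothFun p q →ₗ[ℂ] SmoothFun p q where
  toFun f := ⟨fun x => ∫ g, φ g * f (act (a g) x) ∂μ, by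
    obtain ⟨F, hF, hf⟩ := f.2
    have hΩ : IsOpen {z : (Vec p q →L[ℝ] Vec p q) × Vec p q | z.1 z.2 ≠ 0} :=
      isOpen_ne.preimage (f := fun z : (Vec p q →L[ℝ] Vec p q) × Vec p q => z.1 z.2) (by fun_prop)
    have hΘ : ContDiffOn ℝ ∞ (fun z : (Vec p q →L[ℝ] Vec p q) × Vec p q => F (z.1 z.2))
        {z | z.1 z.2 ≠ 0} :=
      hF.comp (contDiff_fst.clm_apply contDiff_snd).contDiffOn fun z hz => hz
    have hne : ∀ g, ∀ x ∈ ({0}ᶜ : Set (Vec p q)), toCLM (a g) x ≠ 0 := fun g x hx =>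
      (LinearEquiv.map_ne_zero_iff _).2 hx
    have hsm : ∀ g, ContDiffOn ℝ ∞ (fun x => F (toCLM (a g) x)) {0}ᶜ := fun g =>
      hF.comp (toCLM (a g)).contDiff.contDiffOn (hne g)
    refine ⟨fun v => ∫ g, φ g • F (toCLM (a g) v) ∂μ, ?_, fun x => ?_⟩
    · refine contDiffOn_integral isOpen_compl_singleton
        (fun g => (hsm g).const_smul (φ g)) fun k => ?_
      have h := continuousOn_iteratedFDeriv_family (Θ := fun A x => F (A x)) hΩ hΘ ha hne k
      refine ((hφ.comp continuous_fst).continuousOn.smul h).congr fun z hz => ?_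
      exact iteratedFDeriv_const_smul_apply (f := fun x => F (toCLM (a z.1) x)) (a := φ z.1)
        ((((hsm z.1).contDiffAt
        (isOpen_compl_singleton.mem_nhds hz.2))).of_le (by exact_mod_cast le_top))
    · refine integral_congr_ae (Filter.Eventually.of_forall fun g => ?_)
      exact congrArg (φ g * ·) (hf (act (a g) x))⟩
  map_add' f h := by
    refine SmoothFun.ext fun x => ?_
    have hi : ∀ f : SmoothFun p q, Integrable (fun g => φ g * f (act (a g) x)) μ := fun f => by
      refine integrable_of_continuous_of_compactSpace (hφ.mul ?_)
      have := continuous_of_continuousOn_prod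
        (Ψ := fun g y => iteratedFDeriv ℝ 0 (pullback (precomp (a g) f)) y) (continuousOn_iteratedFDeriv_precomp ha f 0)
        (cone_subset_polarDomain x.2)
      have h2 := (continuousMultilinearCurryFin0 ℝ (Vec p q) ℂ).continuous.comp this
      refine h2.congr fun g => ?_
      refine Eq.trans ?_ (precomp_apply (a g) f x)
      exact pullback_coe (precomp (a g) f) x
    change ∫ g, φ g * (f (act (a g) x) + h (act (a g) x)) ∂μ = _
    simp only [mul_add]
    exact integral_add (hi f) (hi h)
  map_smul' c f := by
    refine SmoothFun.ext fun x => ?_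
    change ∫ g, φ g * (c * f (act (a g) x)) ∂μ = c * ∫ g, φ g * f (act (a g) x) ∂μ
    rw [← integral_const_mul]
    simp only [mul_left_comm]

theorem average_apply (f : SmoothFun p q) (x : cone p q) :
    average μ ha hφ f x = ∫ g, φ g * f (act (a g) x) ∂μ := rfl

theorem iteratedFDeriv_average (f : SmoothFun p q) (k : ℕ) {x : Vec p q}
    (hx : x ∈ polarDomain p q) :
    iteratedFDeriv ℝ k (pullback (average μ ha hφ f)) x =
      ∫ g, φ g • iteratedFDeriv ℝ k (pullback (precomp (a g) f)) x ∂μ := by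
  have e : ∀ (g : G) (k : ℕ), ∀ x ∈ polarDomain p q,
      iteratedFDeriv ℝ k (fun y => φ g • pullback (precomp (a g) f) y) x =
        φ g • iteratedFDeriv ℝ k (pullback (precomp (a g) f)) x := fun g k x hx =>
    iteratedFDeriv_const_smul_apply (a := φ g) (((precomp (a g) f).contDiffAt_pullback hx).of_le
      (by exact_mod_cast le_top))
  have h := iteratedFDeriv_integral (μ := μ)
    (Ψ := fun g x => φ g • pullback (precomp (a g) f) x) isOpen_polarDomain
    (fun g => (precomp (a g) f).contDiffOn_pullback.const_smul (φ g)) (fun k =>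
      ((hφ.comp continuous_fst).continuousOn.smul
        (continuousOn_iteratedFDeriv_precomp ha f k)).congr fun z hz => e z.1 k z.2 hz.2) k hx
  simp only [e _ k x hx] at h
  rw [← h]
  refine (Filter.EventuallyEq.iteratedFDeriv ℝ (Filter.eventuallyEq_of_mem
    (isOpen_polarDomain.mem_nhds hx) fun y hy => ?_) k).self_of_nhds
  rw [pullback_of_mem _ hy, average_apply]
  refine integral_congr_ae (Filter.Eventually.of_forall fun g => ?_)
  simp only [pullback_of_mem _ hy, precomp_apply, smul_eq_mul]

theorem continuous_average : Continuous (average μ ha hφ) := by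
  refine continuous_of_jetBound _ fun k K hK hKU => ?_
  obtain ⟨K', C, h1, h2, h3, h4⟩ := jetBound_precomp ha k hK hKU
  obtain ⟨B, hB⟩ := isCompact_univ.exists_bound_of_continuousOn hφ.continuousOn
  refine ⟨k, K', (|B| * C) * μ.real univ + 1, h1, h2, by positivity,
    fun f δ hδ hf i hi x hx => ?_⟩
  rw [iteratedFDeriv_average μ ha hφ f i (hKU hx)]
  refine (norm_integral_le_of_norm_le_const (C := |B| * (C * δ))
    (Filter.Eventually.of_forall fun g => ?_)).trans_lt ?_
  · rw [norm_smul]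
    gcongr
    · exact (hB g (mem_univ g)).trans (le_abs_self B)
    · exact (h4 f δ hδ hf g i hi x hx).le
  · nlinarith

/-- The space of `k`-jets. -/
def JetSpace (p q k : ℕ) : Type := (i : Fin (k + 1)) → Vec p q [×(i : ℕ)]→L[ℝ] ℂ

instance (k : ℕ) : NormedAddCommGroup (JetSpace p q k) :=
  inferInstanceAs (NormedAddCommGroup ((i : Fin (k + 1)) → Vec p q [×(i : ℕ)]→L[ℝ] ℂ))

instance (k : ℕ) : NormedSpace ℂ (JetSpace p q k) :=
  inferInstanceAs (NormedSpace ℂ ((i : Fin (k + 1)) → Vec p q [×(i : ℕ)]→L[ℝ] ℂ))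

instance (k : ℕ) : CompleteSpace (JetSpace p q k) :=
  inferInstanceAs (CompleteSpace ((i : Fin (k + 1)) → Vec p q [×(i : ℕ)]→L[ℝ] ℂ))

/-- The component of order `i` of a jet. -/
def jetProj {k : ℕ} (i : Fin (k + 1)) : JetSpace p q k →L[ℂ] (Vec p q [×(i : ℕ)]→L[ℝ] ℂ) :=
  ContinuousLinearMap.proj (φ := fun i : Fin (k + 1) => Vec p q [×(i : ℕ)]→L[ℝ] ℂ) i

/-- The `k`-jet of `f` along a compact subset of the domain of pullbacks. -/
def jet (k : ℕ) {K : Set (Vec p q)} (hK : K ⊆ polarDomain p q) (f : SmoothFun p q) :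
    C(K, JetSpace p q k) where
  toFun x i := iteratedFDeriv ℝ i (pullback f) x
  continuous_toFun := continuous_pi fun i => continuousOn_iff_continuous_domRestrict.1
    ((f.contDiffOn_pullback.continuousOn_iteratedFDerivWithin (m := (i : ℕ))
      (by exact_mod_cast le_top) isOpen_polarDomain.uniqueDiffOn).congr
      (fun x hx => (iteratedFDerivWithin_of_isOpen i isOpen_polarDomain hx).symm) |>.mono hK)

theorem jetBound_of_norm_jet_sub_lt {k : ℕ} {K : Set (Vec p q)} [CompactSpace K]
    (hK : K ⊆ polarDomain p q) {f h : SmoothFun p q} {ε : ℝ}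
    (H : ‖jet k hK h - jet k hK f‖ < ε) :
    JetBound k K ε (pullback (h - f : SmoothFun p q)) := by
  intro i hi x hx
  rw [iteratedFDeriv_pullback_sub _ _ _ (hK hx)]
  exact ((norm_le_pi_norm ((jet k hK h - jet k hK f) ⟨x, hx⟩)
    ⟨i, Nat.lt_succ_of_le hi⟩).trans (ContinuousMap.norm_coe_le_norm _ _)).trans_lt H

theorem continuous_jet_precomp (k : ℕ) {K : Set (Vec p q)} (hK : K ⊆ polarDomain p q)
    {G : Type*} [TopologicalSpace G] {a : G → orthogonalGroup p q}
    (ha : Continuous fun g => toCLM (a g)) (f : SmoothFun p q) :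
    Continuous fun g => jet k hK (precomp (a g) f) := by
  refine ContinuousMap.continuous_of_continuous_uncurry _ (continuous_pi fun i => ?_)
  have := (continuousOn_iteratedFDeriv_precomp ha f i).comp_continuous
    (f := fun z : G × K => (z.1, (z.2 : Vec p q))) (by fun_prop) fun z => ⟨mem_univ _, hK z.2.2⟩
  exact this

/-- On a fixed compact set the average becomes a Bochner integral in the Banach space of continuous
jets, which stands in for an integral with values in the Fréchet space. -/
theorem jet_average (k : ℕ) {K : Set (Vec p q)} [CompactSpace K] (hK : K ⊆ polarDomain p q)
    (f : SmoothFun p q) :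
    jet k hK (average μ ha hφ f) = ∫ g, φ g • jet k hK (precomp (a g) f) ∂μ := by
  have hi : Integrable (fun g => φ g • jet k hK (precomp (a g) f)) μ :=
    integrable_of_continuous_of_compactSpace (hφ.smul (continuous_jet_precomp k hK ha f))
  refine ContinuousMap.ext fun x => funext fun i => ?_
  let L : C(K, JetSpace p q k) →L[ℂ] (Vec p q [×(i : ℕ)]→L[ℝ] ℂ) :=
    (jetProj i).comp (ContinuousMap.evalCLM ℂ x)
  have h := L.integral_comp_comm hi
  refine (iteratedFDeriv_average μ ha hφ f i (hK x.2)).trans (Eq.trans ?_ h)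
  rfl

/-- The jets of elements of `N` along a compact set form a convex set, and the integral of a
function with values in a closed convex set against a probability measure stays in that set. Hence
the average is a limit of elements of `N`. -/
theorem average_mem {N : Submodule ℂ (SmoothFun p q)} (hN : IsClosed (N : Set (SmoothFun p q)))
    [IsProbabilityMeasure μ] {f : SmoothFun p q} (hf : ∀ g, precomp (a g) f ∈ N) :
    average μ ha hφ f ∈ N := by
  change _ ∈ (N : Set (SmoothFun p q))
  rw [← hN.closure_eq]
  refine mem_closure_iff_jetBound.2 fun k K ε hK hKU hε => ?_
  have := isCompact_iff_compactSpace.1 hK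
  have hsmul : ∀ (c : ℂ) (h : SmoothFun p q), jet k hKU (c • h) = c • jet k hKU h := fun c h =>
    ContinuousMap.ext fun x => funext fun i => by
      change iteratedFDeriv ℝ i (pullback (c • h : SmoothFun p q)) x = _
      rw [pullback_smul]
      exact iteratedFDeriv_const_smul_apply ((h.contDiffAt_pullback (hKU x.2)).of_le
        (by exact_mod_cast le_top))
  have hadd : ∀ f h : SmoothFun p q, jet k hKU (f + h) = jet k hKU f + jet k hKU h := fun f h =>
    ContinuousMap.ext fun x => funext fun i => by
      change iteratedFDeriv ℝ i (pullback (f + h : SmoothFun p q)) x = _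
      rw [pullback_add]
      exact iteratedFDeriv_add_apply ((f.contDiffAt_pullback (hKU x.2)).of_le
        (by exact_mod_cast le_top)) ((h.contDiffAt_pullback (hKU x.2)).of_le
        (by exact_mod_cast le_top))
  have hconv : Convex ℝ (jet k hKU '' N) := by
    rintro _ ⟨f, hf, rfl⟩ _ ⟨h, hh, rfl⟩ s t - - -
    refine ⟨(s : ℂ) • f + (t : ℂ) • h, N.add_mem (N.smul_mem _ hf) (N.smul_mem _ hh), ?_⟩
    rw [hadd, hsmul, hsmul]
    rfl
  have hmem := Convex.integral_mem (μ := μ) hconv.closure isClosed_closure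
    (f := fun g => φ g • jet k hKU (precomp (a g) f))
    (Filter.Eventually.of_forall fun g => subset_closure ⟨φ g • precomp (a g) f,
      N.smul_mem _ (hf g), hsmul _ _⟩)
    (integrable_of_continuous_of_compactSpace (hφ.smul (continuous_jet_precomp k hKU ha f)))
  rw [← jet_average, Metric.mem_closure_iff] at hmem
  obtain ⟨_, ⟨h, hh, rfl⟩, hlt⟩ := hmem ε hε
  refine ⟨h, hh, jetBound_of_norm_jet_sub_lt hKU ?_⟩
  rwa [← dist_eq_norm, dist_comm]

end Average

/-! ### The Hermitian form, one-parameter groups and Lie derivatives -/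

variable {p q : ℕ}

theorem herm_add_left (u v w : Vec p q) : herm (u + v) w = herm u w + herm v w := by
  simp only [herm, Prod.fst_add, Prod.snd_add, PiLp.add_apply, add_mul, Finset.sum_add_distrib]
  ring

theorem herm_smul_left (c : ℂ) (u v : Vec p q) : herm (c • u) v = c * herm u v := by
  simp only [herm, Prod.smul_fst, Prod.smul_snd, PiLp.smul_apply, smul_eq_mul, mul_assoc,
    ← Finset.mul_sum]
  ring

theorem conj_herm (u v : Vec p q) : conj (herm u v) = herm v u := by
  simp only [herm, map_sub, map_sum, map_mul, Complex.conj_conj, mul_comm]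

theorem herm_add_right (u v w : Vec p q) : herm u (v + w) = herm u v + herm u w := by
  rw [← conj_herm, herm_add_left, map_add, conj_herm, conj_herm]

theorem herm_smul_right (c : ℂ) (u v : Vec p q) : herm u (c • v) = conj c * herm u v := by
  rw [← conj_herm, herm_smul_left, map_mul, conj_herm]

theorem herm_neg_left (u v : Vec p q) : herm (-u) v = -herm u v := by
  rw [← neg_one_smul ℂ, herm_smul_left, neg_one_mul]

theorem herm_neg_right (u v : Vec p q) : herm u (-v) = -herm u v := by
  rw [← neg_one_smul ℂ, herm_smul_right, map_neg, map_one, neg_one_mul]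

theorem herm_sub_left (u v w : Vec p q) : herm (u - v) w = herm u w - herm v w := by
  rw [sub_eq_add_neg, herm_add_left, herm_neg_left, ← sub_eq_add_neg]

theorem herm_sub_right (u v w : Vec p q) : herm u (v - w) = herm u v - herm u w := by
  rw [sub_eq_add_neg, herm_add_right, herm_neg_right, ← sub_eq_add_neg]

theorem herm_rsmul_left (c : ℝ) (u v : Vec p q) : herm (c • u) v = c * herm u v := by
  rw [← Complex.coe_smul, herm_smul_left]

theorem herm_rsmul_right (c : ℝ) (u v : Vec p q) : herm u (c • v) = c * herm u v := by
  rw [← Complex.coe_smul, herm_smul_right, Complex.conj_ofReal]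

/-- The real part of the Hermitian form as a continuous bilinear form. -/
def hermRe (p q : ℕ) : Vec p q →L[ℝ] Vec p q →L[ℝ] ℝ :=
  LinearMap.toContinuousBilinearMap (LinearMap.mk₂ ℝ (fun u v => (herm u v).re)
    (fun u v w => by rw [herm_add_left, Complex.add_re])
    (fun c u v => by rw [herm_rsmul_left, Complex.re_ofReal_mul, smul_eq_mul])
    (fun u v w => by rw [herm_add_right, Complex.add_re])
    (fun c u v => by rw [herm_rsmul_right, Complex.re_ofReal_mul, smul_eq_mul]))

theorem hermRe_apply (u v : Vec p q) : hermRe p q u v = (herm u v).re := rfl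

/-- The Lie algebra of `O(2p,2q)`. -/
def lieAlg (p q : ℕ) : Submodule ℝ (Vec p q →L[ℝ] Vec p q) where
  carrier := {T | ∀ u v, hermRe p q (T u) v + hermRe p q u (T v) = 0}
  zero_mem' := fun u v => by simp
  add_mem' := fun {T S} hT hS u v => by
    have := congrArg₂ (· + ·) (hT u v) (hS u v)
    simp only [add_apply, map_add] at this ⊢
    linarith
  smul_mem' := fun c T hT u v => by
    have := congrArg (c * ·) (hT u v)
    simp only [smul_apply, map_smul, smul_eq_mul] at this ⊢
    linarith

section Flow

variable {E : Type*} [NormedAddCommGroup E] [NormedSpace ℝ E] [CompleteSpace E]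

/-- The flow `exp(tT)` of a continuous linear map. -/
def flow (T : E →L[ℝ] E) (t : ℝ) : E →L[ℝ] E := NormedSpace.exp (t • T)

theorem flow_zero (T : E →L[ℝ] E) : flow T 0 = ContinuousLinearMap.id ℝ E := by
  rw [flow, zero_smul, NormedSpace.exp_zero]
  rfl

theorem hasDerivAt_flow (T : E →L[ℝ] E) (t : ℝ) : HasDerivAt (flow T) (T ∘L flow T t) t :=
  hasDerivAt_exp_smul_const' (𝕂 := ℝ) T t

theorem hasDerivAt_flow_apply (T : E →L[ℝ] E) (x : E) (t : ℝ) :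
    HasDerivAt (fun s => flow T s x) (T (flow T t x)) t :=
  ((hasDerivAt_flow T t).clm_apply (hasDerivAt_const t x)).congr_deriv (by simp)

theorem flow_neg_flow (T : E →L[ℝ] E) (t : ℝ) (u : E) : flow T (-t) (flow T t u) = u := by
  let +nondep : NormedAlgebra ℚ (E →L[ℝ] E) := NormedAlgebra.restrictScalars ℚ ℝ _
  have h : Commute ((-t) • T) (t • T) := ((Commute.refl T).smul_left _).smul_right _
  have h2 := NormedSpace.exp_add_of_commute h
  rw [neg_smul, neg_add_cancel, NormedSpace.exp_zero, ← neg_smul] at h2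
  exact (DFunLike.congr_fun h2 u).symm

theorem flow_comm {T S : E →L[ℝ] E} (h : ∀ x, T (S x) = S (T x)) (t : ℝ) (x : E) :
    flow T t (S x) = S (flow T t x) := by
  have h1 : Commute S (t • T) := Commute.smul_right
    (ContinuousLinearMap.ext fun x => (h x).symm : S * T = T * S) t
  exact (DFunLike.congr_fun (Commute.exp_right h1) x).symm

end Flow

/-- The derivative of the form along the flow is the expression whose vanishing defines the Lie
algebra. -/
theorem hermRe_flow (T : lieAlg p q) (t : ℝ) (u v : Vec p q) :
    hermRe p q (flow T.1 t u) (flow T.1 t v) = hermRe p q u v := by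
  have h : ∀ s : ℝ, HasDerivAt (fun s : ℝ => hermRe p q (flow T.1 s u) (flow T.1 s v)) 0 s :=
    fun s => by
      have h1 := ((hermRe p q).hasFDerivAt.comp_hasDerivAt s
        (hasDerivAt_flow_apply T.1 u s)).clm_apply (hasDerivAt_flow_apply T.1 v s)
      exact h1.congr_deriv (T.2 _ _)
  have := is_const_of_deriv_eq_zero (fun s => (h s).differentiableAt) (fun s => (h s).deriv) t 0
  simpa only [flow_zero, ContinuousLinearMap.id_apply] using this

/-- The one-parameter group generated by an element of the Lie algebra. -/
def oneParam (T : lieAlg p q) (t : ℝ) : orthogonalGroup p q :=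
  ⟨{ toFun := flow T.1 t
     map_add' := map_add _
     map_smul' := map_smul _
     invFun := flow T.1 (-t)
     left_inv := flow_neg_flow T.1 t
     right_inv := fun u => by
        have := flow_neg_flow T.1 (-t) u
        rwa [neg_neg] at this }, hermRe_flow T t⟩

theorem oneParam_zero (T : lieAlg p q) : oneParam T 0 = 1 := by
  apply Subtype.ext
  apply LinearEquiv.ext
  exact fun v => DFunLike.congr_fun (flow_zero T.1) v

theorem hasDerivAt_oneParam (T : lieAlg p q) (x : Vec p q) (t : ℝ) :
    HasDerivAt (fun s => (oneParam T s).1 x) (T.1 ((oneParam T t).1 x)) t :=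
  hasDerivAt_flow_apply T.1 x t

theorem continuous_toCLM_oneParam (T : lieAlg p q) : Continuous fun t => toCLM (oneParam T t) :=
  continuous_iff_continuousAt.2 fun t => (hasDerivAt_flow T.1 t).continuousAt

theorem hasDerivAt_comp_curve (f : SmoothFun p q) {γ : ℝ → Vec p q} (hγ : ∀ t, γ t ∈ cone p q)
    {v : Vec p q} {t : ℝ} (hd : HasDerivAt γ v t) :
    HasDerivAt (fun s => f ⟨γ s, hγ s⟩) (fderiv ℝ (pullback f) (γ t) v) t := by
  have h := ((f.contDiffAt_pullback (cone_subset_polarDomain (hγ t))).differentiableAt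
    (by simp)).hasFDerivAt.comp_hasDerivAt t hd
  refine h.congr_of_eventuallyEq (Filter.Eventually.of_forall fun s => ?_)
  exact (pullback_coe f ⟨γ s, hγ s⟩).symm

/-- Any extension of `f` may be used to compute its derivatives in tangent directions. -/
theorem fderiv_pullback_apply_eq (f : SmoothFun p q) (T : lieAlg p q) (x : cone p q)
    {F : Vec p q → ℂ} (hF : DifferentiableAt ℝ F x) (hf : ∀ y : cone p q, F y = f y) :
    fderiv ℝ (pullback f) x (T.1 x) = fderiv ℝ F x (T.1 x) := by
  -- The orbit of `x` under the one-parameter group stays in the cone, where both extensions agree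
  -- with `f`. Both sides are therefore the derivative of `f` along this orbit.
  have hd := hasDerivAt_oneParam T x 0
  have h0 : (oneParam T 0).1 (x : Vec p q) = x := by rw [oneParam_zero]; rfl
  have hmem : ∀ t, (oneParam T t).1 (x : Vec p q) ∈ cone p q := fun t => apply_mem_cone _ x.2
  have h1 := hasDerivAt_comp_curve f hmem hd
  have h2 : HasDerivAt (fun s => F ((oneParam T s).1 x)) _ 0 :=
    HasFDerivAt.comp_hasDerivAt (l := F) 0 (by rw [h0]; exact hF.hasFDerivAt) hd
  simp only [h0] at h1 h2
  refine h1.unique (h2.congr_of_eventuallyEq (Filter.Eventually.of_forall fun s => ?_))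
  exact (hf ⟨_, hmem s⟩).symm

/-- The derivative of `f` along the vector field `x ↦ T x`. -/
def lieDeriv (T : lieAlg p q) : SmoothFun p q →ₗ[ℂ] SmoothFun p q where
  toFun f := ⟨fun x => fderiv ℝ (pullback f) x (T.1 x), by
    obtain ⟨F, hF, hf⟩ := f.2
    refine ⟨fun v => fderiv ℝ F v (T.1 v), ?_, fun x => ?_⟩
    · exact (hF.fderiv_of_isOpen isOpen_compl_singleton (by simp)).clm_apply
        T.1.contDiff.contDiffOn
    · exact (fderiv_pullback_apply_eq f T x ((hF.contDiffAt
        (isOpen_compl_singleton.mem_nhds x.2.1)).differentiableAt (by simp)) hf).symm⟩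
  map_add' f h := SmoothFun.ext fun x => by
    have hx := cone_subset_polarDomain x.2
    change fderiv ℝ (pullback (f + h : SmoothFun p q)) x (T.1 x) =
      fderiv ℝ (pullback f) x (T.1 x) + fderiv ℝ (pullback h) x (T.1 x)
    rw [pullback_add, fderiv_add ((f.contDiffAt_pullback hx).differentiableAt (by simp))
      ((h.contDiffAt_pullback hx).differentiableAt (by simp))]
    rfl
  map_smul' c f := SmoothFun.ext fun x => by
    have hx := cone_subset_polarDomain x.2
    change fderiv ℝ (pullback (c • f : SmoothFun p q)) x (T.1 x) =
      c * fderiv ℝ (pullback f) x (T.1 x)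
    rw [pullback_smul, fderiv_const_smul ((f.contDiffAt_pullback hx).differentiableAt (by simp))]
    rfl

theorem lieDeriv_apply (T : lieAlg p q) (f : SmoothFun p q) (x : cone p q) :
    lieDeriv T f x = fderiv ℝ (pullback f) x (T.1 x) := rfl

theorem lieDeriv_apply_of_extension (T : lieAlg p q) (f : SmoothFun p q) (x : cone p q)
    {F : Vec p q → ℂ} (hF : DifferentiableAt ℝ F x) (hf : ∀ y : cone p q, F y = f y) :
    lieDeriv T f x = fderiv ℝ F x (T.1 x) :=
  fderiv_pullback_apply_eq f T x hF hf

theorem hasDerivAt_lieDeriv (T : lieAlg p q) (f : SmoothFun p q) (x : cone p q) {γ : ℝ → Vec p q}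
    (hγ : ∀ t, γ t ∈ cone p q) {t : ℝ} (ht : γ t = x) (hd : HasDerivAt γ (T.1 x) t) :
    HasDerivAt (fun s => f ⟨γ s, hγ s⟩) (lieDeriv T f x) t := by
  have h := hasDerivAt_comp_curve f hγ hd
  rwa [ht] at h

/-- The Leibniz estimate for `fderiv (pullback f) v (T v)` costs one derivative and the factor `2 ^
k` from the binomial coefficients; composing with the retraction then yields the pullback of the Lie
derivative. -/
theorem continuous_lieDeriv (T : lieAlg p q) : Continuous (lieDeriv T) := by
  refine continuous_of_jetBound _ fun k K hK hKU => ?_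
  obtain ⟨K', C, h1, h2, h3, h4⟩ := JetBound.comp (G := Unit) (E := ℂ) isOpen_polarDomain
    (isOpen_polarDomain (p := p) (q := q)) (fun _ => retraction) (fun _ => contDiffOn_retraction)
    (fun _ => retraction_mapsTo) (fun k => by
      have := contDiffOn_retraction.continuousOn_iteratedFDerivWithin (m := k)
        (by exact_mod_cast le_top) (isOpen_polarDomain (p := p) (q := q)).uniqueDiffOn
      exact (this.congr fun x hx =>
        (iteratedFDerivWithin_of_isOpen k isOpen_polarDomain hx).symm).comp
        (f := fun z : Unit × Vec p q => z.2) continuous_snd.continuousOn fun z hz => hz.2) k hK hKU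
  choose B hB using fun m : ℕ => h1.exists_bound_of_continuousOn
    ((T.1.contDiff (n := ∞)).continuous_iteratedFDeriv (m := m)
      (by exact_mod_cast le_top)).continuousOn
  let D : ℝ := 1 + ∑ i ∈ Finset.range (k + 1), |B i|
  have hD : 0 < D := lt_of_lt_of_le one_pos
    (le_add_of_nonneg_right (Finset.sum_nonneg fun i _ => abs_nonneg _))
  have hBD : ∀ i ≤ k, B i ≤ D := fun i hi => (le_abs_self _).trans
    ((Finset.single_le_sum (f := fun i => |B i|) (fun i _ => abs_nonneg _)
      (Finset.mem_range.2 (Nat.lt_succ_of_le hi))).trans (le_add_of_nonneg_left zero_le_one))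
  refine ⟨k + 1, K', C * (2 ^ k * D + 1), h1, h2, by positivity, fun f δ hδ hf => ?_⟩
  have hsm : ContDiffOn ℝ ∞ (fderiv ℝ (pullback f)) (polarDomain p q) :=
    f.contDiffOn_pullback.fderiv_of_isOpen isOpen_polarDomain (by simp)
  have hJ : JetBound k K' ((2 ^ k * D + 1) * δ)
      (fun v => fderiv ℝ (pullback f) v (T.1 v)) := by
    intro i hi x hx
    have h5 := norm_iteratedFDerivWithin_clm_apply (N := ∞) (n := i) hsm
      T.1.contDiff.contDiffOn isOpen_polarDomain.uniqueDiffOn (h2 hx) (by exact_mod_cast le_top)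
    rw [iteratedFDerivWithin_of_isOpen i isOpen_polarDomain (h2 hx)] at h5
    refine h5.trans_lt ?_
    have h6 : ∀ j ∈ Finset.range (i + 1), (i.choose j : ℝ) *
        ‖iteratedFDerivWithin ℝ j (fderiv ℝ (pullback f)) (polarDomain p q) x‖ *
        ‖iteratedFDerivWithin ℝ (i - j) T.1 (polarDomain p q) x‖ ≤ i.choose j * δ * D := by
      intro j hj
      have hj' := Nat.lt_succ_iff.1 (Finset.mem_range.1 hj)
      rw [iteratedFDerivWithin_of_isOpen j isOpen_polarDomain (h2 hx),
        iteratedFDerivWithin_of_isOpen (i - j) isOpen_polarDomain (h2 hx),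
        norm_iteratedFDeriv_fderiv]
      gcongr
      · exact (hf (j + 1) (by omega) x hx).le
      · exact (hB (i - j) x hx).trans (hBD _ (by omega))
    refine (Finset.sum_le_sum h6).trans_lt ?_
    rw [← Finset.sum_mul, ← Finset.sum_mul, ← Nat.cast_sum, Nat.sum_range_choose]
    have : ((2 : ℝ) ^ i) ≤ 2 ^ k := pow_le_pow_right₀ (by norm_num) hi
    push_cast
    nlinarith [mul_pos hδ hD]
  have h7 := h4 _ (hsm.clm_apply T.1.contDiff.contDiffOn) _ (by positivity) hJ ()
  intro i hi x hx
  rw [mul_assoc]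
  refine lt_of_eq_of_lt (congrArg norm ?_) (h7 i hi x hx)
  refine (Filter.EventuallyEq.iteratedFDeriv ℝ (Filter.eventuallyEq_of_mem
    (isOpen_polarDomain.mem_nhds (hKU hx)) fun y hy => ?_) i).self_of_nhds
  exact pullback_of_mem _ hy

theorem lieDeriv_average {G : Type*} [TopologicalSpace G] [CompactSpace G]
    [SecondCountableTopology G] [MeasurableSpace G] [BorelSpace G] (μ : Measure G)
    [IsFiniteMeasure μ] {a : G → orthogonalGroup p q} (ha : Continuous fun g => toCLM (a g))
    {φ : G → ℂ} (hφ : Continuous φ) (T : lieAlg p q) (f : SmoothFun p q) (x : cone p q) :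
    lieDeriv T (average μ ha hφ f) x = ∫ g, φ g * lieDeriv T (precomp (a g) f) x ∂μ := by
  have hx := cone_subset_polarDomain x.2
  have h := iteratedFDeriv_average μ ha hφ f 1 hx
  have hi : Integrable (fun g => φ g • iteratedFDeriv ℝ 1 (pullback (precomp (a g) f)) x) μ :=
    integrable_of_continuous_of_compactSpace (hφ.smul (continuous_of_continuousOn_prod
      (Ψ := fun g y => iteratedFDeriv ℝ 1 (pullback (precomp (a g) f)) y)
      (continuousOn_iteratedFDeriv_precomp ha f 1) hx))
  have h2 := (ContinuousMultilinearMap.apply ℝ (fun _ : Fin 1 => Vec p q) ℂ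
    (fun _ => T.1 x)).integral_comp_comm hi
  have h3 := congrArg (fun A => A fun _ : Fin 1 => T.1 (x : Vec p q)) h
  simp only [iteratedFDeriv_one_apply] at h3
  rw [lieDeriv_apply, h3]
  refine h2.symm.trans (integral_congr_ae (Filter.Eventually.of_forall fun g => ?_))
  change φ g * iteratedFDeriv ℝ 1 (pullback (precomp (a g) f)) x _ = _
  rw [iteratedFDeriv_one_apply]
  rfl

/-- Closed subspaces invariant under a one-parameter group are invariant under its generator. -/
theorem lieDeriv_mem {N : Submodule ℂ (SmoothFun p q)} (hN : IsClosed (N : Set (SmoothFun p q)))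
    (T : lieAlg p q) {f : SmoothFun p q} (hf : ∀ t, precomp (oneParam T t) f ∈ N) :
    lieDeriv T f ∈ N := by
  have ha : ∀ t : ℝ, Continuous fun s : unitInterval => toCLM (oneParam T (s * t)) := fun t =>
    (continuous_toCLM_oneParam T).comp (by fun_prop)
  -- `A t` is the mean of the translates of `lieDeriv T f` over the segment from 0 to `t`. By the
  -- fundamental theorem of calculus it equals a difference quotient of `f`, which lies in `N`; by
  -- continuity of jets in the parameter it tends to `lieDeriv T f` as `t` tends to 0.
  let A : ℝ → SmoothFun p q := fun t =>
    average volume (ha t) (φ := fun _ => 1) continuous_const (lieDeriv T f)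
  have hA : ∀ t : ℝ, t ≠ 0 → A t = ((t⁻¹ : ℝ) : ℂ) • (precomp (oneParam T t) f - f) := by
    intro t ht
    refine SmoothFun.ext fun x => ?_
    have hmem : ∀ t, (oneParam T t).1 (x : Vec p q) ∈ cone p q := fun t => apply_mem_cone _ x.2
    have hd : ∀ s : ℝ, HasDerivAt (fun s => f (act (oneParam T s) x))
        (lieDeriv T f (act (oneParam T s) x)) s := fun s =>
      hasDerivAt_lieDeriv T f _ hmem rfl (hasDerivAt_oneParam T x s)
    have hc : Continuous fun s => lieDeriv T f (act (oneParam T s) x) := by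
      have hc' : ContinuousOn (pullback (lieDeriv T f)) (polarDomain p q) :=
        (lieDeriv T f).contDiffOn_pullback.continuousOn
      refine (hc'.comp_continuous (f := fun s => (oneParam T s).1 (x : Vec p q)) ?_
        fun s => cone_subset_polarDomain (hmem s)).congr
          fun s => pullback_coe (lieDeriv T f) (act (oneParam T s) x)
      exact continuous_iff_continuousAt.2 fun s => (hasDerivAt_oneParam T x s).continuousAt
    have hftc := intervalIntegral.integral_eq_sub_of_hasDerivAt
      (fun s _ => hd s) (hc.intervalIntegrable 0 t)
    have h1 : A t x = ∫ s in (0 : ℝ)..1, lieDeriv T f (act (oneParam T (s * t)) x) := by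
      rw [intervalIntegral.integral_of_le zero_le_one, ← integral_Icc_eq_integral_Ioc]
      refine Eq.trans ?_ (integral_subtype_comap measurableSet_Icc
        fun s => lieDeriv T f (act (oneParam T (s * t)) x))
      simp only [A, average_apply, one_mul]
      rfl
    rw [h1, intervalIntegral.integral_comp_mul_right
      (fun s => lieDeriv T f (act (oneParam T s) x)) ht, zero_mul, one_mul, hftc]
    rw [SmoothFun.smul_apply, SmoothFun.sub_apply, precomp_apply, Complex.real_smul]
    congr 2
    rw [oneParam_zero]
    rfl
  have hAN : ∀ t : ℝ, t ≠ 0 → A t ∈ N := fun t ht => by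
    rw [hA t ht]
    have h0 := hf 0
    rw [oneParam_zero, precomp_one] at h0
    exact N.smul_mem _ (N.sub_mem (hf t) h0)
  change _ ∈ (N : Set (SmoothFun p q))
  rw [← hN.closure_eq]
  refine mem_closure_iff_jetBound.2 fun k K ε hK hKU hε => ?_
  have := isCompact_iff_compactSpace.1 hK
  have hcont := continuous_jet_precomp k hKU (continuous_toCLM_oneParam T) (lieDeriv T f)
  obtain ⟨δ, hδ, hδ'⟩ := Metric.continuousAt_iff.1 (hcont.continuousAt (x := 0)) (ε / 2) (half_pos hε)
  simp only [oneParam_zero, precomp_one] at hδ'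
  refine ⟨A (δ / 2), hAN _ (half_pos hδ).ne', jetBound_of_norm_jet_sub_lt hKU ?_⟩
  have hi : Integrable (fun s : unitInterval =>
      jet k hKU (precomp (oneParam T (s * (δ / 2))) (lieDeriv T f))) volume :=
    integrable_of_continuous_of_compactSpace (continuous_jet_precomp k hKU (ha (δ / 2)) _)
  have h2 : jet k hKU (A (δ / 2)) - jet k hKU (lieDeriv T f) = ∫ s : unitInterval,
      (jet k hKU (precomp (oneParam T (s * (δ / 2))) (lieDeriv T f)) -
        jet k hKU (lieDeriv T f)) := by
    rw [integral_sub hi (integrable_const _), integral_const, probReal_univ, one_smul]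
    congr 1
    refine (jet_average volume (ha (δ / 2)) continuous_const k hKU _).trans ?_
    simp only [one_smul]
  rw [h2]
  refine (norm_integral_le_of_norm_le_const (C := ε / 2)
    (Filter.Eventually.of_forall fun s => ?_)).trans_lt ?_
  · rw [← dist_eq_norm]
    refine (hδ' ?_).le
    rw [dist_zero_right, norm_mul, Real.norm_of_nonneg s.2.1, Real.norm_of_nonneg (half_pos hδ).le]
    nlinarith [s.2.2]
  · rw [probReal_univ]
    linarith

theorem lieDeriv_precomp (T : lieAlg p q) (g : orthogonalGroup p q) (S : lieAlg p q)
    (h : ∀ x, g.1 (T.1 x) = S.1 (g.1 x)) (f : SmoothFun p q) :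
    lieDeriv T (precomp g f) = precomp g (lieDeriv S f) := by
  refine SmoothFun.ext fun x => ?_
  have hmem : ∀ t, (oneParam T t).1 (x : Vec p q) ∈ cone p q := fun t => apply_mem_cone _ x.2
  have hd := hasDerivAt_oneParam T x 0
  have h0 : (oneParam T 0).1 (x : Vec p q) = x := by rw [oneParam_zero]; rfl
  rw [h0] at hd
  have h1 := hasDerivAt_lieDeriv T (precomp g f) x hmem h0 hd
  have hd2 : HasDerivAt (fun t => g.1 ((oneParam T t).1 (x : Vec p q))) (S.1 (act g x)) 0 := by
    have := (toCLM g).hasFDerivAt.comp_hasDerivAt 0 hd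
    rw [toCLM_apply, h] at this
    exact this
  have h2 := hasDerivAt_lieDeriv S f (act g x) (fun t => apply_mem_cone g (hmem t))
    (congrArg g.1 h0) hd2
  rw [precomp_apply]
  refine h1.unique (h2.congr_of_eventuallyEq (Filter.Eventually.of_forall fun t => ?_))
  exact precomp_apply g f _


/-! ### Generators of the Lie algebra, Wirtinger derivatives, raising and lowering operators -/

variable {p q : ℕ}

/-- `x ↦ h(u, x) v - h(v, x) u`, an antilinear element of the Lie algebra of `O(2p,2q)`. -/
def antiGen (u v : Vec p q) : lieAlg p q :=
  ⟨LinearMap.toContinuousLinearMap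
    { toFun := fun x => herm u x • v - herm v x • u
      map_add' := fun x y => by
        rw [herm_add_right, herm_add_right]; module
      map_smul' := fun c x => by
        rw [herm_rsmul_right, herm_rsmul_right, ← Complex.coe_smul, RingHom.id_apply]; module },
    fun x y => by
      change (herm (herm u x • v - herm v x • u) y).re +
        (herm x (herm u y • v - herm v y • u)).re = 0
      rw [← conj_herm (herm u y • v - herm v y • u) x, Complex.conj_re, ← Complex.add_re,
        herm_sub_left, herm_sub_left, herm_smul_left, herm_smul_left, herm_smul_left,
        herm_smul_left]
      ring_nf
      rfl⟩

theorem antiGen_apply (u v x : Vec p q) : (antiGen u v).1 x = herm u x • v - herm v x • u := rfl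

/-- `x ↦ h(x, v) u - h(x, u) v`, an element of the Lie algebra of `U(p,q)`. -/
def unitGen (u v : Vec p q) : lieAlg p q :=
  ⟨LinearMap.toContinuousLinearMap
    { toFun := fun x => herm x v • u - herm x u • v
      map_add' := fun x y => by
        rw [herm_add_left, herm_add_left]; module
      map_smul' := fun c x => by
        rw [herm_rsmul_left, herm_rsmul_left, ← Complex.coe_smul, RingHom.id_apply]; module },
    fun x y => by
      change (herm (herm x v • u - herm x u • v) y).re +
        (herm x (herm y v • u - herm y u • v)).re = 0
      rw [herm_sub_left, herm_sub_right, herm_smul_left, herm_smul_left, herm_smul_right,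
        herm_smul_right, conj_herm, conj_herm]
      simp only [Complex.sub_re, Complex.mul_re]
      ring⟩

theorem unitGen_apply (u v x : Vec p q) : (unitGen u v).1 x = herm x v • u - herm x u • v := rfl

/-- `x ↦ i (h(x, v) u + h(x, u) v)`, an element of the Lie algebra of `U(p,q)`. -/
def unitGenI (u v : Vec p q) : lieAlg p q :=
  ⟨LinearMap.toContinuousLinearMap
    { toFun := fun x => Complex.I • (herm x v • u + herm x u • v)
      map_add' := fun x y => by
        rw [herm_add_left, herm_add_left]; module
      map_smul' := fun c x => by
        rw [herm_rsmul_left, herm_rsmul_left, ← Complex.coe_smul, RingHom.id_apply]; module },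
    fun x y => by
      change (herm (Complex.I • (herm x v • u + herm x u • v)) y).re +
        (herm x (Complex.I • (herm y v • u + herm y u • v))).re = 0
      rw [herm_smul_left, herm_smul_right, herm_add_left, herm_add_right, herm_smul_left,
        herm_smul_left, herm_smul_right, herm_smul_right, conj_herm, conj_herm, Complex.conj_I]
      simp only [Complex.mul_re, Complex.neg_re, Complex.neg_im, Complex.I_re, Complex.I_im,
        Complex.add_im, Complex.mul_im, Complex.add_re]
      ring⟩

theorem unitGenI_apply (u v x : Vec p q) :
    (unitGenI u v).1 x = Complex.I • (herm x v • u + herm x u • v) := rfl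

section Wirtinger

/-- The holomorphic directional derivative. -/
def dz (w : Vec p q) (F : Vec p q → ℂ) (x : Vec p q) : ℂ :=
  (fderiv ℝ F x w - Complex.I * fderiv ℝ F x (Complex.I • w)) / 2

/-- The antiholomorphic directional derivative. -/
def dzbar (w : Vec p q) (F : Vec p q → ℂ) (x : Vec p q) : ℂ :=
  (fderiv ℝ F x w + Complex.I * fderiv ℝ F x (Complex.I • w)) / 2

theorem smul_eq_re_im (c : ℂ) (w : Vec p q) :
    c • w = c.re • w + c.im • (Complex.I • w) := by
  rw [← Complex.coe_smul c.re, ← Complex.coe_smul c.im, smul_smul, ← add_smul, Complex.re_add_im]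

theorem fderiv_smul_eq (F : Vec p q → ℂ) (x w : Vec p q) (c : ℂ) :
    fderiv ℝ F x (c • w) = c * dz w F x + conj c * dzbar w F x := by
  rw [smul_eq_re_im, map_add, map_smul, map_smul, dz, dzbar, Complex.real_smul, Complex.real_smul]
  conv_rhs => rw [← Complex.re_add_im c]
  simp only [map_add, map_mul, Complex.conj_ofReal, Complex.conj_I]
  linear_combination ((c.im * fderiv ℝ F x (Complex.I • w)) : ℂ) * Complex.I_sq

theorem contDiffOn_dz {U : Set (Vec p q)} (hU : IsOpen U) {F : Vec p q → ℂ}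
    (hF : ContDiffOn ℝ ∞ F U) (w : Vec p q) : ContDiffOn ℝ ∞ (dz w F) U := by
  have h := hF.fderiv_of_isOpen hU (m := ∞) (by simp)
  exact ((h.clm_apply contDiffOn_const).sub
    (contDiffOn_const.mul (h.clm_apply contDiffOn_const))).div_const 2

theorem contDiffOn_dzbar {U : Set (Vec p q)} (hU : IsOpen U) {F : Vec p q → ℂ}
    (hF : ContDiffOn ℝ ∞ F U) (w : Vec p q) : ContDiffOn ℝ ∞ (dzbar w F) U := by
  have h := hF.fderiv_of_isOpen hU (m := ∞) (by simp)
  exact ((h.clm_apply contDiffOn_const).add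
    (contDiffOn_const.mul (h.clm_apply contDiffOn_const))).div_const 2

variable {F : Vec p q → ℂ} {x : Vec p q}

theorem fderiv_dz (hF : ContDiffAt ℝ ∞ F x) (w w' : Vec p q) :
    fderiv ℝ (dz w F) x w' = (fderiv ℝ (fderiv ℝ F) x w' w -
      Complex.I * fderiv ℝ (fderiv ℝ F) x w' (Complex.I • w)) / 2 := by
  have h : HasFDerivAt (fderiv ℝ F) (fderiv ℝ (fderiv ℝ F) x) x :=
    ((hF.fderiv_right (m := ∞) (by simp)).differentiableAt (by simp)).hasFDerivAt
  have h1 : ∀ w : Vec p q, HasFDerivAt (fun y => fderiv ℝ F y w) _ x := fun w =>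
    h.clm_apply (hasFDerivAt_const w x)
  have h2 := (((h1 w).sub ((h1 (Complex.I • w)).const_mul Complex.I)).mul_const (2 : ℂ)⁻¹)
  have h3 : HasFDerivAt (dz w F) _ x := h2
  rw [h3.fderiv]
  simp
  ring

theorem fderiv_dzbar (hF : ContDiffAt ℝ ∞ F x) (w w' : Vec p q) :
    fderiv ℝ (dzbar w F) x w' = (fderiv ℝ (fderiv ℝ F) x w' w +
      Complex.I * fderiv ℝ (fderiv ℝ F) x w' (Complex.I • w)) / 2 := by
  have h : HasFDerivAt (fderiv ℝ F) (fderiv ℝ (fderiv ℝ F) x) x :=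
    ((hF.fderiv_right (m := ∞) (by simp)).differentiableAt (by simp)).hasFDerivAt
  have h1 : ∀ w : Vec p q, HasFDerivAt (fun y => fderiv ℝ F y w) _ x := fun w =>
    h.clm_apply (hasFDerivAt_const w x)
  have h2 := (((h1 w).add ((h1 (Complex.I • w)).const_mul Complex.I)).mul_const (2 : ℂ)⁻¹)
  have h3 : HasFDerivAt (dzbar w F) _ x := h2
  rw [h3.fderiv]
  simp
  ring

theorem fderiv_fderiv_comm (hF : ContDiffAt ℝ ∞ F x) (w w' : Vec p q) :
    fderiv ℝ (fderiv ℝ F) x w w' = fderiv ℝ (fderiv ℝ F) x w' w :=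
  (hF.isSymmSndFDerivAt (by
    rw [minSmoothness_of_isRCLikeNormedField]
    exact WithTop.coe_le_coe.2 (le_top (a := (2 : ℕ∞))))).eq w w'

theorem dz_dz_comm (hF : ContDiffAt ℝ ∞ F x) (w w' : Vec p q) :
    dz w (dz w' F) x = dz w' (dz w F) x := by
  rw [dz, dz, fderiv_dz hF, fderiv_dz hF, fderiv_dz hF, fderiv_dz hF, fderiv_fderiv_comm hF w' w,
    fderiv_fderiv_comm hF w' (Complex.I • w), fderiv_fderiv_comm hF (Complex.I • w') w,
    fderiv_fderiv_comm hF (Complex.I • w') (Complex.I • w)]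
  ring

theorem dzbar_dzbar_comm (hF : ContDiffAt ℝ ∞ F x) (w w' : Vec p q) :
    dzbar w (dzbar w' F) x = dzbar w' (dzbar w F) x := by
  rw [dzbar, dzbar, fderiv_dzbar hF, fderiv_dzbar hF, fderiv_dzbar hF, fderiv_dzbar hF,
    fderiv_fderiv_comm hF w' w,
    fderiv_fderiv_comm hF w' (Complex.I • w), fderiv_fderiv_comm hF (Complex.I • w') w,
    fderiv_fderiv_comm hF (Complex.I • w') (Complex.I • w)]
  ring

theorem dzbar_dz_comm (hF : ContDiffAt ℝ ∞ F x) (w w' : Vec p q) :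
    dzbar w (dz w' F) x = dz w' (dzbar w F) x := by
  rw [dz, dzbar, fderiv_dzbar hF, fderiv_dzbar hF, fderiv_dz hF, fderiv_dz hF,
    fderiv_fderiv_comm hF w' w,
    fderiv_fderiv_comm hF w' (Complex.I • w), fderiv_fderiv_comm hF (Complex.I • w') w,
    fderiv_fderiv_comm hF (Complex.I • w') (Complex.I • w)]
  ring

/-- `x ↦ h(x, v)` as a real-linear map. -/
def hermLeft (v : Vec p q) : Vec p q →L[ℝ] ℂ :=
  LinearMap.toContinuousLinearMap
    { toFun := fun x => herm x v
      map_add' := fun x y => herm_add_left x y v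
      map_smul' := fun c x => herm_rsmul_left c x v }

/-- `x ↦ h(v, x)` as a real-linear map. -/
def hermRight (v : Vec p q) : Vec p q →L[ℝ] ℂ :=
  LinearMap.toContinuousLinearMap
    { toFun := fun x => herm v x
      map_add' := fun x y => herm_add_right v x y
      map_smul' := fun c x => herm_rsmul_right c v x }

theorem fderiv_clm_mul_sub (L L' : Vec p q →L[ℝ] ℂ) {F F' : Vec p q → ℂ}
    (hF : DifferentiableAt ℝ F x) (hF' : DifferentiableAt ℝ F' x) (w : Vec p q) :
    fderiv ℝ (fun y => L y * F y - L' y * F' y) x w =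
      L w * F x + L x * fderiv ℝ F x w - (L' w * F' x + L' x * fderiv ℝ F' x w) := by
  have h : HasFDerivAt (fun y => L y * F y - L' y * F' y) _ x :=
    (L.hasFDerivAt.mul hF.hasFDerivAt).sub (L'.hasFDerivAt.mul hF'.hasFDerivAt)
  rw [h.fderiv]
  simp
  ring

theorem differentiableAt_clm_mul_sub (L L' : Vec p q →L[ℝ] ℂ) {F F' : Vec p q → ℂ}
    (hF : DifferentiableAt ℝ F x) (hF' : DifferentiableAt ℝ F' x) :
    DifferentiableAt ℝ (fun y => L y * F y - L' y * F' y) x :=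
  (L.differentiableAt.mul hF).sub (L'.differentiableAt.mul hF')

theorem dz_clm_mul_sub (L L' : Vec p q →L[ℝ] ℂ) {F F' : Vec p q → ℂ}
    (hF : DifferentiableAt ℝ F x) (hF' : DifferentiableAt ℝ F' x) (w : Vec p q) :
    dz w (fun y => L y * F y - L' y * F' y) x =
      dz w L x * F x + L x * dz w F x - (dz w L' x * F' x + L' x * dz w F' x) := by
  rw [dz, fderiv_clm_mul_sub L L' hF hF', fderiv_clm_mul_sub L L' hF hF', dz, dz, dz, dz, L.fderiv,
    L'.fderiv]
  ring

theorem dzbar_clm_mul_sub (L L' : Vec p q →L[ℝ] ℂ) {F F' : Vec p q → ℂ}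
    (hF : DifferentiableAt ℝ F x) (hF' : DifferentiableAt ℝ F' x) (w : Vec p q) :
    dzbar w (fun y => L y * F y - L' y * F' y) x =
      dzbar w L x * F x + L x * dzbar w F x - (dzbar w L' x * F' x + L' x * dzbar w F' x) := by
  rw [dzbar, fderiv_clm_mul_sub L L' hF hF', fderiv_clm_mul_sub L L' hF hF', dzbar, dzbar, dzbar,
    dzbar, L.fderiv, L'.fderiv]
  ring

theorem hermLeft_apply (v x : Vec p q) : hermLeft v x = herm x v := rfl

theorem hermRight_apply (v x : Vec p q) : hermRight v x = herm v x := rfl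

theorem dz_hermLeft (w v : Vec p q) : dz w (hermLeft v) x = herm w v := by
  rw [dz, (hermLeft v).fderiv, hermLeft_apply, hermLeft_apply, herm_smul_left]
  linear_combination (-herm w v / 2) * Complex.I_sq

theorem dzbar_hermLeft (w v : Vec p q) : dzbar w (hermLeft v) x = 0 := by
  rw [dzbar, (hermLeft v).fderiv, hermLeft_apply, hermLeft_apply, herm_smul_left]
  linear_combination (herm w v / 2) * Complex.I_sq

theorem dz_hermRight (w v : Vec p q) : dz w (hermRight v) x = 0 := by
  rw [dz, (hermRight v).fderiv, hermRight_apply, hermRight_apply, herm_smul_right, Complex.conj_I]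
  linear_combination (herm v w / 2) * Complex.I_sq

theorem dzbar_hermRight (w v : Vec p q) : dzbar w (hermRight v) x = herm v w := by
  rw [dzbar, (hermRight v).fderiv, hermRight_apply, hermRight_apply, herm_smul_right,
    Complex.conj_I]
  linear_combination (-herm v w / 2) * Complex.I_sq

end Wirtinger

/-- `E_{u,v} = h(x,v) ∂_u - h(u,x) ∂̄_v`. -/
def opE (u v : Vec p q) : SmoothFun p q →ₗ[ℂ] SmoothFun p q :=
  (2⁻¹ : ℂ) • (lieDeriv (unitGen u v) - Complex.I • lieDeriv (unitGenI u v))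

/-- The raising operator `h(x,u) ∂̄_v - h(x,v) ∂̄_u` (for `σ = 1`) and the lowering operator
`h(u,x) ∂_v - h(v,x) ∂_u` (for `σ = -1`). -/
def op (σ : ℤˣ) (u v : Vec p q) : SmoothFun p q →ₗ[ℂ] SmoothFun p q :=
  (2⁻¹ : ℂ) • (lieDeriv (antiGen u v) +
    (((σ : ℤ) : ℂ) * Complex.I) • lieDeriv (antiGen u (Complex.I • v)))

theorem lieDeriv_antiGen (u v : Vec p q) (f : SmoothFun p q) :
    lieDeriv (antiGen u v) f = op 1 u v f + op (-1) u v f := by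
  simp only [op, LinearMap.smul_apply, LinearMap.add_apply, Units.val_one, Units.val_neg,
    Int.cast_neg, Int.cast_one, neg_mul, one_mul]
  module

theorem continuous_op (σ : ℤˣ) (u v : Vec p q) : Continuous (op σ u v) :=
  ((continuous_lieDeriv _).add ((continuous_lieDeriv _).const_smul _)).const_smul _

section Extension

variable {f : SmoothFun p q} {F : Vec p q → ℂ}

theorem opE_apply_of_extension (u v : Vec p q) {x : cone p q} (hF : DifferentiableAt ℝ F x)
    (hf : ∀ y : cone p q, F y = f y) :
    opE u v f x = herm x v * dz u F x - herm u x * dzbar v F x := by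
  change (2⁻¹ : ℂ) * (lieDeriv (unitGen u v) f x - Complex.I * lieDeriv (unitGenI u v) f x) = _
  rw [lieDeriv_apply_of_extension _ f x hF hf, lieDeriv_apply_of_extension _ f x hF hf,
    unitGen_apply, unitGenI_apply, smul_add, smul_smul, smul_smul, map_sub, map_add,
    fderiv_smul_eq, fderiv_smul_eq, fderiv_smul_eq, fderiv_smul_eq]
  simp only [map_mul, Complex.conj_I, conj_herm]
  linear_combination (-(herm x v * dz u F x + herm x u * dz v F x) / 2 +
    (herm v x * dzbar u F x + herm u x * dzbar v F x) / 2) * Complex.I_sq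

theorem op_one_apply_of_extension (u v : Vec p q) {x : cone p q} (hF : DifferentiableAt ℝ F x)
    (hf : ∀ y : cone p q, F y = f y) :
    op 1 u v f x = herm x u * dzbar v F x - herm x v * dzbar u F x := by
  change (2⁻¹ : ℂ) * (lieDeriv (antiGen u v) f x + (((1 : ℤˣ) : ℤ) : ℂ) * Complex.I *
    lieDeriv (antiGen u (Complex.I • v)) f x) = _
  rw [lieDeriv_apply_of_extension _ f x hF hf, lieDeriv_apply_of_extension _ f x hF hf,
    antiGen_apply, antiGen_apply, smul_smul, herm_smul_left, map_sub, map_sub,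
    fderiv_smul_eq, fderiv_smul_eq, fderiv_smul_eq, fderiv_smul_eq]
  simp only [map_mul, Complex.conj_I, conj_herm, Units.val_one, Int.cast_one]
  linear_combination ((herm u x * dz v F x - herm v x * dz u F x) / 2 -
    (herm x u * dzbar v F x - herm x v * dzbar u F x) / 2) * Complex.I_sq

theorem op_neg_one_apply_of_extension (u v : Vec p q) {x : cone p q}
    (hF : DifferentiableAt ℝ F x) (hf : ∀ y : cone p q, F y = f y) :
    op (-1) u v f x = herm u x * dz v F x - herm v x * dz u F x := by
  change (2⁻¹ : ℂ) * (lieDeriv (antiGen u v) f x + (((-1 : ℤˣ) : ℤ) : ℂ) * Complex.I *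
    lieDeriv (antiGen u (Complex.I • v)) f x) = _
  rw [lieDeriv_apply_of_extension _ f x hF hf, lieDeriv_apply_of_extension _ f x hF hf,
    antiGen_apply, antiGen_apply, smul_smul, herm_smul_left, map_sub, map_sub,
    fderiv_smul_eq, fderiv_smul_eq, fderiv_smul_eq, fderiv_smul_eq]
  simp only [map_mul, Complex.conj_I, conj_herm, Units.val_neg, Units.val_one, Int.cast_neg,
    Int.cast_one]
  linear_combination (-(herm u x * dz v F x - herm v x * dz u F x) / 2 +
    (herm x u * dzbar v F x - herm x v * dzbar u F x) / 2) * Complex.I_sq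

end Extension

/-- In the antisymmetrised product of the `opE` the terms with two holomorphic or two
antiholomorphic derivatives cancel, and the mixed terms are those of the left side. The terms with a
single `opE` correct for derivatives that fall on the coefficients. The equation of the cone plays
no role in the computation. -/
theorem op_one_op_neg_one (u v u' v' : Vec p q) (f : SmoothFun p q) :
    op 1 u' v' (op (-1) u v f) = opE v v' (opE u u' f) - opE v u' (opE u v' f) +
      herm u v' • opE v u' f - herm u u' • opE v v' f := by
  refine SmoothFun.ext fun x => ?_
  obtain ⟨F, hF, hf⟩ := f.2
  have hx := isOpen_compl_singleton.mem_nhds x.2.1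
  have hFx : ContDiffAt ℝ ∞ F x := hF.contDiffAt hx
  have hd : ∀ y : cone p q, DifferentiableAt ℝ F y := fun y =>
    (hF.contDiffAt (isOpen_compl_singleton.mem_nhds y.2.1)).differentiableAt (by simp)
  have d1 : ∀ w, DifferentiableAt ℝ (dz w F) x := fun w =>
    ((contDiffOn_dz isOpen_compl_singleton hF w).contDiffAt hx).differentiableAt (by simp)
  have d2 : ∀ w, DifferentiableAt ℝ (dzbar w F) x := fun w =>
    ((contDiffOn_dzbar isOpen_compl_singleton hF w).contDiffAt hx).differentiableAt (by simp)
  have e1 : ∀ u v (y : cone p q), hermLeft v y * dz u F y - hermRight u y * dzbar v F y =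
      opE u v f y := fun u v y => (opE_apply_of_extension u v (hd y) hf).symm
  have e2 : ∀ u v (y : cone p q), hermRight u y * dz v F y - hermRight v y * dz u F y =
      op (-1) u v f y := fun u v y => (op_neg_one_apply_of_extension u v (hd y) hf).symm
  simp only [SmoothFun.add_apply, SmoothFun.sub_apply, SmoothFun.smul_apply]
  rw [op_one_apply_of_extension u' v' (differentiableAt_clm_mul_sub _ _ (d1 _) (d1 _)) (e2 u v),
    opE_apply_of_extension v v' (differentiableAt_clm_mul_sub _ _ (d1 _) (d2 _)) (e1 u u'),
    opE_apply_of_extension v u' (differentiableAt_clm_mul_sub _ _ (d1 _) (d2 _)) (e1 u v'),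
    opE_apply_of_extension v u' (hd x) hf, opE_apply_of_extension v v' (hd x) hf,
    dzbar_clm_mul_sub _ _ (d1 _) (d1 _), dzbar_clm_mul_sub _ _ (d1 _) (d1 _),
    dz_clm_mul_sub _ _ (d1 _) (d2 _), dzbar_clm_mul_sub _ _ (d1 _) (d2 _),
    dz_clm_mul_sub _ _ (d1 _) (d2 _), dzbar_clm_mul_sub _ _ (d1 _) (d2 _)]
  simp only [dz_hermLeft, dzbar_hermLeft, dz_hermRight, dzbar_hermRight, hermLeft_apply,
    hermRight_apply]
  rw [dzbar_dz_comm hFx v' v, dzbar_dz_comm hFx v' u, dzbar_dz_comm hFx u' v,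
    dzbar_dz_comm hFx u' u, dz_dz_comm hFx v u, dzbar_dzbar_comm hFx v' u']
  ring

theorem op_neg_one_op_one (u v u' v' : Vec p q) (f : SmoothFun p q) :
    op (-1) u' v' (op 1 u v f) = opE v' v (opE u' u f) - opE u' v (opE v' u f) -
      herm v' u • opE u' v f + herm u' u • opE v' v f := by
  refine SmoothFun.ext fun x => ?_
  obtain ⟨F, hF, hf⟩ := f.2
  have hx := isOpen_compl_singleton.mem_nhds x.2.1
  have hFx : ContDiffAt ℝ ∞ F x := hF.contDiffAt hx
  have hd : ∀ y : cone p q, DifferentiableAt ℝ F y := fun y =>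
    (hF.contDiffAt (isOpen_compl_singleton.mem_nhds y.2.1)).differentiableAt (by simp)
  have d1 : ∀ w, DifferentiableAt ℝ (dz w F) x := fun w =>
    ((contDiffOn_dz isOpen_compl_singleton hF w).contDiffAt hx).differentiableAt (by simp)
  have d2 : ∀ w, DifferentiableAt ℝ (dzbar w F) x := fun w =>
    ((contDiffOn_dzbar isOpen_compl_singleton hF w).contDiffAt hx).differentiableAt (by simp)
  have e1 : ∀ u v (y : cone p q), hermLeft v y * dz u F y - hermRight u y * dzbar v F y =
      opE u v f y := fun u v y => (opE_apply_of_extension u v (hd y) hf).symm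
  have e2 : ∀ u v (y : cone p q), hermLeft u y * dzbar v F y - hermLeft v y * dzbar u F y =
      op 1 u v f y := fun u v y => (op_one_apply_of_extension u v (hd y) hf).symm
  simp only [SmoothFun.add_apply, SmoothFun.sub_apply, SmoothFun.smul_apply]
  rw [op_neg_one_apply_of_extension u' v' (differentiableAt_clm_mul_sub _ _ (d2 _) (d2 _)) (e2 u v),
    opE_apply_of_extension v' v (differentiableAt_clm_mul_sub _ _ (d1 _) (d2 _)) (e1 u' u),
    opE_apply_of_extension u' v (differentiableAt_clm_mul_sub _ _ (d1 _) (d2 _)) (e1 v' u),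
    opE_apply_of_extension u' v (hd x) hf, opE_apply_of_extension v' v (hd x) hf,
    dz_clm_mul_sub _ _ (d2 _) (d2 _), dz_clm_mul_sub _ _ (d2 _) (d2 _),
    dz_clm_mul_sub _ _ (d1 _) (d2 _), dzbar_clm_mul_sub _ _ (d1 _) (d2 _),
    dz_clm_mul_sub _ _ (d1 _) (d2 _), dzbar_clm_mul_sub _ _ (d1 _) (d2 _)]
  simp only [dz_hermLeft, dzbar_hermLeft, dz_hermRight, dzbar_hermRight, hermLeft_apply,
    hermRight_apply]
  rw [dzbar_dz_comm hFx v u', dzbar_dz_comm hFx v v', dz_dz_comm hFx u' v',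
    dzbar_dzbar_comm hFx v u]
  ring


/-! ### Invariance under U(p,q) and weights for the unit scalars -/

variable {p q : ℕ}

section ComplexLinear

/-- The elements of `O(2p,2q)` that commute with the multiplication by `i`. -/
def CommI (g : orthogonalGroup p q) : Prop :=
  ∀ x : Vec p q, g.1 (Complex.I • x) = Complex.I • g.1 x

theorem CommI.smul {g : orthogonalGroup p q} (hg : CommI g) (c : ℂ) (x : Vec p q) :
    g.1 (c • x) = c • g.1 x := by
  rw [smul_eq_re_im, map_add, map_smul, map_smul, hg, ← smul_eq_re_im]

theorem im_herm_eq (u v : Vec p q) : (herm u v).im = (herm u (Complex.I • v)).re := by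
  rw [herm_smul_right, Complex.conj_I]
  simp

theorem CommI.herm {g : orthogonalGroup p q} (hg : CommI g) (u v : Vec p q) :
    LightCone.herm (g.1 u) (g.1 v) = LightCone.herm u v :=
  Complex.ext (g.2 u v) (by rw [im_herm_eq, im_herm_eq, ← hg]; exact g.2 _ _)

/-- The elements of `O(2p,2q)` that commute with `i` form `U(p,q)`. -/
theorem CommI.exists_unitary {g : orthogonalGroup p q} (hg : CommI g) :
    ∃ k : unitaryGroup p q, unitaryToOrthogonal p q k = g :=
  ⟨⟨{ g.1 with map_smul' := hg.smul }, hg.herm⟩, rfl⟩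

theorem commI_unitaryToOrthogonal (k : unitaryGroup p q) : CommI (unitaryToOrthogonal p q k) :=
  fun x => map_smul k.1 Complex.I x

theorem CommI.inv {g : orthogonalGroup p q} (hg : CommI g) : CommI g⁻¹ := by
  obtain ⟨k, rfl⟩ := hg.exists_unitary
  rw [← map_inv]
  exact commI_unitaryToOrthogonal _

theorem commI_oneParam {T : lieAlg p q} (hT : ∀ x, T.1 (Complex.I • x) = Complex.I • T.1 x)
    (t : ℝ) : CommI (oneParam T t) :=
  flow_comm (S := LinearMap.toContinuousLinearMap
    ((LinearMap.lsmul ℂ (Vec p q) Complex.I).restrictScalars ℝ)) hT t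

/-- Invariance under `U(p,q)`. -/
def UInvariant (N : Submodule ℂ (SmoothFun p q)) : Prop :=
  ∀ g : orthogonalGroup p q, CommI g → ∀ f ∈ N, precomp g f ∈ N

theorem UInvariant.lieDeriv_mem {N : Submodule ℂ (SmoothFun p q)} (hU : UInvariant N)
    (hN : IsClosed (N : Set (SmoothFun p q))) {T : lieAlg p q}
    (hT : ∀ x, T.1 (Complex.I • x) = Complex.I • T.1 x) {f : SmoothFun p q} (hf : f ∈ N) :
    lieDeriv T f ∈ N :=
  LightCone.lieDeriv_mem hN T fun t => hU _ (commI_oneParam hT t) f hf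

theorem unitGen_smul (u v : Vec p q) (x : Vec p q) :
    (unitGen u v).1 (Complex.I • x) = Complex.I • (unitGen u v).1 x := by
  rw [unitGen_apply, unitGen_apply, herm_smul_left, herm_smul_left]
  module

theorem unitGenI_smul (u v : Vec p q) (x : Vec p q) :
    (unitGenI u v).1 (Complex.I • x) = Complex.I • (unitGenI u v).1 x := by
  rw [unitGenI_apply, unitGenI_apply, herm_smul_left, herm_smul_left]
  module

/-- `opE` is a complex combination of two generators of one-parameter groups in U(p,q), and
closedness allows differentiating along these groups. -/
theorem UInvariant.opE_mem {N : Submodule ℂ (SmoothFun p q)} (hU : UInvariant N)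
    (hN : IsClosed (N : Set (SmoothFun p q))) (u v : Vec p q) {f : SmoothFun p q} (hf : f ∈ N) :
    opE u v f ∈ N :=
  N.smul_mem _ (N.sub_mem (hU.lieDeriv_mem hN (unitGen_smul u v) hf)
    (N.smul_mem _ (hU.lieDeriv_mem hN (unitGenI_smul u v) hf)))

/-- Although the factors `op` need not preserve `N`, their product in either order is an expression
in the `opE`, which do. -/
theorem UInvariant.op_neg_op_mem {N : Submodule ℂ (SmoothFun p q)} (hU : UInvariant N)
    (hN : IsClosed (N : Set (SmoothFun p q))) (σ : ℤˣ) (u v u' v' : Vec p q) {f : SmoothFun p q}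
    (hf : f ∈ N) : op (-σ) u' v' (op σ u v f) ∈ N := by
  have h : ∀ u v u' v', opE u v (opE u' v' f) ∈ N := fun u v u' v' =>
    hU.opE_mem hN _ _ (hU.opE_mem hN _ _ hf)
  have h' : ∀ (c : ℂ) (u v), c • opE u v f ∈ N := fun c u v =>
    N.smul_mem _ (hU.opE_mem hN _ _ hf)
  rcases Int.units_eq_one_or σ with rfl | rfl
  · rw [op_neg_one_op_one]
    exact N.add_mem (N.sub_mem (N.sub_mem (h _ _ _ _) (h _ _ _ _)) (h' _ _ _)) (h' _ _ _)
  · rw [neg_neg, op_one_op_neg_one]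
    exact N.sub_mem (N.add_mem (N.sub_mem (h _ _ _ _) (h _ _ _ _)) (h' _ _ _)) (h' _ _ _)

theorem op_precomp (σ : ℤˣ) (u v : Vec p q) {g : orthogonalGroup p q} (hg : CommI g)
    (f : SmoothFun p q) :
    op σ u v (precomp g f) = precomp g (op σ (g.1 u) (g.1 v) f) := by
  have h : ∀ (v x : Vec p q), g.1 ((antiGen u v).1 x) = (antiGen (g.1 u) (g.1 v)).1 (g.1 x) :=
    fun v x => by
      rw [antiGen_apply, antiGen_apply, map_sub, hg.smul, hg.smul, hg.herm, hg.herm]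
  change (2⁻¹ : ℂ) • (lieDeriv (antiGen u v) (precomp g f) + (((σ : ℤ) : ℂ) * Complex.I) •
    lieDeriv (antiGen u (Complex.I • v)) (precomp g f)) = _
  rw [lieDeriv_precomp _ g _ (h v), lieDeriv_precomp _ g _ (h (Complex.I • v)), hg, ← map_smul,
    ← map_add, ← map_smul]
  rfl

theorem UInvariant.op_apply_mem_iff {N : Submodule ℂ (SmoothFun p q)} (hU : UInvariant N)
    {σ : ℤˣ} {f : SmoothFun p q} (hf : ∀ u v, op σ u v f ∈ N) {g : orthogonalGroup p q}
    (hg : CommI g) (u v : Vec p q) : op σ u v (precomp g f) ∈ N := by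
  rw [op_precomp σ u v hg]
  exact hU g hg _ (hf _ _)

end ComplexLinear

section Scalars

/-- Multiplication by a complex number of absolute value one. -/
def scalar (p q : ℕ) (ζ : Circle) : orthogonalGroup p q :=
  ⟨(LinearEquiv.smulOfNeZero ℂ (Vec p q) (ζ : ℂ) ζ.coe_ne_zero).restrictScalars ℝ, fun u v => by
    change (herm ((ζ : ℂ) • u) ((ζ : ℂ) • v)).re = _
    rw [herm_smul_left, herm_smul_right, ← mul_assoc, Complex.mul_conj, Circle.normSq_coe,
      Complex.ofReal_one, one_mul]⟩

theorem scalar_apply (ζ : Circle) (x : Vec p q) : (scalar p q ζ).1 x = (ζ : ℂ) • x := rfl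

theorem commI_scalar (ζ : Circle) : CommI (scalar p q ζ) := fun x => smul_comm (ζ : ℂ) _ x

theorem act_scalar_mul (ζ ξ : Circle) (x : cone p q) :
    act (scalar p q (ζ * ξ)) x = act (scalar p q ζ) (act (scalar p q ξ) x) :=
  Subtype.ext (mul_smul (ζ : ℂ) (ξ : ℂ) (x : Vec p q))

theorem act_scalar_comm {g : orthogonalGroup p q} (hg : CommI g) (ζ : Circle) (x : cone p q) :
    act g (act (scalar p q ζ) x) = act (scalar p q ζ) (act g x) :=
  Subtype.ext (hg.smul ζ (x : Vec p q))

theorem continuous_toCLM_scalar : Continuous fun ζ => toCLM (scalar p q ζ) := by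
  have : (fun ζ => toCLM (scalar p q ζ)) = fun ζ : Circle =>
      (ζ : ℂ) • ContinuousLinearMap.id ℝ (Vec p q) := by
    funext ζ
    refine ContinuousLinearMap.ext fun x => ?_
    rfl
  rw [this]
  fun_prop

theorem dz_smul (c : ℂ) (w : Vec p q) (F : Vec p q → ℂ) (x : Vec p q) :
    dz (c • w) F x = c * dz w F x := by
  rw [dz, smul_smul, fderiv_smul_eq, fderiv_smul_eq, map_mul, Complex.conj_I]
  linear_combination ((-c * dz w F x + conj c * dzbar w F x) / 2) * Complex.I_sq

theorem dzbar_smul (c : ℂ) (w : Vec p q) (F : Vec p q → ℂ) (x : Vec p q) :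
    dzbar (c • w) F x = conj c * dzbar w F x := by
  rw [dzbar, smul_smul, fderiv_smul_eq, fderiv_smul_eq, map_mul, Complex.conj_I]
  linear_combination ((c * dz w F x - conj c * dzbar w F x) / 2) * Complex.I_sq

/-- `op 1` is antilinear in each vector and `op (-1)` is linear in each, so the two factors `ζ`
contribute the power -2 or 2. Conjugating by scalars, this becomes the weight shift by `2σ`. -/
theorem op_scalar (σ : ℤˣ) (u v : Vec p q) (ζ : Circle) (f : SmoothFun p q) :
    op σ ((ζ : ℂ) • u) ((ζ : ℂ) • v) f = (ζ : ℂ) ^ (-2 * (σ : ℤ)) • op σ u v f := by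
  refine SmoothFun.ext fun x => ?_
  obtain ⟨F, hF, hf⟩ := f.2
  have hd : DifferentiableAt ℝ F x :=
    (hF.contDiffAt (isOpen_compl_singleton.mem_nhds x.2.1)).differentiableAt (by simp)
  rw [SmoothFun.smul_apply]
  rcases Int.units_eq_one_or σ with rfl | rfl
  · rw [op_one_apply_of_extension _ _ hd hf, op_one_apply_of_extension _ _ hd hf,
      herm_smul_right, herm_smul_right, dzbar_smul, dzbar_smul, ← Circle.coe_inv_eq_conj,
      Circle.coe_inv, Units.val_one, mul_one, zpow_neg]
    have : (ζ : ℂ) ≠ 0 := ζ.coe_ne_zero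
    field_simp
  · rw [op_neg_one_apply_of_extension _ _ hd hf, op_neg_one_apply_of_extension _ _ hd hf,
      herm_smul_left, herm_smul_left, dz_smul, dz_smul]
    rw [Units.val_neg, Units.val_one, neg_mul_neg, mul_one, zpow_ofNat]
    ring

theorem op_precomp_scalar (σ : ℤˣ) (u v : Vec p q) (ζ : Circle) (f : SmoothFun p q) :
    op σ u v (precomp (scalar p q ζ) f) =
      (ζ : ℂ) ^ (-2 * (σ : ℤ)) • precomp (scalar p q ζ) (op σ u v f) := by
  rw [op_precomp σ u v (commI_scalar ζ), scalar_apply, scalar_apply, op_scalar, map_smul]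

/-- The functions with `f(ζx) = ζ^m f(x)` for `|ζ| = 1`. -/
def wt (p q : ℕ) (m : ℤ) : Submodule ℂ (SmoothFun p q) where
  carrier := {f | ∀ ζ : Circle, precomp (scalar p q ζ) f = (ζ : ℂ) ^ m • f}
  zero_mem' ζ := by rw [map_zero, smul_zero]
  add_mem' hf hg ζ := by rw [map_add, hf ζ, hg ζ, smul_add]
  smul_mem' c f hf ζ := by rw [map_smul, hf ζ, smul_comm]

theorem isClosed_setOf_apply_eq (x y : cone p q) (c : ℂ) :
    IsClosed {f : SmoothFun p q | f x = c * f y} :=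
  isClosed_eq (continuous_eval x) (continuous_const.mul (continuous_eval y))

theorem mem_wt_iff {m : ℤ} {f : SmoothFun p q} :
    f ∈ wt p q m ↔ ∀ (ζ : Circle) (x : cone p q), f (act (scalar p q ζ) x) = (ζ : ℂ) ^ m * f x := by
  refine forall_congr' fun ζ => ⟨fun h x => ?_, fun h => SmoothFun.ext fun x => ?_⟩
  · rw [← precomp_apply, h, SmoothFun.smul_apply]
  · rw [precomp_apply, h, SmoothFun.smul_apply]

theorem isClosed_wt (m : ℤ) : IsClosed (wt p q m : Set (SmoothFun p q)) := by
  have : (wt p q m : Set (SmoothFun p q)) = ⋂ (ζ : Circle) (x : cone p q),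
      {f | f (act (scalar p q ζ) x) = (ζ : ℂ) ^ m * f x} := by
    ext f
    simp only [SetLike.mem_coe, mem_wt_iff, mem_iInter, mem_ofPred_eq]
  rw [this]
  exact isClosed_iInter fun ζ => isClosed_iInter fun x => isClosed_setOf_apply_eq _ _ _

theorem uInvariant_wt (m : ℤ) : UInvariant (wt p q m) := fun g hg f hf => by
  rw [mem_wt_iff] at hf ⊢
  intro ζ x
  rw [precomp_apply, precomp_apply, act_scalar_comm hg, hf]

theorem op_mem_wt (σ : ℤˣ) (u v : Vec p q) {m : ℤ} {f : SmoothFun p q} (hf : f ∈ wt p q m) :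
    op σ u v f ∈ wt p q (m + 2 * σ) := fun ζ => by
  have h := op_precomp_scalar σ u v ζ f
  rw [hf ζ, map_smul] at h
  have h2 := congrArg (fun f => (ζ : ℂ) ^ (2 * (σ : ℤ)) • f) h
  simp only [smul_smul] at h2
  rw [← zpow_add₀ ζ.coe_ne_zero, ← zpow_add₀ ζ.coe_ne_zero, ← add_mul, add_neg_cancel, zero_mul,
    zpow_zero, one_smul] at h2
  rw [← h2, add_comm]

instance : MeasurableSpace Circle := borel Circle

instance : BorelSpace Circle := ⟨rfl⟩

/-- The invariant probability measure of a compact group. -/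
def compactHaar (G : Type*) [TopologicalSpace G] [Group G] [IsTopologicalGroup G] [CompactSpace G]
    [MeasurableSpace G] [BorelSpace G] : Measure G :=
  Measure.haarMeasure (⊤ : TopologicalSpace.PositiveCompacts G)

section
variable (G : Type*) [TopologicalSpace G] [Group G] [IsTopologicalGroup G] [CompactSpace G]
    [MeasurableSpace G] [BorelSpace G]

instance : IsProbabilityMeasure (compactHaar G) :=
  ⟨Measure.haarMeasure_self (K₀ := (⊤ : TopologicalSpace.PositiveCompacts G))⟩

instance : (compactHaar G).IsHaarMeasure :=
  inferInstanceAs (Measure.haarMeasure _).IsHaarMeasure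

end

theorem continuous_circle_zpow (m : ℤ) : Continuous fun ζ : Circle => (ζ : ℂ) ^ m :=
  Continuous.zpow₀ (by fun_prop) m fun ζ => Or.inl ζ.coe_ne_zero

/-- The projection to the functions of weight `m`. -/
def proj (p q : ℕ) (m : ℤ) : SmoothFun p q →ₗ[ℂ] SmoothFun p q :=
  average (compactHaar Circle) continuous_toCLM_scalar (continuous_circle_zpow (-m))

theorem proj_apply (m : ℤ) (f : SmoothFun p q) (x : cone p q) :
    proj p q m f x = ∫ ζ : Circle, (ζ : ℂ) ^ (-m) * f (act (scalar p q ζ) x) ∂compactHaar Circle :=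
  rfl

theorem continuous_proj (m : ℤ) : Continuous (proj p q m) := continuous_average _ _ _

theorem proj_mem {N : Submodule ℂ (SmoothFun p q)} (hN : IsClosed (N : Set (SmoothFun p q)))
    (hU : UInvariant N) (m : ℤ) {f : SmoothFun p q} (hf : f ∈ N) : proj p q m f ∈ N :=
  average_mem _ _ _ hN fun ζ => hU _ (commI_scalar ζ) f hf

theorem proj_mem_wt (m : ℤ) (f : SmoothFun p q) : proj p q m f ∈ wt p q m := by
  rw [mem_wt_iff]
  intro ζ x
  rw [proj_apply, proj_apply, ← integral_const_mul,
    ← integral_mul_left_eq_self (μ := compactHaar Circle)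
      (fun ξ : Circle => (ζ : ℂ) ^ m * ((ξ : ℂ) ^ (-m) * f (act (scalar p q ξ) x))) ζ]
  refine integral_congr_ae (Filter.Eventually.of_forall fun ξ => ?_)
  simp only [Circle.coe_mul, mul_zpow, mul_comm ζ ξ, act_scalar_mul]
  have h : (ζ : ℂ) ^ m * (ζ : ℂ) ^ (-m) = 1 := by
    rw [← zpow_add₀ ζ.coe_ne_zero, add_neg_cancel, zpow_zero]
  linear_combination (-(ξ : ℂ) ^ (-m) * f (act (scalar p q ξ) (act (scalar p q ζ) x))) * h

theorem proj_eq_self {m : ℤ} {f : SmoothFun p q} (hf : f ∈ wt p q m) : proj p q m f = f := by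
  refine SmoothFun.ext fun x => ?_
  rw [mem_wt_iff] at hf
  simp only [proj_apply, hf, ← mul_assoc]
  have : ∀ ζ : Circle, (ζ : ℂ) ^ (-m) * (ζ : ℂ) ^ m = 1 := fun ζ => by
    rw [← zpow_add₀ ζ.coe_ne_zero, neg_add_cancel, zpow_zero]
  simp only [this, one_mul, integral_const, probReal_univ, one_smul]

theorem eq_zero_of_mem_wt {m m' : ℤ} (h : m ≠ m') {f : SmoothFun p q} (hf : f ∈ wt p q m)
    (hf' : f ∈ wt p q m') : f = 0 := by
  have hd : ((m : ℝ) - m') ≠ 0 := sub_ne_zero.2 (by exact_mod_cast h)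
  -- A point of the circle with `ζ ^ (m - m') = -1`; the two transformation rules at `ζ` then differ
  -- by a sign.
  let ζ := Circle.exp (Real.pi / (m - m'))
  have h1 : (ζ : ℂ) ^ (m - m') = -1 := by
    rw [Circle.coe_exp, ← Complex.exp_int_mul, ← Complex.exp_pi_mul_I]
    congr 1
    have : ((m : ℂ) - m') ≠ 0 := by exact_mod_cast hd
    push_cast
    field_simp
  have h2 := (hf ζ).symm.trans (hf' ζ)
  rw [← sub_add_cancel m m', zpow_add₀ ζ.coe_ne_zero, h1, neg_one_mul, neg_smul] at h2
  have h3 : (2 * (ζ : ℂ) ^ m') • f = 0 := by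
    rw [mul_smul, two_smul]
    nth_rewrite 1 [← h2]
    exact neg_add_cancel _
  exact (smul_eq_zero.1 h3).resolve_left (mul_ne_zero two_ne_zero (zpow_ne_zero _ ζ.coe_ne_zero))

theorem proj_eq_zero {m m' : ℤ} (h : m ≠ m') {f : SmoothFun p q} (hf : f ∈ wt p q m') :
    proj p q m f = 0 :=
  eq_zero_of_mem_wt h (proj_mem_wt m f) (proj_mem (isClosed_wt m') (uInvariant_wt m') m hf)

theorem proj_precomp (m : ℤ) {g : orthogonalGroup p q} (hg : CommI g) (f : SmoothFun p q) :
    proj p q m (precomp g f) = precomp g (proj p q m f) := by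
  refine SmoothFun.ext fun x => ?_
  rw [precomp_apply, proj_apply, proj_apply]
  simp only [precomp_apply, act_scalar_comm hg]

theorem continuous_lieDeriv_precomp {G : Type*} [TopologicalSpace G] {a : G → orthogonalGroup p q}
    (ha : Continuous fun g => toCLM (a g)) (T : lieAlg p q) (f : SmoothFun p q) (x : cone p q) :
    Continuous fun g => lieDeriv T (precomp (a g) f) x := by
  have hc := (continuousOn_iteratedFDeriv_precomp ha f 1).comp_continuous
    (f := fun g => (g, (x : Vec p q))) (by fun_prop)
    fun g => ⟨mem_univ _, cone_subset_polarDomain x.2⟩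
  have h := (ContinuousMultilinearMap.apply ℝ (fun _ : Fin 1 => Vec p q) ℂ
    (fun _ => T.1 x)).continuous.comp hc
  refine h.congr fun g => ?_
  rw [lieDeriv_apply]
  exact iteratedFDeriv_one_apply (f := pullback (precomp (a g) f)) (x := (x : Vec p q))
    fun _ => T.1 x

/-- Lie derivatives pass under the average, and moving `op` past the scalar `ζ` changes the
character in the integral from the one for `m` to the one for `m + 2σ`. -/
theorem op_proj (σ : ℤˣ) (u v : Vec p q) (m : ℤ) (f : SmoothFun p q) :
    op σ u v (proj p q m f) = proj p q (m + 2 * σ) (op σ u v f) := by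
  refine SmoothFun.ext fun x => ?_
  have hφ := continuous_circle_zpow (-m)
  have hi : ∀ T : lieAlg p q, Integrable (fun ζ : Circle =>
      (ζ : ℂ) ^ (-m) * lieDeriv T (precomp (scalar p q ζ) f) x) (compactHaar Circle) := fun T =>
    integrable_of_continuous_of_compactSpace
    (μ := compactHaar Circle) (hφ.mul (continuous_lieDeriv_precomp continuous_toCLM_scalar T f x))
  have h : ∀ ζ : Circle, (ζ : ℂ) ^ (-m) * op σ u v (precomp (scalar p q ζ) f) x =
      (ζ : ℂ) ^ (-(m + 2 * (σ : ℤ))) * op σ u v f (act (scalar p q ζ) x) := fun ζ => by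
    rw [op_precomp_scalar, SmoothFun.smul_apply, precomp_apply, ← mul_assoc,
      ← zpow_add₀ ζ.coe_ne_zero, neg_add, neg_mul]
  rw [proj_apply]
  simp only [← h]
  change (2⁻¹ : ℂ) * (lieDeriv (antiGen u v) (average _ _ hφ f) x + ((σ : ℤ) : ℂ) * Complex.I *
    lieDeriv (antiGen u (Complex.I • v)) (average _ _ hφ f) x) = _
  rw [lieDeriv_average, lieDeriv_average, ← integral_const_mul, ← integral_add (hi _)
    ((hi _).const_mul _), ← integral_const_mul]
  refine integral_congr_ae (Filter.Eventually.of_forall fun ζ => ?_)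
  change _ = (ζ : ℂ) ^ (-m) * ((2⁻¹ : ℂ) * (lieDeriv (antiGen u v) (precomp (scalar p q ζ) f) x +
    ((σ : ℤ) : ℂ) * Complex.I *
      lieDeriv (antiGen u (Complex.I • v)) (precomp (scalar p q ζ) f) x))
  ring

end Scalars

/-! ### The closed space generated by N under raising and lowering -/

section Chain

variable (V N : Submodule ℂ (SmoothFun p q)) (n : ℤ)

/-- The functions of weight `n + 2σj` in `V` that all products of `j` operators `op (-σ) u v` take
to `N`. -/
def chain (σ : ℤˣ) : ℕ → Submodule ℂ (SmoothFun p q)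
  | 0 => N
  | j + 1 => V ⊓ wt p q (n + 2 * σ * (j + 1)) ⊓ ⨅ (u) (v), (chain σ j).comap (op (-σ) u v)

/-- The functions in `V` whose components of weight `n + 2σj` lie in the chain. -/
def hull : Submodule ℂ (SmoothFun p q) :=
  V ⊓ ⨅ (σ : ℤˣ) (j : ℕ), (chain V N n σ j).comap (proj p q (n + 2 * σ * j))

variable {V N n}

theorem mem_chain_succ {σ : ℤˣ} {j : ℕ} {f : SmoothFun p q} :
    f ∈ chain V N n σ (j + 1) ↔ (f ∈ V ∧ f ∈ wt p q (n + 2 * σ * (j + 1))) ∧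
      ∀ u v, op (-σ) u v f ∈ chain V N n σ j := by
  simp only [chain, Submodule.mem_inf, Submodule.mem_iInf, Submodule.mem_comap]

theorem mem_hull {f : SmoothFun p q} : f ∈ hull V N n ↔ f ∈ V ∧ ∀ (σ : ℤˣ) (j : ℕ),
    proj p q (n + 2 * σ * j) f ∈ chain V N n σ j := by
  simp only [hull, Submodule.mem_inf, Submodule.mem_iInf, Submodule.mem_comap]

variable (hV : IsClosed (V : Set (SmoothFun p q))) (hVU : UInvariant V)
  (hVop : ∀ σ u v, ∀ f ∈ V, op σ u v f ∈ V)
  (hN : IsClosed (N : Set (SmoothFun p q))) (hNU : UInvariant N) (hNV : N ≤ V)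
  (hNn : N ≤ wt p q n)

include hV hN in
theorem isClosed_chain (σ : ℤˣ) : ∀ j, IsClosed (chain V N n σ j : Set (SmoothFun p q))
  | 0 => hN
  | j + 1 => by
    have : (chain V N n σ (j + 1) : Set (SmoothFun p q)) =
        (V ∩ wt p q (n + 2 * σ * (j + 1)) : Set (SmoothFun p q)) ∩
        ⋂ (u) (v), op (-σ) u v ⁻¹' (chain V N n σ j) := by
      ext f
      simp only [SetLike.mem_coe, mem_chain_succ, mem_inter_iff, mem_iInter, mem_preimage]
    rw [this]
    exact (hV.inter (isClosed_wt _)).inter (isClosed_iInter fun u => isClosed_iInter fun v =>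
      (isClosed_chain σ j).preimage (continuous_op _ u v))

include hVU hNU in
theorem uInvariant_chain (σ : ℤˣ) : ∀ j, UInvariant (chain V N n σ j)
  | 0 => hNU
  | j + 1 => fun g hg f hf => by
    rw [mem_chain_succ] at hf ⊢
    exact ⟨⟨hVU g hg f hf.1.1, uInvariant_wt _ g hg f hf.1.2⟩,
      (uInvariant_chain σ j).op_apply_mem_iff hf.2 hg⟩

include hNV hNn in
theorem chain_le (σ : ℤˣ) (j : ℕ) : chain V N n σ j ≤ V ⊓ wt p q (n + 2 * σ * j) := by
  cases j with
  | zero => simpa [chain] using ⟨hNV, hNn⟩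
  | succ j => exact fun f hf => by simpa using (mem_chain_succ.1 hf).1

include hV hVU hVop hN hNU hNV hNn in
-- Membership one step further out is tested by stepping back with `op (-σ)`, and such a product of
-- opposite operators preserves the closed U(p,q)-invariant space `chain V N n σ j`.
theorem op_mem_chain_succ (σ : ℤˣ) (j : ℕ) {f : SmoothFun p q} (hf : f ∈ chain V N n σ j)
    (u v : Vec p q) : op σ u v f ∈ chain V N n σ (j + 1) := by
  have h := chain_le hNV hNn σ j hf
  refine mem_chain_succ.2 ⟨⟨hVop _ _ _ _ h.1, ?_⟩, fun u' v' => ?_⟩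
  · have := op_mem_wt σ u v h.2
    rwa [add_assoc, ← mul_add_one] at this
  · exact (uInvariant_chain hVU hNU σ j).op_neg_op_mem (isClosed_chain hV hN σ j) σ u v u' v' hf

include hV hVU hVop hN hNU hNV hNn in
-- The component of weight `n + 2σj` of `op τ u v f` comes from the component of `f` whose weight is
-- smaller by `2τ`. An operator that moves away from `n` is covered by `op_mem_chain_succ`, one that
-- moves towards `n` by the definition of the chain.
theorem op_mem_hull (τ : ℤˣ) (u v : Vec p q) {f : SmoothFun p q} (hf : f ∈ hull V N n) :
    op τ u v f ∈ hull V N n := by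
  rw [mem_hull] at hf ⊢
  have key : ∀ (σ : ℤˣ) (j : ℕ) (m : ℤ), m = n + 2 * σ * j - 2 * τ →
      op τ u v (proj p q m f) ∈ chain V N n σ j →
      proj p q (n + 2 * σ * j) (op τ u v f) ∈ chain V N n σ j := fun σ j m hm h => by
    rw [op_proj, hm, sub_add_cancel] at h
    exact h
  refine ⟨hVop _ _ _ _ hf.1, fun σ j => ?_⟩
  rcases eq_or_ne τ σ with rfl | hne
  · cases j with
    | zero =>
      -- Weight `n` is reached from `n - 2τ`, which is the first place on the opposite branch `-τ`.
      refine key _ _ (n + 2 * ((-τ : ℤˣ) : ℤ) * (0 + 1 : ℕ)) (by simp [sub_eq_add_neg]) ?_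
      have := (mem_chain_succ.1 (hf.2 (-τ) (0 + 1))).2 u v
      rwa [neg_neg] at this
    | succ j =>
      refine key _ _ (n + 2 * (τ : ℤ) * j) (by push_cast; ring) ?_
      exact op_mem_chain_succ hV hVU hVop hN hNU hNV hNn τ j (hf.2 τ j) u v
  · have hτ : τ = -σ := by
      rcases Int.units_eq_one_or τ with rfl | rfl <;> rcases Int.units_eq_one_or σ with rfl | rfl <;>
        simp_all
    subst hτ
    refine key _ _ (n + 2 * (σ : ℤ) * (j + 1 : ℕ)) (by push_cast; ring) ?_
    exact (mem_chain_succ.1 (hf.2 σ (j + 1))).2 u v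

include hV hN in
theorem isClosed_hull : IsClosed (hull V N n : Set (SmoothFun p q)) := by
  have : (hull V N n : Set (SmoothFun p q)) = (V : Set (SmoothFun p q)) ∩
      ⋂ (σ : ℤˣ) (j : ℕ), proj p q (n + 2 * σ * j) ⁻¹' (chain V N n σ j) := by
    ext f
    simp only [SetLike.mem_coe, mem_hull, mem_inter_iff, mem_iInter, mem_preimage]
  rw [this]
  exact hV.inter (isClosed_iInter fun σ => isClosed_iInter fun j =>
    (isClosed_chain hV hN σ j).preimage (continuous_proj _))

include hVU hNU in
theorem uInvariant_hull : UInvariant (hull V N n) := fun g hg f hf => by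
  rw [mem_hull] at hf ⊢
  refine ⟨hVU g hg f hf.1, fun σ j => ?_⟩
  rw [proj_precomp _ hg]
  exact uInvariant_chain hVU hNU σ j g hg _ (hf.2 σ j)

/-- Lowering a function of `W` of weight `n + 2σj` back to weight `n` stays in `W`, hence ends in
`N`. Components whose weight differs from `n` by an odd number carry no condition in the hull beyond
`f ∈ V`. -/
theorem le_hull_of_op_mem {W : Submodule ℂ (SmoothFun p q)}
    (hW : IsClosed (W : Set (SmoothFun p q))) (hWU : UInvariant W)
    (hWop : ∀ σ u v, ∀ f ∈ W, op σ u v f ∈ W) (hWV : W ≤ V) (hWN : W ⊓ wt p q n ≤ N) :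
    W ≤ hull V N n := by
  have h : ∀ (σ : ℤˣ) (j : ℕ), W ⊓ wt p q (n + 2 * σ * j) ≤ chain V N n σ j := by
    intro σ j
    induction j with
    | zero => simpa [chain] using hWN
    | succ j ih =>
      rintro f ⟨hf, hf'⟩
      refine mem_chain_succ.2 ⟨⟨hWV hf, by simpa using hf'⟩, fun u v => ih ⟨hWop _ _ _ _ hf, ?_⟩⟩
      have := op_mem_wt (-σ) u v hf'
      have e : n + 2 * (σ : ℤ) * (j + 1 : ℕ) + 2 * ((-σ : ℤˣ) : ℤ) = n + 2 * σ * j := by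
        push_cast
        ring
      rwa [e] at this
  exact fun f hf => mem_hull.2 ⟨hWV hf, fun σ j =>
    h σ j ⟨proj_mem hW hWU _ hf, proj_mem_wt _ _⟩⟩

include hNV hNn in
theorem le_hull : N ≤ hull V N n := fun f hf => mem_hull.2 ⟨hNV hf, fun σ j => by
  cases j with
  | zero =>
    simp only [Nat.cast_zero, mul_zero, add_zero]
    rw [proj_eq_self (hNn hf)]
    exact hf
  | succ j =>
    rw [proj_eq_zero (m' := n) _ (hNn hf)]
    · exact Submodule.zero_mem _
    · rcases Int.units_eq_one_or σ with rfl | rfl <;> push_cast <;> omega⟩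

theorem mem_of_mem_hull {f : SmoothFun p q} (hf : f ∈ hull V N n) (hfn : f ∈ wt p q n) : f ∈ N := by
  have := (mem_hull.1 hf).2 1 0
  simp only [Nat.cast_zero, mul_zero, add_zero] at this
  rwa [proj_eq_self hfn] at this

end Chain


/-! ### Spherical harmonics in three variables and the Casimir operator -/

section Polynomials

open MvPolynomial

theorem pderiv_pderiv_comm {σ : Type*} (i j : σ) (Q : MvPolynomial σ ℂ) :
    pderiv i (pderiv j Q) = pderiv j (pderiv i Q) := by
  classical
  have h : ⁅pderiv (R := ℂ) i, pderiv (R := ℂ) j⁆ = (0 : Derivation ℂ (MvPolynomial σ ℂ) _) :=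
    MvPolynomial.derivation_ext fun k => by
      rw [Derivation.commutator_apply, pderiv_X, pderiv_X]
      simp [Pi.single_apply]
      split_ifs <;> simp
  have h2 := congrArg (fun D => D Q) h
  simpa [Derivation.commutator_apply, sub_eq_zero] using h2

/-- The infinitesimal rotation `x_i ∂_j - x_j ∂_i` of polynomials. -/
def polyRot (i j : Fin 3) : MvPolynomial (Fin 3) ℂ →ₗ[ℂ] MvPolynomial (Fin 3) ℂ :=
  LinearMap.mulLeft ℂ (X i) ∘ₗ (pderiv j).toLinearMap -
    LinearMap.mulLeft ℂ (X j) ∘ₗ (pderiv i).toLinearMap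

theorem polyRot_apply (i j : Fin 3) (Q : MvPolynomial (Fin 3) ℂ) :
    polyRot i j Q = X i * pderiv j Q - X j * pderiv i Q := rfl

/-- The sum of the squares of the infinitesimal rotations. -/
def polyCasimir : Module.End ℂ (MvPolynomial (Fin 3) ℂ) :=
  ∑ i, ∑ j, polyRot i j ∘ₗ polyRot i j

/-- The squared norm as a polynomial. -/
def sqNorm : MvPolynomial (Fin 3) ℂ := ∑ i, X i ^ 2

/-- The Laplacian of polynomials. -/
def laplacian : MvPolynomial (Fin 3) ℂ →ₗ[ℂ] MvPolynomial (Fin 3) ℂ :=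
  ∑ i, (pderiv i).toLinearMap ∘ₗ (pderiv i).toLinearMap

theorem laplacian_apply (Q : MvPolynomial (Fin 3) ℂ) :
    laplacian Q = ∑ i, pderiv i (pderiv i Q) := by
  simp [laplacian]

theorem polyCasimir_apply (Q : MvPolynomial (Fin 3) ℂ) :
    polyCasimir Q = ∑ i, ∑ j, polyRot i j (polyRot i j Q) := by
  simp [polyCasimir]

/-- The angular part of the Laplacian in dimension three: with the Euler operator `E`, the squared
rotations add up to `|x|² Δ - E² - E`. The factor 2 arises because the sum runs over ordered pairs.
-/
theorem polyCasimir_eq (Q : MvPolynomial (Fin 3) ℂ) :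
    polyCasimir Q = 2 * (sqNorm * laplacian Q - (∑ i, X i * pderiv i (∑ j, X j * pderiv j Q) +
      ∑ i, X i * pderiv i Q)) := by
  have h01 : pderiv (0 : Fin 3) (X 1 : MvPolynomial (Fin 3) ℂ) = 0 := pderiv_X_of_ne (by decide)
  have h02 : pderiv (0 : Fin 3) (X 2 : MvPolynomial (Fin 3) ℂ) = 0 := pderiv_X_of_ne (by decide)
  have h10 : pderiv (1 : Fin 3) (X 0 : MvPolynomial (Fin 3) ℂ) = 0 := pderiv_X_of_ne (by decide)
  have h12 : pderiv (1 : Fin 3) (X 2 : MvPolynomial (Fin 3) ℂ) = 0 := pderiv_X_of_ne (by decide)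
  have h20 : pderiv (2 : Fin 3) (X 0 : MvPolynomial (Fin 3) ℂ) = 0 := pderiv_X_of_ne (by decide)
  have h21 : pderiv (2 : Fin 3) (X 1 : MvPolynomial (Fin 3) ℂ) = 0 := pderiv_X_of_ne (by decide)
  simp only [polyCasimir_apply, laplacian_apply, sqNorm, polyRot_apply, Fin.sum_univ_three,
    map_sub, map_add, pderiv_mul, pderiv_X_self, h01, h02, h10, h12, h20, h21]
  rw [pderiv_pderiv_comm 1 0, pderiv_pderiv_comm 2 0, pderiv_pderiv_comm 2 1]
  ring

theorem polyCasimir_of_isHomogeneous {Q : MvPolynomial (Fin 3) ℂ} {d : ℕ}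
    (hQ : Q.IsHomogeneous d) :
    polyCasimir Q = (-2 * (d * (d + 1)) : ℂ) • Q + 2 * (sqNorm * laplacian Q) := by
  rw [polyCasimir_eq, hQ.sum_X_mul_pderiv]
  simp only [map_nsmul, mul_smul_comm]
  rw [← Finset.smul_sum, hQ.sum_X_mul_pderiv]
  simp only [MvPolynomial.smul_eq_C_mul, nsmul_eq_mul, map_mul, map_neg, map_natCast, map_add,
    map_one, map_ofNat]
  ring

theorem isHomogeneous_laplacian {Q : MvPolynomial (Fin 3) ℂ} {d : ℕ} (hQ : Q.IsHomogeneous (d + 2)) :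
    (laplacian Q).IsHomogeneous d := by
  rw [laplacian_apply]
  exact IsHomogeneous.sum _ _ _ fun i _ => (hQ.pderiv (i := i)).pderiv (i := i)

theorem laplacian_eq_zero {Q : MvPolynomial (Fin 3) ℂ} {d : ℕ} (hd : d < 2)
    (hQ : Q.IsHomogeneous d) : laplacian Q = 0 := by
  rw [laplacian_apply]
  refine Finset.sum_eq_zero fun i _ => ?_
  have h : (pderiv i Q).IsHomogeneous 0 := by
    have := hQ.pderiv (i := i)
    rwa [show d - 1 = 0 by omega] at this
  rw [totalDegree_eq_zero_iff_eq_C.1 (h.totalDegree_le.antisymm (Nat.zero_le _)), pderiv_C]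

/-- Rotations are derivations that annihilate the squared norm. -/
theorem polyCasimir_sqNorm_mul (Q : MvPolynomial (Fin 3) ℂ) :
    polyCasimir (sqNorm * Q) = sqNorm * polyCasimir Q := by
  have h : ∀ i j (Q : MvPolynomial (Fin 3) ℂ), polyRot i j (sqNorm * Q) = sqNorm * polyRot i j Q := by
    intro i j Q
    have h2 : ∀ i, pderiv i sqNorm = 2 * (X i : MvPolynomial (Fin 3) ℂ) := fun i => by
      simp [sqNorm, pderiv_X, Pi.single_apply]
    rw [polyRot_apply, polyRot_apply, pderiv_mul, pderiv_mul, h2, h2]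
    ring
  simp only [polyCasimir_apply, h, Finset.mul_sum]

theorem aeval_polyCasimir_sqNorm_mul (s : Polynomial ℂ) (Q : MvPolynomial (Fin 3) ℂ) :
    Polynomial.aeval polyCasimir s (sqNorm * Q) =
      sqNorm * Polynomial.aeval polyCasimir s Q := by
  induction s using Polynomial.induction_on' generalizing Q with
  | add s t hs ht => rw [map_add, LinearMap.add_apply, LinearMap.add_apply, hs, ht, mul_add]
  | monomial n a =>
    have h : ∀ n, (polyCasimir ^ n) (sqNorm * Q) = sqNorm * (polyCasimir ^ n) Q := fun n => by
      induction n with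
      | zero => rfl
      | succ n ih => rw [pow_succ', Module.End.mul_apply, ih, polyCasimir_sqNorm_mul]; rfl
    rw [Polynomial.aeval_monomial]
    simp only [Module.End.mul_apply, h, Module.algebraMap_end_apply, mul_smul_comm]

/-- The Casimir operator has only the eigenvalues `-2l(l+1)`, `l ≤ d` of the same parity as `d`, on
homogeneous polynomials of degree `d`. -/
theorem aeval_polyCasimir_eq_zero (d : ℕ) : ∀ {Q : MvPolynomial (Fin 3) ℂ} (_ : Q.IsHomogeneous d)
    {s : Polynomial ℂ} (_ : ∀ l ≤ d, Even (d + l) → s.eval (-2 * (l * (l + 1)) : ℂ) = 0),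
    Polynomial.aeval polyCasimir s Q = 0 := by
  induction d using Nat.strong_induction_on with
  | _ d ih =>
  intro Q hQ s hs
  -- The factor of `s` at the eigenvalue of degree `d` sends `Q` to a multiple of `sqNorm *
  -- laplacian Q`. The remaining factor acts on `laplacian Q`, of degree `d - 2`, and kills it by
  -- induction.
  obtain ⟨t, rfl⟩ := Polynomial.dvd_iff_isRoot.2 (hs d le_rfl ⟨d, rfl⟩)
  have h1 : Polynomial.aeval polyCasimir (Polynomial.X - Polynomial.C (-2 * (d * (d + 1)) : ℂ)) Q =
      sqNorm * ((2 : ℂ) • laplacian Q) := by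
    rw [map_sub, Polynomial.aeval_X, Polynomial.aeval_C, LinearMap.sub_apply,
      Module.algebraMap_end_apply, polyCasimir_of_isHomogeneous hQ, add_sub_cancel_left,
      MvPolynomial.smul_eq_C_mul, map_ofNat]
    ring
  rw [mul_comm, map_mul, Module.End.mul_apply, h1, aeval_polyCasimir_sqNorm_mul]
  rcases lt_or_ge d 2 with hd | hd
  · rw [laplacian_eq_zero hd hQ, smul_zero, map_zero, mul_zero]
  · obtain ⟨e, rfl⟩ := Nat.exists_eq_add_of_le' hd
    rw [map_smul, ih e (by omega) (isHomogeneous_laplacian hQ), smul_zero, mul_zero]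
    intro l hl he
    have h2 := hs l (by omega) (by rw [show e + 2 + l = e + l + 2 by ring]; exact he.add even_two)
    rw [Polynomial.eval_mul, Polynomial.eval_sub, Polynomial.eval_X, Polynomial.eval_C] at h2
    -- The eigenvalues for `l ≤ d - 2` differ from the one for `d`, so their vanishing must come
    -- from the remaining factor.
    refine (mul_eq_zero.1 h2).resolve_left fun h => ?_
    have h3 : (l * (l + 1) : ℂ) = ((e + 2 : ℕ) * ((e + 2 : ℕ) + 1)) := by linear_combination -h / 2
    have h4 : l * (l + 1) = (e + 2) * ((e + 2) + 1) := by exact_mod_cast h3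
    nlinarith

theorem eval_neg_of_isHomogeneous {Q : MvPolynomial (Fin 3) ℂ} {d : ℕ} (hQ : Q.IsHomogeneous d)
    (y : Fin 3 → ℂ) : eval (-y) Q = (-1) ^ d * eval y Q := by
  rw [eval_eq', eval_eq', Finset.mul_sum]
  refine Finset.sum_congr rfl fun m hm => ?_
  have h : Finsupp.weight (fun _ => 1) m = d := hQ (mem_support_iff.1 hm)
  rw [← Finsupp.degree_eq_weight_one, Finsupp.degree_eq_sum] at h
  simp only [Pi.neg_apply, fun i => neg_pow (y i) (m i), Finset.prod_mul_distrib,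
    Finset.prod_pow_eq_pow_sum, h]
  ring

/-- A polynomial in the Casimir operator is the pullback by `-1` on polynomials of degree at most
`n`. -/
theorem exists_aeval_polyCasimir_eq (n : ℕ) : ∃ s : Polynomial ℂ,
    ∀ Q : MvPolynomial (Fin 3) ℂ, Q.totalDegree ≤ n → ∀ y : Fin 3 → ℂ,
      eval y (Polynomial.aeval polyCasimir s Q) = eval (-y) Q := by
  let s : Polynomial ℂ := Lagrange.interpolate (Finset.range (n + 1))
    (fun l : ℕ => (-2 * (l * (l + 1)) : ℂ)) fun l => (-1) ^ l
  have hinj : Set.InjOn (fun l : ℕ => (-2 * (l * (l + 1)) : ℂ)) (Finset.range (n + 1)) := by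
    intro l _ m _ h
    have h3 : (l * (l + 1) : ℂ) = m * (m + 1) := by
      have : (-2 * (l * (l + 1)) : ℂ) = -2 * (m * (m + 1)) := h
      linear_combination -this / 2
    have h4 : l * (l + 1) = m * (m + 1) := by exact_mod_cast h3
    rcases lt_trichotomy l m with h5 | h5 | h5
    · nlinarith
    · exact h5
    · nlinarith
  have hs : ∀ l ≤ n, s.eval (-2 * (l * (l + 1)) : ℂ) = (-1) ^ l := fun l hl =>
    Lagrange.eval_interpolate_at_node _ hinj (Finset.mem_range.2 (Nat.lt_succ_of_le hl))
  refine ⟨s, fun Q hQ y => ?_⟩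
  have hd : ∀ d ≤ n, ∀ P : MvPolynomial (Fin 3) ℂ, P.IsHomogeneous d →
      Polynomial.aeval polyCasimir s P = ((-1) ^ d : ℂ) • P := fun d hd P hP => by
    -- Only the `l` of the same parity as `d` occur, and for them the interpolated value `(-1) ^ l`
    -- equals `(-1) ^ d`.
    have h := aeval_polyCasimir_eq_zero d hP (s := s - Polynomial.C ((-1) ^ d)) fun l hl he => by
      rw [Polynomial.eval_sub, Polynomial.eval_C, hs l (hl.trans hd), sub_eq_zero]
      have := Nat.even_add.1 he
      rcases Nat.even_or_odd l with h | h
      · rw [h.neg_one_pow, (this.2 h).neg_one_pow]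
      · rw [h.neg_one_pow, (Nat.not_even_iff_odd.1 fun h' =>
          Nat.not_even_iff_odd.2 h (this.1 h')).neg_one_pow]
    rwa [map_sub, Polynomial.aeval_C, LinearMap.sub_apply, Module.algebraMap_end_apply,
      sub_eq_zero] at h
  rw [← sum_homogeneousComponent Q, map_sum, map_sum, map_sum]
  refine Finset.sum_congr rfl fun d hd' => ?_
  have hh := homogeneousComponent_isHomogeneous d Q
  rw [hd d (by have := Finset.mem_range.1 hd'; omega) _ hh, smul_eval]
  rw [eval_neg_of_isHomogeneous hh]

theorem hasDerivAt_eval {γ γ' : Fin 3 → ℝ → ℂ} {t : ℝ} (hγ : ∀ i, HasDerivAt (γ i) (γ' i t) t)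
    (Q : MvPolynomial (Fin 3) ℂ) : HasDerivAt (fun s => eval (fun i => γ i s) Q)
      (∑ i, γ' i t * eval (fun i => γ i t) (pderiv i Q)) t := by
  induction Q using MvPolynomial.induction_on with
  | C a => simpa using hasDerivAt_const t a
  | add P Q hP hQ =>
    simp only [map_add, mul_add, Finset.sum_add_distrib]
    exact hP.add hQ
  | mul_X P i hP =>
    simp only [map_mul, eval_X, pderiv_mul, map_add, mul_add, Finset.sum_add_distrib]
    refine (hP.mul (hγ i)).congr_deriv ?_
    simp only [Finset.sum_mul, pderiv_X, mul_assoc]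
    congr 1
    simp [Pi.single_apply, apply_ite, mul_comm]

/-- Integrals of powers of affine functions are polynomials. -/
theorem exists_eval_eq_integral_pow {G : Type*} [TopologicalSpace G] [CompactSpace G]
    [MeasurableSpace G] [BorelSpace G] [SecondCountableTopology G] (μ : Measure G) [IsFiniteMeasure μ] {b : G → ℂ}
    (hb : Continuous b) {l : Fin 3 → G → ℂ} (hl : ∀ i, Continuous (l i)) (n : ℕ) :
    ∀ {F : G → ℂ} (_ : Continuous F), ∃ Q : MvPolynomial (Fin 3) ℂ, Q.totalDegree ≤ n ∧
      ∀ y : Fin 3 → ℂ, eval y Q = ∫ w, (b w + ∑ i, y i * l i w) ^ n * F w ∂μ := by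
  induction n with
  | zero => exact fun {F} hF => ⟨C (∫ w, F w ∂μ), by simp, by simp⟩
  | succ n ih =>
    intro F hF
    -- One affine factor is expanded and its coefficients `b`, `l i` are absorbed into the weight,
    -- which is why the induction runs over all continuous `F`.
    obtain ⟨Q, hQ, hQ'⟩ := ih (hb.mul hF)
    choose P hP hP' using fun i => ih ((hl i).mul hF)
    refine ⟨Q + ∑ i, X i * P i, ?_, fun y => ?_⟩
    · refine (totalDegree_add _ _).trans (max_le (hQ.trans n.le_succ)
        ((totalDegree_finsetSum_le fun i _ => (totalDegree_mul _ _).trans ?_)))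
      rw [totalDegree_X, add_comm]
      exact Nat.succ_le_succ (hP i)
    · have hi : ∀ {H : G → ℂ}, Continuous H →
          Integrable (fun w => (b w + ∑ i, y i * l i w) ^ n * H w) μ := fun hH =>
        integrable_of_continuous_of_compactSpace (by fun_prop)
      simp only [map_add, map_sum, map_mul, eval_X, hQ', hP', ← integral_const_mul]
      rw [← integral_finsetSum _ fun i _ => (hi ((hl i).mul hF)).const_mul (y i),
        ← integral_add (hi (hb.mul hF))
          (integrable_finsetSum _ fun i _ => (hi ((hl i).mul hF)).const_mul (y i))]
      refine integral_congr_ae (Filter.Eventually.of_forall fun w => ?_)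
      simp only [Pi.mul_apply, Fin.sum_univ_three]
      ring

end Polynomials


/-! ### Quaternionic coordinates on a definite complex plane -/

variable {p q : ℕ}

/-- The quaternion with given components. -/
def quat (a b c d : ℝ) : ℍ := ⟨a, b, c, d⟩

@[simp] theorem re_quat (a b c d : ℝ) : (quat a b c d).re = a := rfl
@[simp] theorem imI_quat (a b c d : ℝ) : (quat a b c d).imI = b := rfl
@[simp] theorem imJ_quat (a b c d : ℝ) : (quat a b c d).imJ = c := rfl
@[simp] theorem imK_quat (a b c d : ℝ) : (quat a b c d).imK = d := rfl

theorem inner_quaternion (a b : ℍ) :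
    inner ℝ a b = a.re * b.re + a.imI * b.imI + a.imJ * b.imJ + a.imK * b.imK := by
  rw [Quaternion.inner_def]
  simp

/-- Two orthogonal vectors with the same norm `±1`. -/
structure Frame (p q : ℕ) where
  /-- The common value of the form. -/
  sgn : ℝ
  /-- The first vector. -/
  fst : Vec p q
  /-- The second vector. -/
  snd : Vec p q
  sgn_mul_sgn : sgn * sgn = 1
  herm_fst_fst : herm fst fst = sgn
  herm_snd_snd : herm snd snd = sgn
  herm_fst_snd : herm fst snd = 0

namespace Frame

variable (e : Frame p q)

theorem herm_snd_fst : herm e.snd e.fst = 0 := by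
  rw [← conj_herm, e.herm_fst_snd, map_zero]

/-- The embedding of the quaternions as the complex span of a frame. -/
def inj : ℍ →ₗ[ℝ] Vec p q where
  toFun h := (⟨h.re, h.imI⟩ : ℂ) • e.fst + (⟨h.imJ, -h.imK⟩ : ℂ) • e.snd
  map_add' a b := by
    have h1 : (⟨(a + b).re, (a + b).imI⟩ : ℂ) = ⟨a.re, a.imI⟩ + ⟨b.re, b.imI⟩ :=
      Complex.ext (by simp) (by simp)
    have h2 : (⟨(a + b).imJ, -(a + b).imK⟩ : ℂ) = ⟨a.imJ, -a.imK⟩ + ⟨b.imJ, -b.imK⟩ :=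
      Complex.ext (by simp) (by simp; ring)
    rw [h1, h2]
    module
  map_smul' c a := by
    have h1 : (⟨(c • a).re, (c • a).imI⟩ : ℂ) = (c : ℂ) * ⟨a.re, a.imI⟩ :=
      Complex.ext (by simp) (by simp)
    have h2 : (⟨(c • a).imJ, -(c • a).imK⟩ : ℂ) = (c : ℂ) * ⟨a.imJ, -a.imK⟩ :=
      Complex.ext (by simp) (by simp)
    rw [h1, h2, RingHom.id_apply, ← Complex.coe_smul]
    module

theorem inj_apply (h : ℍ) :
    e.inj h = (⟨h.re, h.imI⟩ : ℂ) • e.fst + (⟨h.imJ, -h.imK⟩ : ℂ) • e.snd := rfl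

/-- The quaternionic coordinate of a vector with respect to a frame. -/
def coord : Vec p q →ₗ[ℝ] ℍ where
  toFun x := quat (e.sgn * (herm x e.fst).re) (e.sgn * (herm x e.fst).im)
    (e.sgn * (herm x e.snd).re) (-(e.sgn * (herm x e.snd).im))
  map_add' x y := by
    rw [herm_add_left, herm_add_left]
    ext <;> simp <;> ring
  map_smul' c x := by
    rw [herm_rsmul_left, herm_rsmul_left]
    ext <;> simp <;> ring

theorem coord_apply (x : Vec p q) : e.coord x = quat (e.sgn * (herm x e.fst).re)
    (e.sgn * (herm x e.fst).im) (e.sgn * (herm x e.snd).re) (-(e.sgn * (herm x e.snd).im)) := rfl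

theorem coord_inj (h : ℍ) : e.coord (e.inj h) = h := by
  have h0 := e.sgn_mul_sgn
  rw [coord_apply, inj_apply, herm_add_left, herm_add_left, herm_smul_left, herm_smul_left,
    herm_smul_left, herm_smul_left, e.herm_fst_fst, e.herm_snd_snd, e.herm_fst_snd, e.herm_snd_fst]
  ext <;> simp
  · linear_combination h.re * h0
  · linear_combination h.imI * h0
  · linear_combination h.imJ * h0
  · linear_combination h.imK * h0

/-- Right multiplication by `i` in the quaternionic coordinate. -/
theorem inj_mul_i (h : ℍ) : e.inj (h * quat 0 1 0 0) = Complex.I • e.inj h := by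
  rw [inj_apply, inj_apply, smul_add, smul_smul, smul_smul]
  congr 2 <;> apply Complex.ext <;> simp

/-- The minus sign at the `k`-component of the coordinates is there for this rule: complex scalars
act from the right, which leaves the left multiplications free to be complex-linear. -/
theorem coord_smul_I (x : Vec p q) : e.coord (Complex.I • x) = e.coord x * quat 0 1 0 0 := by
  rw [coord_apply, coord_apply, herm_smul_left, herm_smul_left]
  ext <;> simp

theorem re_herm_inj (x : Vec p q) (h : ℍ) :
    (herm x (e.inj h)).re = e.sgn * inner ℝ (e.coord x) h := by
  have h0 := e.sgn_mul_sgn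
  rw [inj_apply, herm_add_right, herm_smul_right, herm_smul_right, inner_quaternion, coord_apply]
  simp
  linear_combination -((herm x e.fst).re * h.re + (herm x e.fst).im * h.imI +
    (herm x e.snd).re * h.imJ - (herm x e.snd).im * h.imK) * h0

theorem re_herm_inj_left (x : Vec p q) (h : ℍ) :
    (herm (e.inj h) x).re = e.sgn * inner ℝ (e.coord x) h := by
  rw [← conj_herm, Complex.conj_re, re_herm_inj]

/-- The vector with quaternionic coordinate `h` and the same orthogonal component as `x`. -/
def move (x : Vec p q) (h : ℍ) : Vec p q := x + e.inj (h - e.coord x)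

theorem coord_move (x : Vec p q) (h : ℍ) : e.coord (e.move x h) = h := by
  rw [move, map_add, coord_inj]
  abel

theorem move_move (x : Vec p q) (h h' : ℍ) : e.move (e.move x h) h' = e.move x h' := by
  rw [move, coord_move, move, move, add_assoc, ← map_add]
  congr 2
  abel

theorem move_coord (x : Vec p q) : e.move x (e.coord x) = x := by
  rw [move, sub_self, map_zero, add_zero]

/-- The plane and its orthogonal complement contribute separately to the form, and on the plane the
form is `sgn` times the inner product of ℍ. -/
theorem re_herm_move (x y : Vec p q) (h h' : ℍ) : (herm (e.move x h) (e.move y h')).re =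
    (herm x y).re + e.sgn * (inner ℝ h h' - inner ℝ (e.coord x) (e.coord y)) := by
  rw [move, move, herm_add_left, herm_add_right, herm_add_right, Complex.add_re, Complex.add_re,
    Complex.add_re, re_herm_inj, re_herm_inj_left, re_herm_inj_left, coord_inj]
  simp only [inner_sub_left, inner_sub_right]
  rw [real_inner_comm (e.coord y) (e.coord x), real_inner_comm h' h,
    real_inner_comm h' (e.coord x)]
  ring

theorem re_herm_self_eq_zero_iff (x : Vec p q) : (herm x x).re = 0 ↔ herm x x = 0 := by
  rw [herm_self, Complex.ofReal_re, Complex.ofReal_eq_zero]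

theorem move_mem_cone {x : Vec p q} (hx : x ∈ cone p q) {h : ℍ} (hh : ‖h‖ = ‖e.coord x‖) :
    e.move x h ∈ cone p q := by
  refine ⟨fun h0 => hx.1 ?_, ?_⟩
  · have h1 := e.coord_move x h
    rw [h0, map_zero] at h1
    rw [← h1, norm_zero, eq_comm, norm_eq_zero] at hh
    rwa [← h1, ← hh, e.move_coord] at h0
  · rw [← re_herm_self_eq_zero_iff, re_herm_move, real_inner_self_eq_norm_sq,
      real_inner_self_eq_norm_sq, hh, hx.2]
    simp

theorem norm_coord_move_eq {x : Vec p q} (hx : x ∈ cone p q) {h : ℍ} (hh : e.move x h ∈ cone p q) :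
    ‖h‖ = ‖e.coord x‖ := by
  have h1 := e.re_herm_move x x h h
  rw [hh.2, hx.2, real_inner_self_eq_norm_sq, real_inner_self_eq_norm_sq, Complex.zero_re,
    zero_add, eq_comm, mul_eq_zero, sub_eq_zero] at h1
  have h2 : e.sgn ≠ 0 := fun h0 => by simpa [h0] using e.sgn_mul_sgn
  exact (sq_eq_sq₀ (norm_nonneg _) (norm_nonneg _)).1 (h1.resolve_left h2)

/-- The action of an isometry of the quaternions on the quaternionic coordinate. -/
def block (A : ℍ ≃ₗᵢ[ℝ] ℍ) : orthogonalGroup p q :=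
  ⟨{ toFun := fun x => e.move x (A (e.coord x))
     invFun := fun x => e.move x (A.symm (e.coord x))
     map_add' := fun x y => by simp only [move, map_add, map_sub]; abel
     map_smul' := fun c x => by
      simp only [move, map_smul, map_sub, RingHom.id_apply, smul_add, smul_sub]
     left_inv := fun x => by
      simp only [coord_move, move_move, A.symm_apply_apply, move_coord]
     right_inv := fun x => by
      simp only [coord_move, move_move, A.apply_symm_apply, move_coord] },
    fun x y => (e.re_herm_move _ _ _ _).trans (by rw [A.inner_map_map, sub_self, mul_zero, add_zero])⟩

theorem block_apply (A : ℍ ≃ₗᵢ[ℝ] ℍ) (x : Vec p q) :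
    (e.block A).1 x = e.move x (A (e.coord x)) := rfl

theorem block_mul (A B : ℍ ≃ₗᵢ[ℝ] ℍ) : e.block (A * B) = e.block A * e.block B :=
  Subtype.ext (LinearEquiv.ext fun x => by
    change e.move x _ = e.move (e.move x _) _
    rw [move_move]
    exact congrArg (fun h => e.move x (A h)) (e.coord_move x _).symm)

end Frame

/-- Left multiplication by a unit quaternion. -/
def leftMul (u : Metric.sphere (0 : ℍ) 1) : ℍ ≃ₗᵢ[ℝ] ℍ where
  toFun h := u * h
  invFun h := (u⁻¹ : Metric.sphere (0 : ℍ) 1) * h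
  map_add' := mul_add _
  map_smul' c h := mul_smul_comm c _ h
  left_inv h := by
    change ((u⁻¹ : Metric.sphere (0 : ℍ) 1) : ℍ) * (u * h) = h
    rw [← mul_assoc, ← Metric.unitSphere.coe_mul, inv_mul_cancel, Metric.unitSphere.coe_one, one_mul]
  right_inv h := by
    change (u : ℍ) * ((u⁻¹ : Metric.sphere (0 : ℍ) 1) * h) = h
    rw [← mul_assoc, ← Metric.unitSphere.coe_mul, mul_inv_cancel, Metric.unitSphere.coe_one, one_mul]
  norm_map' h := by
    change ‖(u : ℍ) * h‖ = _
    rw [norm_mul, norm_eq_of_mem_sphere, one_mul]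

/-- Quaternionic conjugation. -/
def quatConj : ℍ ≃ₗᵢ[ℝ] ℍ where
  toFun h := star h
  invFun h := star h
  map_add' := star_add
  map_smul' c h := by ext <;> simp
  left_inv := star_star
  right_inv := star_star
  norm_map' := Quaternion.norm_star

namespace Frame

variable (e : Frame p q)

/-- Associativity of ℍ: left multiplication commutes with right multiplication by `i`. -/
theorem commI_block_leftMul (u : Metric.sphere (0 : ℍ) 1) : CommI (e.block (leftMul u)) :=
  fun x => by
    rw [block_apply, block_apply, move, move, coord_smul_I, smul_add, ← inj_mul_i, sub_mul]
    congr 3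
    exact (mul_assoc _ _ _).symm

theorem continuous_toCLM_block :
    Continuous fun u : Metric.sphere (0 : ℍ) 1 => toCLM (e.block (leftMul u⁻¹)) := by
  have : (fun u : Metric.sphere (0 : ℍ) 1 => toCLM (e.block (leftMul u⁻¹))) = fun u =>
      ContinuousLinearMap.id ℝ (Vec p q) + (LinearMap.toContinuousLinearMap e.inj) ∘L
        ((ContinuousLinearMap.mul ℝ ℍ ((u⁻¹ : Metric.sphere (0 : ℍ) 1) : ℍ)) ∘L
          (LinearMap.toContinuousLinearMap e.coord) - LinearMap.toContinuousLinearMap e.coord) := by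
    funext u
    refine ContinuousLinearMap.ext fun x => ?_
    rfl
  rw [this]
  have h : Continuous fun u : Metric.sphere (0 : ℍ) 1 =>
      ContinuousLinearMap.mul ℝ ℍ ((u⁻¹ : Metric.sphere (0 : ℍ) 1) : ℍ) :=
    (ContinuousLinearMap.mul ℝ ℍ).continuous.comp (continuous_subtype_val.comp continuous_inv)
  exact continuous_const.add (continuous_const.clm_comp
    ((h.clm_comp continuous_const).sub continuous_const))

/-- The reflection in the first vector of a frame. -/
theorem block_neg_quatConj_apply (x : Vec p q) :
    (e.block (leftMul (-1) * quatConj)).1 x = x - (2 * e.sgn * (herm x e.fst).re) • e.fst := by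
  -- The map `h ↦ -conj h` only changes the sign of the real part, which is `sgn` times the real
  -- part of `herm x fst`.
  have h1 : (leftMul (-1) * quatConj) (e.coord x) - e.coord x =
      quat (-(2 * e.sgn * (herm x e.fst).re)) 0 0 0 := by
    change ((-1 : Metric.sphere (0 : ℍ) 1) : ℍ) * star (e.coord x) - e.coord x = _
    change -((1 : Metric.sphere (0 : ℍ) 1) : ℍ) * star (e.coord x) - e.coord x = _
    rw [Metric.unitSphere.coe_one, coord_apply]
    ext <;> simp
    ring
  have h2 : (⟨-(2 * e.sgn * (herm x e.fst).re), 0⟩ : ℂ) =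
      ((-(2 * e.sgn * (herm x e.fst).re) : ℝ) : ℂ) := rfl
  have h3 : (⟨0, -0⟩ : ℂ) = 0 := by rw [neg_zero]; rfl
  rw [block_apply, move, h1, inj_apply]
  simp only [re_quat, imI_quat, imJ_quat, imK_quat]
  rw [h2, h3, zero_smul, add_zero, Complex.coe_smul, neg_smul, sub_eq_add_neg]

end Frame


/-! ### Rotations of the imaginary quaternions and their Casimir operator -/

variable {p q : ℕ}

/-- The imaginary units of the quaternions. -/
def imUnit : Fin 3 → ℍ := ![quat 0 1 0 0, quat 0 0 1 0, quat 0 0 0 1]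

/-- The components of the imaginary part of a quaternion. -/
def imPart (h : ℍ) : Fin 3 → ℝ := ![h.imI, h.imJ, h.imK]

theorem inner_imUnit (h : ℍ) (i : Fin 3) : inner ℝ h (imUnit i) = imPart h i := by
  rw [inner_quaternion]
  fin_cases i <;> simp [imUnit, imPart]

/-- The components of the imaginary part as complex numbers. -/
def imCoord (h : ℍ) (i : Fin 3) : ℂ := imPart h i

theorem imCoord_star (h : ℍ) : imCoord (star h) = -imCoord h := by
  funext i
  fin_cases i <;> simp [imCoord, imPart]

namespace Frame

variable (e : Frame p q)

/-- The generator of the rotations in the plane of two imaginary units. -/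
def rotGen (i j : Fin 3) : lieAlg p q :=
  (e.sgn / 2) • (unitGen (e.inj (imUnit j)) (e.inj (imUnit i)) -
    antiGen (e.inj (imUnit j)) (e.inj (imUnit i)))

/-- The complex-linear generator supplies the terms `herm x ·`, the antilinear one their conjugates.
Together they form twice the real part of the form, which reads off the imaginary components of the
coordinate. -/
theorem rotGen_apply (i j : Fin 3) (x : Vec p q) : (e.rotGen i j).1 x =
    e.inj (imPart (e.coord x) i • imUnit j - imPart (e.coord x) j • imUnit i) := by
  change (e.sgn / 2) • ((unitGen (e.inj (imUnit j)) (e.inj (imUnit i))).1 x -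
    (antiGen (e.inj (imUnit j)) (e.inj (imUnit i))).1 x) = _
  have h : ∀ (x y w : Vec p q), (e.sgn / 2) • (herm x y • w + herm y x • w) =
      (e.sgn * (herm x y).re) • w := fun x y w => by
    rw [← add_smul, ← conj_herm x y, Complex.add_conj, ← Complex.coe_smul, smul_smul,
      ← Complex.coe_smul (e.sgn * _)]
    congr 1
    push_cast
    ring
  have h2 : ∀ i, e.sgn * (herm x (e.inj (imUnit i))).re = imPart (e.coord x) i := fun i => by
    rw [re_herm_inj, ← mul_assoc, e.sgn_mul_sgn, one_mul, inner_imUnit]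
  have h3 : ∀ a b c d : Vec p q, a - b - (c - d) = (a + d) - (b + c) := fun a b c d => by abel
  rw [unitGen_apply, antiGen_apply, h3, smul_sub, h, h, h2, h2, map_sub, map_smul, map_smul]

/-- `f` is represented by the polynomial `Q` along the sphere of points with the same orthogonal
component and the same real part of the coordinate as `x`. -/
def Rep (f : SmoothFun p q) (x : Vec p q) (Q : MvPolynomial (Fin 3) ℂ) : Prop :=
  ∀ h : ℍ, ‖h‖ = ‖e.coord x‖ → h.re = (e.coord x).re →
    pullback f (e.move x h) = MvPolynomial.eval (imCoord h) Q

variable {e} {f f' : SmoothFun p q} {x : Vec p q} {Q Q' : MvPolynomial (Fin 3) ℂ}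

theorem Rep.add (h : e.Rep f x Q) (h' : e.Rep f' x Q') : e.Rep (f + f') x (Q + Q') :=
  fun k hk hk' => by
    rw [pullback_add, map_add, Pi.add_apply, h k hk hk', h' k hk hk']

theorem Rep.smul (h : e.Rep f x Q) (c : ℂ) : e.Rep (c • f) x (c • Q) := fun k hk hk' => by
  rw [pullback_smul, MvPolynomial.smul_eval, Pi.smul_apply, h k hk hk', smul_eq_mul]

theorem Rep.zero : e.Rep (0 : SmoothFun p q) x 0 := fun k _ _ => by
  have := congrFun (pullback_smul 0 (0 : SmoothFun p q)) (e.move x k)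
  rw [zero_smul] at this
  rw [this, map_zero, Pi.smul_apply, zero_smul]

theorem Rep.sum {ι : Type*} {s : Finset ι} {f : ι → SmoothFun p q}
    {Q : ι → MvPolynomial (Fin 3) ℂ} (h : ∀ i ∈ s, e.Rep (f i) x (Q i)) :
    e.Rep (∑ i ∈ s, f i) x (∑ i ∈ s, Q i) := by
  classical
  induction s using Finset.induction_on with
  | empty => exact Rep.zero
  | insert i s hi ih =>
    rw [Finset.sum_insert hi, Finset.sum_insert hi]
    exact (h i (Finset.mem_insert_self i s)).add
      (ih fun j hj => h j (Finset.mem_insert_of_mem hj))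

theorem eq_of_hasDerivAt_zero {E : Type*} [NormedAddCommGroup E] [NormedSpace ℝ E] {γ : ℝ → E}
    (h : ∀ t, HasDerivAt γ 0 t) (t : ℝ) : γ t = γ 0 :=
  is_const_of_deriv_eq_zero (fun t => (h t).differentiableAt) (fun t => (h t).deriv) t 0

/-- The flow of the rotation fixes the orthogonal component and keeps the norm and the real part of
the coordinate. It thus stays where `Q` represents `f`, and differentiating `Q` along it gives the
polynomial rotation. -/
theorem Rep.lieDeriv (hx : x ∈ cone p q) (hf : e.Rep f x Q) (i j : Fin 3) :
    e.Rep (lieDeriv (e.rotGen i j) f) x (polyRot i j Q) := by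
  intro h hh hh'
  let T := e.rotGen i j
  let z : cone p q := ⟨e.move x h, e.move_mem_cone hx hh⟩
  let γ : ℝ → Vec p q := fun t => (oneParam T t).1 z
  have hγ : ∀ t, γ t ∈ cone p q := fun t => apply_mem_cone _ z.2
  have hγ0 : γ 0 = z := by
    simp only [γ, oneParam_zero]
    rfl
  have hd : ∀ t, HasDerivAt γ (T.1 (γ t)) t := fun t => hasDerivAt_oneParam T z t
  have hcomp : ∀ {E : Type} [NormedAddCommGroup E] [NormedSpace ℝ E] (L : Vec p q →L[ℝ] E) (t : ℝ),
      HasDerivAt (fun t => L (γ t)) (L (T.1 (γ t))) t := fun L t =>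
    L.hasFDerivAt.comp_hasDerivAt t (hd t)
  have hT : ∀ y, e.coord (T.1 y) = imPart (e.coord y) i • imUnit j - imPart (e.coord y) j • imUnit i :=
    fun y => by rw [rotGen_apply, coord_inj]
  -- the orthogonal component is constant along the curve
  have h1 : ∀ t, e.move (γ t) 0 = e.move z 0 := fun t => by
    let P : Vec p q →L[ℝ] Vec p q := ContinuousLinearMap.id ℝ _ -
      LinearMap.toContinuousLinearMap (e.inj ∘ₗ e.coord)
    have hP : ∀ y, P y = e.move y 0 := fun y => by
      rw [move, zero_sub, map_neg, ← sub_eq_add_neg]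
      rfl
    rw [← hP, ← hP, ← hγ0]
    refine eq_of_hasDerivAt_zero (γ := fun t => P (γ t)) (fun t => ?_) t
    convert hcomp P t using 1
    rw [hP, move, zero_sub, rotGen_apply, coord_inj, map_neg, add_neg_cancel]
  have h2 : ∀ t, γ t = e.move x (e.coord (γ t)) := fun t => by
    have := congrArg (fun y => e.move y (e.coord (γ t))) (h1 t)
    simp only [move_move, z, move_coord] at this
    exact this
  have h3 : ∀ t, ‖e.coord (γ t)‖ = ‖e.coord x‖ := fun t =>
    e.norm_coord_move_eq hx (by rw [← h2]; exact hγ t)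
  let c : Fin 3 → Vec p q →L[ℝ] ℝ := fun k =>
    (innerSL ℝ (imUnit k)) ∘L (LinearMap.toContinuousLinearMap e.coord)
  have hc : ∀ k y, c k y = imPart (e.coord y) k := fun k y => by
    rw [← inner_imUnit, real_inner_comm]
    rfl
  have h4 : ∀ t, (e.coord (γ t)).re = (e.coord x).re := fun t => by
    let r : Vec p q →L[ℝ] ℝ := (innerSL ℝ (1 : ℍ)) ∘L (LinearMap.toContinuousLinearMap e.coord)
    have hr : ∀ y, r y = (e.coord y).re := fun y => by
      change inner ℝ (1 : ℍ) (e.coord y) = _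
      rw [inner_quaternion]
      simp
    have h5 : (e.coord (z : Vec p q)).re = (e.coord x).re := by
      rw [← hh']
      exact congrArg _ (e.coord_move x h)
    rw [← h5, ← hr, ← hr, ← hγ0]
    refine eq_of_hasDerivAt_zero (γ := fun t => r (γ t)) (fun t => ?_) t
    convert hcomp r t using 1
    rw [hr, hT]
    fin_cases i <;> fin_cases j <;> simp [imUnit]
  have h6 : HasDerivAt (fun t => pullback f (γ t)) (LightCone.lieDeriv T f z) 0 := by
    have := hasDerivAt_lieDeriv T f z hγ hγ0 (by simpa only [hγ0] using hd 0)
    refine this.congr_of_eventuallyEq (Filter.Eventually.of_forall fun t => ?_)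
    exact pullback_coe f ⟨γ t, hγ t⟩
  have h7 : HasDerivAt (fun t => MvPolynomial.eval (fun k => ((c k (γ t) : ℝ) : ℂ)) Q) _ 0 :=
    hasDerivAt_eval (γ := fun k t => ((c k (γ t) : ℝ) : ℂ))
      (γ' := fun k t => ((c k (T.1 (γ t)) : ℝ) : ℂ)) (fun k => (hcomp (c k) 0).ofReal_comp) Q
  have h8 : (fun t => pullback f (γ t)) =
      fun t => MvPolynomial.eval (fun k => ((c k (γ t) : ℝ) : ℂ)) Q := funext fun t => by
    rw [h2 t, hf _ (h3 t) (h4 t), ← h2 t]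
    simp only [hc]
    rfl
  rw [h8] at h6
  have h9 := h6.unique h7
  have h10 : pullback (LightCone.lieDeriv T f) (e.move x h) = LightCone.lieDeriv T f z :=
    pullback_coe (LightCone.lieDeriv T f) z
  have h11 : e.coord (γ 0) = h := by rw [hγ0]; exact e.coord_move x h
  have h12 : (fun k => ((imPart h k : ℝ) : ℂ)) = imCoord h := rfl
  rw [h10, h9]
  simp only [hc, hT, h11, h12, polyRot_apply, map_sub, map_mul, MvPolynomial.eval_X]
  fin_cases i <;> fin_cases j <;>
    simp [Fin.sum_univ_three, imPart, imUnit, imCoord] <;> ring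

variable (e) in
/-- The sum of the squares of the generators of the rotations of the imaginary quaternions. -/
def casimir : Module.End ℂ (SmoothFun p q) :=
  ∑ i, ∑ j, LightCone.lieDeriv (e.rotGen i j) ∘ₗ LightCone.lieDeriv (e.rotGen i j)

theorem Rep.casimir (hx : x ∈ cone p q) (hf : e.Rep f x Q) :
    e.Rep (e.casimir f) x (polyCasimir Q) := by
  rw [polyCasimir_apply, Frame.casimir]
  simp only [LinearMap.coe_sum, Finset.sum_apply, LinearMap.comp_apply]
  exact Rep.sum fun i _ => Rep.sum fun j _ => (hf.lieDeriv hx i j).lieDeriv hx i j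

theorem Rep.aeval_casimir (hx : x ∈ cone p q) (hf : e.Rep f x Q) (s : Polynomial ℂ) :
    e.Rep (Polynomial.aeval e.casimir s f) x (Polynomial.aeval polyCasimir s Q) := by
  induction s using Polynomial.induction_on' with
  | add s t hs ht =>
    rw [map_add, map_add]
    exact hs.add ht
  | monomial n a =>
    rw [Polynomial.aeval_monomial, Polynomial.aeval_monomial]
    simp only [Module.End.mul_apply, Module.algebraMap_end_apply]
    refine Rep.smul ?_ a
    induction n with
    | zero => exact hf
    | succ n ih =>
      rw [pow_succ', pow_succ', Module.End.mul_apply, Module.End.mul_apply]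
      exact ih.casimir hx

theorem aeval_casimir_mem {M : Submodule ℂ (SmoothFun p q)}
    (hM : ∀ i j, ∀ f ∈ M, LightCone.lieDeriv (e.rotGen i j) f ∈ M) (s : Polynomial ℂ) (hf : f ∈ M) :
    Polynomial.aeval e.casimir s f ∈ M := by
  have h : ∀ f ∈ M, e.casimir f ∈ M := fun f hf => by
    rw [Frame.casimir]
    simp only [LinearMap.coe_sum, Finset.sum_apply, LinearMap.comp_apply]
    exact M.sum_mem fun i _ => M.sum_mem fun j _ => hM _ _ _ (hM _ _ _ hf)
  exact Polynomial.aeval_apply_smul_mem_of_le_comap' hf s e.casimir h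

/-- Functions that are represented by polynomials of bounded degree: the conjugation of the
quaternionic coordinate is a polynomial in the Casimir operator. -/
theorem precomp_quatConj_mem {M : Submodule ℂ (SmoothFun p q)}
    (hM : ∀ i j, ∀ f ∈ M, LightCone.lieDeriv (e.rotGen i j) f ∈ M) (n : ℕ)
    (hf : ∀ x ∈ cone p q, ∃ Q : MvPolynomial (Fin 3) ℂ, Q.totalDegree ≤ n ∧ e.Rep f x Q)
    (hfM : f ∈ M) : precomp (e.block quatConj) f ∈ M := by
  -- The polynomial `Q` varies with the point but its degree is bounded by `n` throughout, so a
  -- single `s` serves the whole cone.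
  obtain ⟨s, hs⟩ := exists_aeval_polyCasimir_eq n
  have h : precomp (e.block quatConj) f = Polynomial.aeval e.casimir s f := by
    refine SmoothFun.ext fun x => ?_
    obtain ⟨Q, hQ, hfQ⟩ := hf x x.2
    have h1 := hfQ.aeval_casimir x.2 s (e.coord x) rfl rfl
    rw [e.move_coord, pullback_coe, hs Q hQ, ← imCoord_star,
      ← hfQ (star (e.coord x)) (Quaternion.norm_star _) (Quaternion.re_star _)] at h1
    rw [h1, precomp_apply]
    exact (pullback_coe f (act (e.block quatConj) x)).symm
  rw [h]
  exact aeval_casimir_mem hM s hfM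

end Frame


/-! ### Polynomial approximation by averages over the unit quaternions -/

variable {p q : ℕ}

/-- The group of unit quaternions. -/
abbrev UnitQuat : Type := Metric.sphere (0 : ℍ) 1

instance : MeasurableSpace UnitQuat := borel UnitQuat

instance : BorelSpace UnitQuat := ⟨rfl⟩

/-- A nonnegative function on the unit quaternions with its unique maximum at `1`. -/
def bump (u : UnitQuat) : ℝ := 1 + (u : ℍ).re

theorem continuous_bump : Continuous bump :=
  continuous_const.add (Quaternion.continuous_re.comp continuous_subtype_val)

theorem sq_add_sq_eq_one (u : UnitQuat) : (u : ℍ).re ^ 2 + (u : ℍ).imI ^ 2 + (u : ℍ).imJ ^ 2 +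
    (u : ℍ).imK ^ 2 = 1 := by
  rw [← Quaternion.normSq_def', Quaternion.normSq_eq_norm_mul_self, norm_eq_of_mem_sphere, mul_one]

theorem bump_nonneg (u : UnitQuat) : 0 ≤ bump u := by
  have h := sq_add_sq_eq_one u
  rw [bump]
  nlinarith [sq_nonneg (u : ℍ).imI, sq_nonneg (u : ℍ).imJ, sq_nonneg (u : ℍ).imK]

theorem bump_one : bump 1 = 2 := by
  rw [bump, Metric.unitSphere.coe_one, Quaternion.re_one]
  norm_num

theorem bump_lt {u : UnitQuat} (hu : u ≠ 1) : bump u < bump 1 := by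
  rw [bump_one, bump]
  by_contra! h
  have h1 := sq_add_sq_eq_one u
  have hr : (u : ℍ).re = 1 := by
    nlinarith [sq_nonneg (u : ℍ).imI, sq_nonneg (u : ℍ).imJ, sq_nonneg (u : ℍ).imK]
  rw [hr] at h1
  refine hu (Subtype.ext (Quaternion.ext _ _ (hr.trans ?_) ?_ ?_ ?_))
  · rw [Metric.unitSphere.coe_one, Quaternion.re_one]
  all_goals
    rw [Metric.unitSphere.coe_one]
    refine pow_eq_zero_iff two_ne_zero |>.1 ?_
    nlinarith [sq_nonneg (u : ℍ).imI, sq_nonneg (u : ℍ).imJ, sq_nonneg (u : ℍ).imK]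

/-- The normalisation of the powers of `bump`. -/
def bumpMass (n : ℕ) : ℝ := ∫ u, bump u ^ n ∂compactHaar UnitQuat

/-- Normalised powers of a nonnegative continuous function concentrate at its unique maximum, here
the identity. -/
theorem tendsto_integral_bump {E : Type*} [NormedAddCommGroup E] [NormedSpace ℝ E] [CompleteSpace E]
    {g : UnitQuat → E} (hg : Continuous g) :
    Filter.Tendsto (fun n => (bumpMass n)⁻¹ • ∫ u, bump u ^ n • g u ∂compactHaar UnitQuat)
      Filter.atTop (𝓝 (g 1)) := by
  have h := tendsto_setIntegral_pow_smul_of_unique_maximum_of_isCompact_of_continuousOn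
    (μ := compactHaar UnitQuat) (s := univ) isCompact_univ (x₀ := 1) continuous_bump.continuousOn
    (fun u _ hu => bump_lt hu) (fun u _ => bump_nonneg u) (by rw [bump_one]; norm_num)
    (by simp) hg.continuousOn
  simp only [setIntegral_univ] at h
  exact h

theorem continuous_bump_kernel (n : ℕ) :
    Continuous fun u => (((bumpMass n)⁻¹ * bump u ^ n : ℝ) : ℂ) :=
  Complex.continuous_ofReal.comp (continuous_const.mul (continuous_bump.pow n))

namespace Frame

variable (e : Frame p q)

/-- Averages over the unit quaternions that approximate the identity. -/
def smoothing (n : ℕ) : SmoothFun p q →ₗ[ℂ] SmoothFun p q :=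
  average (compactHaar UnitQuat) e.continuous_toCLM_block (continuous_bump_kernel n)

theorem block_leftMul_one : e.block (leftMul 1) = 1 := by
  refine Subtype.ext (LinearEquiv.ext fun x => ?_)
  rw [block_apply]
  change e.move x ((1 : UnitQuat) * e.coord x) = x
  rw [Metric.unitSphere.coe_one, one_mul, move_coord]

theorem mem_closure_smoothing (f : SmoothFun p q) :
    f ∈ closure (range fun n => e.smoothing n f) := by
  refine mem_closure_iff_jetBound.2 fun k K ε hK hKU hε => ?_
  have := isCompact_iff_compactSpace.1 hK
  have h := tendsto_integral_bump (continuous_jet_precomp k hKU e.continuous_toCLM_block f)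
  obtain ⟨n, hn⟩ := (Metric.tendsto_atTop.1 h ε hε)
  refine ⟨_, ⟨n, rfl⟩, jetBound_of_norm_jet_sub_lt hKU ?_⟩
  have h2 := hn n le_rfl
  rw [inv_one, block_leftMul_one, precomp_one, dist_eq_norm, ← integral_smul] at h2
  change ‖jet k hKU (average _ _ _ f) - _‖ < ε
  rw [jet_average]
  simpa only [Complex.coe_smul, mul_smul] using h2

theorem act_block_leftMul (u : UnitQuat) (x : cone p q) :
    (act (e.block (leftMul u)) x : Vec p q) = e.move x (u * e.coord x) := rfl

/-- After a translation of the variable the average at coordinate `h` is the integral of `bump (v *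
w) ^ n` against a function of `w` that does not depend on `h`, where `v` is `h` divided by its norm.
Since `bump (v * w)` is affine in `h`, this is a polynomial of degree at most `n`. -/
theorem exists_rep_smoothing (n : ℕ) (f : SmoothFun p q) {x : Vec p q} (hx : x ∈ cone p q) :
    ∃ Q : MvPolynomial (Fin 3) ℂ, Q.totalDegree ≤ n ∧ e.Rep (e.smoothing n f) x Q := by
  -- At coordinate zero the sphere is a single point and a constant polynomial suffices.
  by_cases h0 : e.coord x = 0
  · refine ⟨MvPolynomial.C (pullback (e.smoothing n f) x), by simp, fun h hh _ => ?_⟩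
    rw [h0, norm_zero, norm_eq_zero] at hh
    rw [MvPolynomial.eval_C, hh, ← h0, e.move_coord]
  let ρ : ℝ := ‖e.coord x‖
  have hρ : ρ ≠ 0 := norm_ne_zero_iff.2 h0
  have hρn : ‖(ρ : ℍ)‖ = ‖e.coord x‖ := by
    rw [Quaternion.norm_coe, Real.norm_of_nonneg (norm_nonneg _)]
  -- The base point of the orbit has the positive real coordinate `ρ`, so that every other point of
  -- the sphere is reached by the left multiplication `v = h / ρ`.
  let x₀ : cone p q := ⟨e.move x ρ, e.move_mem_cone hx hρn⟩
  let F : UnitQuat → ℂ := fun w => f (act (e.block (leftMul w⁻¹)) x₀)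
  have hF : Continuous F := by
    have h := (continuousOn_iteratedFDeriv_precomp e.continuous_toCLM_block f 0).comp_continuous
      (f := fun g => (g, (x₀ : Vec p q))) (by fun_prop)
      fun g => ⟨mem_univ _, cone_subset_polarDomain x₀.2⟩
    refine ((continuousMultilinearCurryFin0 ℝ (Vec p q) ℂ).continuous.comp h).congr fun w => ?_
    exact (pullback_coe _ x₀).trans (precomp_apply _ f x₀)
  -- `b` and `l` are the coefficients of `1 + Re (v w)` with `v = h / ρ`; the real part of `h` is
  -- fixed and goes into `b`.
  let b : UnitQuat → ℂ := fun w => ((1 + (e.coord x).re * (w : ℍ).re / ρ : ℝ) : ℂ)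
  let l : Fin 3 → UnitQuat → ℂ := fun i w => ((-imPart w i / ρ : ℝ) : ℂ)
  have hre : Continuous fun w : UnitQuat => (w : ℍ).re :=
    Quaternion.continuous_re.comp continuous_subtype_val
  have hb : Continuous b := by fun_prop
  have hl : ∀ i, Continuous (l i) := fun i => by
    have : Continuous fun w : UnitQuat => imPart w i := by
      fin_cases i
      · exact Quaternion.continuous_imI.comp continuous_subtype_val
      · exact Quaternion.continuous_imJ.comp continuous_subtype_val
      · exact Quaternion.continuous_imK.comp continuous_subtype_val
    fun_prop
  obtain ⟨Q, hQ, hQ'⟩ := exists_eval_eq_integral_pow (compactHaar UnitQuat) hb hl n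
    (F := fun w => ((bumpMass n)⁻¹ : ℝ) * F w) (continuous_const.mul hF)
  refine ⟨Q, hQ, fun h hh hh' => ?_⟩
  let v : UnitQuat := ⟨(ρ⁻¹ : ℝ) • h, by
    rw [mem_sphere_zero_iff_norm, norm_smul, hh, Real.norm_of_nonneg (inv_nonneg.2 (norm_nonneg _))]
    exact inv_mul_cancel₀ hρ⟩
  have hv : (v : ℍ) * ρ = h := by
    change (ρ⁻¹ • h) * (ρ : ℍ) = h
    rw [Quaternion.mul_coe_eq_smul, smul_smul, mul_inv_cancel₀ hρ, one_smul]
  let z : cone p q := ⟨e.move x h, e.move_mem_cone hx hh⟩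
  have hz : act (e.block (leftMul v)) x₀ = z := Subtype.ext (by
    rw [act_block_leftMul]
    change e.move (e.move x ρ) (v * e.coord (e.move x ρ)) = e.move x h
    rw [move_move, coord_move, hv])
  have h1 : pullback (e.smoothing n f) (e.move x h) = e.smoothing n f z :=
    pullback_coe (e.smoothing n f) z
  rw [h1, hQ', smoothing, average_apply, ← integral_mul_left_eq_self _ v]
  refine integral_congr_ae (Filter.Eventually.of_forall fun w => ?_)
  have h2 : act (e.block (leftMul (v * w)⁻¹)) z = act (e.block (leftMul w⁻¹)) x₀ := by
    rw [← hz]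
    refine Subtype.ext ?_
    rw [act_block_leftMul, act_block_leftMul, act_block_leftMul,
      e.coord_move (x₀ : Vec p q), move_move, ← mul_assoc,
      ← Metric.unitSphere.coe_mul, mul_inv_rev, inv_mul_cancel_right]
  have h3 : ((bump (v * w) : ℝ) : ℂ) = b w + ∑ i, imCoord h i * l i w := by
    have h4 : bump (v * w) = 1 + (e.coord x).re * (w : ℍ).re / ρ +
        ∑ i, imPart h i * (-imPart w i / ρ) := by
      rw [bump, Metric.unitSphere.coe_mul, Quaternion.re_mul, Fin.sum_univ_three, ← hh']
      simp [v, imPart]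
      field_simp
      ring
    rw [h4]
    simp only [b, l, imCoord]
    push_cast
    rfl
  simp only [h2, Complex.ofReal_mul, Complex.ofReal_pow, h3]
  ring

/-- A closed `U(p,q)`-invariant subspace that is invariant under the infinitesimal rotations is
invariant under the reflection in the first vector of a frame. -/
theorem precomp_reflection_mem {M : Submodule ℂ (SmoothFun p q)}
    (hM : IsClosed (M : Set (SmoothFun p q))) (hU : UInvariant M)
    (hrot : ∀ i j, ∀ f ∈ M, LightCone.lieDeriv (e.rotGen i j) f ∈ M) {f : SmoothFun p q}
    (hf : f ∈ M) : precomp (e.block (leftMul (-1) * quatConj)) f ∈ M := by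
  have h : ∀ f ∈ M, precomp (e.block quatConj) f ∈ M := fun f hf => by
    -- The polynomial argument applies to the averages of `f`; these accumulate at `f`, and
    -- composition with the conjugation is continuous.
    rw [← SetLike.mem_coe, ← hM.closure_eq]
    refine map_mem_closure (continuous_precomp _) (e.mem_closure_smoothing f) ?_
    rintro _ ⟨n, rfl⟩
    exact precomp_quatConj_mem hrot n (fun x hx => e.exists_rep_smoothing n f hx)
      (average_mem _ _ _ hM fun u => hU _ (e.commI_block_leftMul _) f hf)
  rw [block_mul, ← precomp_precomp]
  exact h _ (hU _ (e.commI_block_leftMul _) f hf)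

end Frame


/-! ### Transitivity of U(p,q) and invariance under all reflections -/

variable {p q : ℕ}

section Transitivity

/-- The complex-linear map `x ↦ x - a h(x, w) w`. -/
def transvection (w : Vec p q) (a : ℂ) (x : Vec p q) : Vec p q := x - (a * herm x w) • w

theorem herm_transvection {w : Vec p q} {a : ℂ} (h : a + conj a = a * conj a * herm w w)
    (x y : Vec p q) : herm (transvection w a x) (transvection w a y) = herm x y := by
  simp only [transvection, herm_sub_left, herm_sub_right, herm_smul_left, herm_smul_right, map_mul,
    conj_herm]
  linear_combination -(herm x w * herm w y) * h

theorem transvection_transvection {w : Vec p q} {a : ℂ} (h : a + conj a = a * conj a * herm w w)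
    (x : Vec p q) : transvection w (conj a) (transvection w a x) = x := by
  simp only [transvection, herm_sub_left, herm_smul_left]
  have : x = x - (0 : ℂ) • w := by rw [zero_smul, sub_zero]
  conv_rhs => rw [this]
  rw [sub_sub, ← add_smul]
  congr 2
  linear_combination (herm x w) * h

/-- The complex reflection along `d = v - w` with `a = 1 / herm v d` takes `v` to `v - d = w`. It is
an isometry because `v` and `w` have the same norm, which gives `herm d d = 2 Re (herm v d)`. -/
theorem exists_commI_apply_eq_of_ne {v w : Vec p q} (h : herm v v = herm w w)
    (hne : herm v w ≠ herm v v) : ∃ g : orthogonalGroup p q, CommI g ∧ g.1 v = w := by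
  let d := v - w
  let a : ℂ := (herm v d)⁻¹
  have hd : herm v d ≠ 0 := by
    rw [herm_sub_right]
    exact sub_ne_zero.2 hne.symm
  have hd' : conj (herm v d) ≠ 0 := (map_ne_zero _).2 hd
  have ha : a + conj a = a * conj a * herm d d := by
    have h1 : herm d d = herm v d + conj (herm v d) := by
      simp only [d, herm_sub_left, herm_sub_right, map_sub, conj_herm, h]
      ring
    rw [h1]
    simp only [a, map_inv₀]
    field_simp
    ring
  have ha' : conj a + conj (conj a) = conj a * conj (conj a) * herm d d := by
    rw [Complex.conj_conj]
    linear_combination ha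
  refine ⟨⟨{ toFun := transvection d a
             invFun := transvection d (conj a)
             map_add' := fun x y => by
              simp only [transvection, herm_add_left]; module
             map_smul' := fun c x => by
              simp only [transvection, ← Complex.coe_smul, herm_smul_left, RingHom.id_apply]; module
             left_inv := transvection_transvection ha
             right_inv := fun x => by
              have := transvection_transvection ha' x
              rwa [Complex.conj_conj] at this },
    fun x y => congrArg Complex.re (herm_transvection ha x y)⟩, fun x => ?_, ?_⟩
  · change transvection d a _ = _ • transvection d a x
    simp only [transvection, herm_smul_left]
    module
  · change transvection d a v = w
    rw [transvection, inv_mul_cancel₀ hd, one_smul, sub_sub_cancel]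

/-- `U(p,q)` is transitive on the vectors of given nonzero norm. -/
theorem exists_commI_apply_eq {v w : Vec p q} (h : herm v v = herm w w) (h0 : herm v v ≠ 0) :
    ∃ g : orthogonalGroup p q, CommI g ∧ g.1 v = w := by
  by_cases hne : herm v w = herm v v
  -- In the exceptional case `v` is first moved to `i w`, for which `herm v (i w) = -i herm v v`
  -- differs from `herm v v`, and the factor `i` is then removed by a scalar.
  · let ζ : Circle := ⟨Complex.I, by simp [Submonoid.unitSphere]⟩
    have hζ : (scalar p q ζ).1 w = Complex.I • w := rfl
    obtain ⟨g, hg, hgv⟩ := exists_commI_apply_eq_of_ne (v := v) (w := Complex.I • w)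
      (by rw [← hζ, (commI_scalar ζ).herm, h])
      (by
        rw [herm_smul_right, hne, Complex.conj_I]
        intro h1
        have h2 : (-Complex.I - 1) * herm v v = 0 := by linear_combination h1
        refine (mul_eq_zero.1 h2).elim (fun h3 => ?_) h0
        simpa using congrArg Complex.re h3)
    refine ⟨(scalar p q ζ)⁻¹ * g, fun x => ?_, ?_⟩
    · change (scalar p q ζ)⁻¹.1 (g.1 _) = _ • (scalar p q ζ)⁻¹.1 (g.1 _)
      rw [hg, (commI_scalar ζ).inv]
    · change (scalar p q ζ)⁻¹.1 (g.1 v) = w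
      rw [hgv, ← hζ]
      exact (scalar p q ζ).1.symm_apply_apply w
  · exact exists_commI_apply_eq_of_ne h hne

end Transitivity

section Frames

theorem herm_inl (a b : EuclideanSpace ℂ (Fin p)) :
    herm ((a, 0) : Vec p q) (b, 0) = ∑ j, a j * conj (b j) := by
  simp [herm]

theorem herm_inr (a b : EuclideanSpace ℂ (Fin q)) :
    herm ((0, a) : Vec p q) (0, b) = -∑ j, a j * conj (b j) := by
  simp [herm]

/-- The frame formed by the first two coordinates. -/
def posFrame (hp : 2 ≤ p) : Frame p q where
  sgn := 1
  fst := (EuclideanSpace.single ⟨0, by omega⟩ 1, 0)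
  snd := (EuclideanSpace.single ⟨1, by omega⟩ 1, 0)
  sgn_mul_sgn := one_mul 1
  herm_fst_fst := by rw [herm_inl]; simp
  herm_snd_snd := by rw [herm_inl]; simp
  herm_fst_snd := by rw [herm_inl]; simp

/-- The frame formed by the first two negative coordinates. -/
def negFrame (hq : 2 ≤ q) : Frame p q where
  sgn := -1
  fst := (0, EuclideanSpace.single ⟨0, by omega⟩ 1)
  snd := (0, EuclideanSpace.single ⟨1, by omega⟩ 1)
  sgn_mul_sgn := by norm_num
  herm_fst_fst := by rw [herm_inr]; simp
  herm_snd_snd := by rw [herm_inr]; simp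
  herm_fst_snd := by rw [herm_inr]; simp

theorem hermRe_symm (u v : Vec p q) : hermRe p q u v = hermRe p q v u := by
  rw [hermRe_apply, hermRe_apply, ← conj_herm, Complex.conj_re]

theorem herm_self_eq_hermRe (v : Vec p q) : herm v v = ((hermRe p q v v : ℝ) : ℂ) := by
  rw [hermRe_apply, herm_self, Complex.ofReal_re]

/-- The assumption that `p` and `q` are at least 2 enters here: a reflection vector of either sign
needs a complex plane on which the form is definite with that sign. -/
theorem exists_frame (hp : 2 ≤ p) (hq : 2 ≤ q) {v : Vec p q} (hv : hermRe p q v v ≠ 0) :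
    ∃ (e : Frame p q) (c : ℝ), hermRe p q v v = c ^ 2 * e.sgn := by
  rcases lt_or_gt_of_ne hv with h | h
  · exact ⟨negFrame hq, √(-hermRe p q v v), by
      rw [Real.sq_sqrt (by linarith)]; simp [negFrame]⟩
  · exact ⟨posFrame hp, √(hermRe p q v v), by
      rw [Real.sq_sqrt h.le]; simp [posFrame]⟩

theorem lieDeriv_rotGen_mem {M : Submodule ℂ (SmoothFun p q)}
    (hM : IsClosed (M : Set (SmoothFun p q))) (hU : UInvariant M)
    (hop : ∀ σ u v, ∀ f ∈ M, op σ u v f ∈ M) (e : Frame p q) (i j : Fin 3) {f : SmoothFun p q}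
    (hf : f ∈ M) : lieDeriv (e.rotGen i j) f ∈ M := by
  have h : lieDeriv (e.rotGen i j) f = ((e.sgn / 2 : ℝ) : ℂ) •
      (lieDeriv (unitGen (e.inj (imUnit j)) (e.inj (imUnit i))) f -
        lieDeriv (antiGen (e.inj (imUnit j)) (e.inj (imUnit i))) f) := SmoothFun.ext fun x => by
    rw [SmoothFun.smul_apply, SmoothFun.sub_apply, lieDeriv_apply, lieDeriv_apply, lieDeriv_apply,
      ← map_sub, ← Complex.real_smul, ← map_smul]
    rfl
  rw [h, lieDeriv_antiGen]
  exact M.smul_mem _ (M.sub_mem (hU.lieDeriv_mem hM (unitGen_smul _ _) hf)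
    (M.add_mem (hop _ _ _ _ hf) (hop _ _ _ _ hf)))

/-- A closed `U(p,q)`-invariant subspace that is invariant under the raising and lowering operators
is invariant under all reflections. -/
theorem exists_reflection (hp : 2 ≤ p) (hq : 2 ≤ q) {M : Submodule ℂ (SmoothFun p q)}
    (hM : IsClosed (M : Set (SmoothFun p q))) (hU : UInvariant M)
    (hop : ∀ σ u v, ∀ f ∈ M, op σ u v f ∈ M) {v : Vec p q} (hv : hermRe p q v v ≠ 0) :
    ∃ s : orthogonalGroup p q, (∀ x, s.1 x = x - (2 * hermRe p q x v / hermRe p q v v) • v) ∧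
      ∀ f ∈ M, precomp s f ∈ M := by
  obtain ⟨e, c, hc⟩ := exists_frame hp hq hv
  have hc0 : c ≠ 0 := by
    rintro rfl
    exact hv (by rw [hc]; ring)
  -- An element of U(p,q) carries `v` to a real multiple of the first frame vector, and the required
  -- reflection is the conjugate of the frame reflection.
  obtain ⟨g, hg, hgv⟩ := exists_commI_apply_eq (v := v) (w := c • e.fst)
    (by
      rw [herm_rsmul_left, herm_rsmul_right, e.herm_fst_fst, herm_self_eq_hermRe, hc]
      push_cast
      ring)
    (by rw [herm_self_eq_hermRe]; exact_mod_cast hv)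
  have hinv : ∀ x, g⁻¹.1 (g.1 x) = x := g.1.symm_apply_apply
  have hfst : g⁻¹.1 e.fst = c⁻¹ • v := by
    rw [← hinv (c⁻¹ • v), map_smul, hgv, smul_smul, inv_mul_cancel₀ hc0, one_smul]
  refine ⟨g⁻¹ * e.block (leftMul (-1) * quatConj) * g, fun x => ?_, fun f hf => ?_⟩
  · change g⁻¹.1 ((e.block (leftMul (-1) * quatConj)).1 (g.1 x)) = _
    have h1 : (herm (g.1 x) e.fst).re = c⁻¹ * hermRe p q x v := by
      have h2 := g.2 x (c⁻¹ • v)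
      rw [map_smul, hgv, smul_smul, inv_mul_cancel₀ hc0, one_smul, ← hermRe_apply x, map_smul,
        smul_eq_mul] at h2
      exact h2
    have h0 : e.sgn ≠ 0 := fun h0 => by simpa [h0] using e.sgn_mul_sgn
    rw [e.block_neg_quatConj_apply, map_sub, hinv, map_smul, hfst, smul_smul, h1, hc]
    congr 2
    field_simp
    linear_combination (hermRe p q x v) * e.sgn_mul_sgn
  · rw [← precomp_precomp, ← precomp_precomp]
    exact hU g hg _ (e.precomp_reflection_mem hM hU
      (fun i j f hf => lieDeriv_rotGen_mem hM hU hop e i j hf) (hU _ hg.inv f hf))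

end Frames

/-! ### Generation of O(2p,2q) by reflections -/

section Generation

/-- A set of isometries that contains the reflections and is closed under multiplication contains
all isometries. -/
theorem forall_of_reflections {H : orthogonalGroup p q → Prop} (hone : H 1)
    (hmul : ∀ g h, H g → H h → H (g * h))
    (hrefl : ∀ v, hermRe p q v v ≠ 0 → ∃ s : orthogonalGroup p q,
      (∀ x, s.1 x = x - (2 * hermRe p q x v / hermRe p q v v) • v) ∧ H s)
    (g : orthogonalGroup p q) : H g := by
  classical
  -- Reflections are involutions, so they can be cancelled on the left although `H` is not assumed
  -- closed under inverses.
  have hdiv : ∀ (s g : orthogonalGroup p q) (v : Vec p q), hermRe p q v v ≠ 0 →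
      (∀ x, s.1 x = x - (2 * hermRe p q x v / hermRe p q v v) • v) → H s → H (s * g) → H g := by
    intro s g v hv hs hHs h
    have hss : s * s = 1 := Subtype.ext (LinearEquiv.ext fun x => by
      change s.1 (s.1 x) = x
      rw [hs, hs, map_sub, sub_apply, map_smul, smul_apply,
        smul_eq_mul, sub_sub, ← add_smul]
      have : 2 * hermRe p q x v / hermRe p q v v + 2 * (hermRe p q x v -
          2 * hermRe p q x v / hermRe p q v v * hermRe p q v v) / hermRe p q v v = 0 := by
        field_simp
        ring
      rw [this, zero_smul, sub_zero])
    have := hmul s _ hHs h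
    rwa [← mul_assoc, hss, one_mul] at this
  have hg : ∀ (g : orthogonalGroup p q) (u v : Vec p q),
      hermRe p q (g.1 u) (g.1 v) = hermRe p q u v := fun g => g.2
  let B : LinearMap.BilinForm ℝ (Vec p q) := (ContinuousLinearMap.coeLM ℝ).comp
    (hermRe p q : Vec p q →ₗ[ℝ] Vec p q →L[ℝ] ℝ)
  have hB : ∀ u v, B u v = hermRe p q u v := fun _ _ => rfl
  obtain ⟨b, hb⟩ := LinearMap.BilinForm.exists_orthogonal_basis (B := B) ⟨fun u v => hermRe_symm u v⟩
  have hb' : ∀ i, hermRe p q (b i) (b i) ≠ 0 := by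
    refine hb.not_isOrtho_basis_self_of_separatingLeft fun x hx => ?_
    -- Pairing with this vector turns the indefinite form into the Euclidean norm of `x`;
    -- nondegeneracy keeps the members of an orthogonal basis anisotropic.
    have h1 := hx (x.1, -x.2)
    rw [hB, hermRe_apply] at h1
    have h2 : herm x (x.1, -x.2) = ((‖x.1‖ ^ 2 + ‖x.2‖ ^ 2 : ℝ) : ℂ) := by
      simp [herm, EuclideanSpace.norm_sq_eq, Complex.mul_conj, Complex.normSq_eq_norm_sq]
    rw [h2, Complex.ofReal_re] at h1
    have h3 : ‖x.1‖ ^ 2 = 0 := by nlinarith [sq_nonneg ‖x.1‖, sq_nonneg ‖x.2‖]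
    have h4 : ‖x.2‖ ^ 2 = 0 := by nlinarith [sq_nonneg ‖x.1‖, sq_nonneg ‖x.2‖]
    exact Prod.ext (norm_eq_zero.1 (pow_eq_zero_iff two_ne_zero |>.1 h3))
      (norm_eq_zero.1 (pow_eq_zero_iff two_ne_zero |>.1 h4))
  -- Induction on the set of basis vectors that `g` is allowed to move.
  have key : ∀ (s : Finset (Fin (Module.finrank ℝ (Vec p q)))) (g : orthogonalGroup p q),
      (∀ i ∉ s, g.1 (b i) = b i) → H g := by
    intro s
    induction s using Finset.induction_on with
    | empty =>
      intro g hg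
      have : g = 1 := Subtype.ext (b.ext' fun i => hg i (Finset.notMem_empty i))
      rwa [this]
    | insert i s hi ih =>
      intro g hgs
      let v := g.1 (b i)
      have hvv : hermRe p q v v = hermRe p q (b i) (b i) := hg g _ _
      have hfix : ∀ j ∉ s, j ≠ i → g.1 (b j) = b j := fun j hj hji =>
        hgs j fun h => (Finset.mem_insert.1 h).elim hji hj
      have horth : ∀ j, j ≠ i → hermRe p q (b j) (b i) = 0 := fun j hj => hb hj
      have hjv : ∀ j ∉ s, j ≠ i → hermRe p q (b j) v = 0 := fun j hj hji => by
        rw [← hfix j hj hji, hg g, horth j hji]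
      -- If `v - b i` is anisotropic, its reflection takes `v` to `b i`. Otherwise the parallelogram
      -- law makes `v + b i` anisotropic; its reflection takes `v` to `-b i`, and the reflection in
      -- `b i` corrects the sign. All these reflections fix the other basis vectors that `g` fixes.
      by_cases hd : hermRe p q (v - b i) (v - b i) = 0
      · have hs2 : hermRe p q (v + b i) (v + b i) = 4 * hermRe p q (b i) (b i) := by
          simp only [map_add, map_sub, add_apply,
            sub_apply] at hd ⊢
          linarith
        have hs0 : hermRe p q (v + b i) (v + b i) ≠ 0 := by
          rw [hs2]
          exact mul_ne_zero four_ne_zero (hb' i)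
        obtain ⟨t, ht, hHt⟩ := hrefl _ hs0
        obtain ⟨r, hr, hHr⟩ := hrefl _ (hb' i)
        refine hdiv t g _ hs0 ht hHt (hdiv r _ _ (hb' i) hr hHr (ih _ fun j hj => ?_))
        change r.1 (t.1 (g.1 (b j))) = b j
        by_cases hji : j = i
        · subst hji
          have h1 : t.1 v = -b j := by
            rw [ht, show 2 * hermRe p q v (v + b j) = hermRe p q (v + b j) (v + b j) by
              simp only [map_add, add_apply, hvv, hermRe_symm (b j) v]; ring,
              div_self hs0]
            module
          change r.1 (t.1 v) = b j
          rw [h1, hr, map_neg, neg_apply, mul_neg, neg_div,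
            mul_div_cancel_right₀ _ (hb' j)]
          module
        · rw [hfix j hj hji, ht, map_add, hjv j hj hji, horth j hji, add_zero, mul_zero, zero_div,
            zero_smul, sub_zero, hr, horth j hji, mul_zero, zero_div, zero_smul, sub_zero]
      · obtain ⟨t, ht, hHt⟩ := hrefl _ hd
        refine hdiv t g _ hd ht hHt (ih _ fun j hj => ?_)
        change t.1 (g.1 (b j)) = b j
        by_cases hji : j = i
        · subst hji
          change t.1 v = b j
          rw [ht, show 2 * hermRe p q v (v - b j) = hermRe p q (v - b j) (v - b j) by
            simp only [map_sub, sub_apply, hvv, hermRe_symm (b j) v]; ring,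
            div_self hd]
          module
        · rw [hfix j hj hji, ht, map_sub, hjv j hj hji, horth j hji, sub_zero, mul_zero, zero_div,
            zero_smul, sub_zero]
  exact key Finset.univ g fun i hi => absurd (Finset.mem_univ i) hi

/-- A closed `U(p,q)`-invariant subspace that is invariant under the raising and lowering operators
is invariant under `O(2p,2q)`. -/
theorem precomp_mem (hp : 2 ≤ p) (hq : 2 ≤ q) {M : Submodule ℂ (SmoothFun p q)}
    (hM : IsClosed (M : Set (SmoothFun p q))) (hU : UInvariant M)
    (hop : ∀ σ u v, ∀ f ∈ M, op σ u v f ∈ M) (g : orthogonalGroup p q) {f : SmoothFun p q}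
    (hf : f ∈ M) : precomp g f ∈ M :=
  forall_of_reflections (H := fun g => ∀ f ∈ M, precomp g f ∈ M)
    (fun f hf => by rwa [precomp_one])
    (fun g h hg hh f hf => by
      rw [← precomp_precomp]
      exact hh _ (hg f hf))
    (fun v hv => exists_reflection hp hq hM hU hop hv) g f hf

end Generation


/-! ### Subquotients and the proof of irreducibility -/

variable {p q : ℕ}

section Invariance

variable (V : Subrepresentation (rho p q))

theorem precomp_mem_of_subrepresentation (g : orthogonalGroup p q) {f : SmoothFun p q}
    (hf : f ∈ V.toSubmodule) : precomp g f ∈ V.toSubmodule :=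
  V.apply_mem_toSubmodule g⁻¹ hf

theorem uInvariant_of_subrepresentation : UInvariant V.toSubmodule := fun g _ _ hf =>
  precomp_mem_of_subrepresentation V g hf

theorem op_mem_of_subrepresentation (hV : IsClosed (V.toSubmodule : Set (SmoothFun p q)))
    (σ : ℤˣ) (u v : Vec p q) {f : SmoothFun p q} (hf : f ∈ V.toSubmodule) :
    op σ u v f ∈ V.toSubmodule := by
  have h : ∀ T : lieAlg p q, lieDeriv T f ∈ V.toSubmodule := fun T =>
    lieDeriv_mem hV T fun t => precomp_mem_of_subrepresentation V _ hf
  exact V.toSubmodule.smul_mem _ (V.toSubmodule.add_mem (h _) (V.toSubmodule.smul_mem _ (h _)))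

end Invariance

/-- Polar decomposition of `t`: homogeneity under `|t|` is already part of S^{α+β}, and on `t / |t|`
the character is the `n`-th power. -/
theorem mem_Sab_iff {α β : ℂ} {n : ℤ} (hn : α - β = n) {f : SmoothFun p q}
    (hf : f ∈ (S p q (α + β)).toSubmodule) : f ∈ (Sab p q α β).toSubmodule ↔ f ∈ wt p q n := by
  have hf0 : ∀ (t : ℝ) (ht : 0 < t) (x : cone p q),
    f (dilate (posUnit t ht) x) = (t : ℂ) ^ (α + β) * f x := hf
  rw [mem_wt_iff]
  constructor
  · intro h ζ x
    have h1 : f (dilate (Circle.toUnits ζ) x) = psi α β (Circle.toUnits ζ) * f x := h.2 _ x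
    rw [psi, hn, Circle.toUnits_apply, Units.val_mk0, Circle.norm_coe, Complex.ofReal_one,
      Complex.one_cpow, one_mul, div_one, Complex.cpow_intCast] at h1
    exact h1
  · refine fun h => ⟨hf, fun t x => ?_⟩
    have ht : 0 < ‖(t : ℂ)‖ := norm_pos_iff.2 t.ne_zero
    have ht' : ((‖(t : ℂ)‖ : ℝ) : ℂ) ≠ 0 := Complex.ofReal_ne_zero.2 ht.ne'
    obtain ⟨ζ, hζ⟩ : ∃ ζ : Circle, (ζ : ℂ) = (t : ℂ) / ‖(t : ℂ)‖ :=
      ⟨⟨(t : ℂ) / ‖(t : ℂ)‖, by simp [Submonoid.unitSphere, ht.ne']⟩, rfl⟩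
    have h1 : dilate t x = dilate (posUnit _ ht) (act (scalar p q ζ) x) := Subtype.ext (by
      change (t : ℂ) • (x : Vec p q) = ((‖(t : ℂ)‖ : ℝ) : ℂ) • ((ζ : ℂ) • (x : Vec p q))
      rw [smul_smul, hζ, mul_div_cancel₀ _ ht'])
    rw [h1, hf0, h, psi, hn, Complex.cpow_intCast, hζ, mul_assoc]

section Image

variable {A : Type*} [AddCommGroup A] [Module ℂ A] (V W L : Submodule ℂ A)

/-- The image of `V ∩ L` in `V / W`. -/
abbrev image : Submodule ℂ (V ⧸ W.submoduleOf V) :=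
  (L.submoduleOf V).map (W.submoduleOf V).mkQ

/-- The map from `V ∩ L` to its image in `V / W`. -/
def toImage : ↥(V ⊓ L) →ₗ[ℂ] ↥(image V W L) where
  toFun f := ⟨(W.submoduleOf V).mkQ ⟨f, f.2.1⟩, ⟨f, f.2.1⟩, f.2.2, rfl⟩
  map_add' _ _ := rfl
  map_smul' _ _ := rfl

variable {V W L}

theorem toImage_surjective (y : ↥(image V W L)) : ∃ f, toImage V W L f = y := by
  obtain ⟨_, v, hv, rfl⟩ := y
  exact ⟨⟨v, v.2, hv⟩, rfl⟩

theorem toImage_eq_zero_iff (f : ↥(V ⊓ L)) : toImage V W L f = 0 ↔ (f : A) ∈ W := by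
  rw [← Subtype.coe_inj]
  exact (Submodule.Quotient.mk_eq_zero _).trans Iff.rfl

/-- The elements of `V ∩ L` whose image is in a given subspace. -/
def lift (N : Submodule ℂ ↥(image V W L)) : Submodule ℂ A :=
  (N.comap (toImage V W L)).map (Submodule.subtype _)

theorem mem_lift {N : Submodule ℂ ↥(image V W L)} {f : A} : f ∈ lift N ↔
    ∃ hf : f ∈ V ⊓ L, toImage V W L ⟨f, hf⟩ ∈ N := by
  constructor
  · rintro ⟨f, hf, rfl⟩
    exact ⟨f.2, hf⟩
  · rintro ⟨hf, h⟩
    exact ⟨⟨f, hf⟩, h, rfl⟩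

theorem mkQ_mem_image_iff (hWL : W ≤ L) (v : V) :
    (W.submoduleOf V).mkQ v ∈ image V W L ↔ (v : A) ∈ L := by
  constructor
  · rintro ⟨w, hw, hwv⟩
    have h : w - v ∈ W.submoduleOf V := by
      rwa [← Submodule.Quotient.eq]
    have h3 : (w : A) - (w - v) ∈ L := L.sub_mem hw (hWL h)
    rwa [sub_sub_cancel] at h3
  · exact fun h => ⟨v, h, rfl⟩

theorem inf_le_of_image_le {L' : Submodule ℂ A} (hWL : W ≤ L') (h : image V W L ≤ image V W L') :
    V ⊓ L ≤ L' :=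
  fun f hf => (mkQ_mem_image_iff hWL ⟨f, hf.1⟩).1 (h ⟨⟨f, hf.1⟩, hf.2, rfl⟩)

theorem eq_bot_of_lift_le {N : Submodule ℂ ↥(image V W L)} (h : lift N ≤ W) : N = ⊥ := by
  refine (Submodule.eq_bot_iff _).2 fun y hy => ?_
  obtain ⟨f, rfl⟩ := toImage_surjective y
  exact (toImage_eq_zero_iff f).2 (h (mem_lift.2 ⟨f.2, hy⟩))

theorem eq_top_of_le_lift {N : Submodule ℂ ↥(image V W L)} (h : V ⊓ L ≤ lift N) : N = ⊤ := by
  refine Submodule.eq_top_iff'.2 fun y => ?_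
  obtain ⟨f, rfl⟩ := toImage_surjective y
  exact (mem_lift.1 (h f.2)).2

theorem inf_le_lift (hWV : W ≤ V) (N : Submodule ℂ ↥(image V W L)) : W ⊓ L ≤ lift N := by
  intro f hf
  have hf' : f ∈ V ⊓ L := ⟨hWV hf.1, hf.2⟩
  have h0 : toImage V W L ⟨f, hf'⟩ = 0 := (toImage_eq_zero_iff _).2 hf.1
  exact mem_lift.2 ⟨hf', h0 ▸ N.zero_mem⟩

theorem lift_le (N : Submodule ℂ ↥(image V W L)) : lift N ≤ V ⊓ L := fun _ hf => (mem_lift.1 hf).1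

variable [TopologicalSpace A]

theorem continuous_toImage : Continuous (toImage V W L) :=
  (continuous_quot_mk.comp (continuous_subtype_val.subtype_mk fun f => f.2.1)).subtype_mk _

/-- Only continuity of the map from `V ⊓ L` to its image is used, so the subspace topology on the
image need not be compared with a quotient topology of `V ⊓ L`. -/
theorem isClosed_lift {N : Submodule ℂ ↥(image V W L)} (h : IsClosed ((V ⊓ L : Submodule ℂ A) : Set A))
    (hN : IsClosed (N : Set ↥(image V W L))) : IsClosed (lift N : Set A) := by
  have := h.isClosedEmbedding_subtypeVal.isClosedMap _ (hN.preimage continuous_toImage)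
  exact this

/-- Closedness in the quotient is tested on the preimage in `V`, which is `V ∩ L` because `L`
contains `W`. -/
theorem isClosed_image (hWL : W ≤ L) (hL : IsClosed (L : Set A)) :
    IsClosed (image V W L : Set (V ⧸ W.submoduleOf V)) := by
  refine (Submodule.isQuotientMap_mkQL _).isClosed_preimage.1 ?_
  have : IsClosed ((↑) ⁻¹' (L : Set A) : Set V) := hL.preimage continuous_subtype_val
  convert this using 1
  ext v
  exact mkQ_mem_image_iff hWL v

end Image

/-- The image of an invariant subspace in a subquotient. -/
def subquotientImage (V W : Subrepresentation (rho p q)) (M : Submodule ℂ (SmoothFun p q))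
    (hM : ∀ g, ∀ f ∈ M, precomp g f ∈ M) : Subrepresentation (subquotientRep V W) where
  toSubmodule := image V.toSubmodule W.toSubmodule M
  apply_mem_toSubmodule g := by
    rintro _ ⟨v, hv, rfl⟩
    refine ⟨V.toRepresentation g v, ?_, rfl⟩
    change rho p q g v ∈ M
    rw [rho_eq_precomp]
    exact hM _ _ hv

/-- The functions in `V ∩ S^{α,β}` whose image is in a given invariant subspace. -/
def liftSab {α β : ℂ} {V W : Subrepresentation (rho p q)}
    (N : Subrepresentation (imageSab V W α β).toRepresentation) : Submodule ℂ (SmoothFun p q) :=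
  lift (V := V.toSubmodule) (W := W.toSubmodule) (L := (Sab p q α β).toSubmodule) N.toSubmodule

theorem uInvariant_liftSab {α β : ℂ} {V W : Subrepresentation (rho p q)}
    (N : Subrepresentation (imageSab V W α β).toRepresentation) :
    UInvariant (liftSab N) := fun g hg f hf => by
  obtain ⟨k, rfl⟩ := hg.exists_unitary
  obtain ⟨hf, hfN⟩ := mem_lift.1 hf
  refine mem_lift.2 ⟨⟨uInvariant_of_subrepresentation V _ hg f hf.1,
    (Sab p q α β).apply_mem_toSubmodule k⁻¹ hf.2⟩, ?_⟩
  exact N.apply_mem_toSubmodule k⁻¹ hfN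

/-- A closed `U(p,q)`-invariant space `N` of functions of weight `n` between `W` and `V` consists of
the functions of weight `n` in a closed `O(2p,2q)`-invariant space between `W` and `V`. -/
theorem exists_invariant_hull (hp : 2 ≤ p) (hq : 2 ≤ q) {V W : Subrepresentation (rho p q)}
    (hV : IsClosed (V.toSubmodule : Set (SmoothFun p q)))
    (hW : IsClosed (W.toSubmodule : Set (SmoothFun p q)))
    (hWV : W.toSubmodule ≤ V.toSubmodule) {n : ℤ} {N : Submodule ℂ (SmoothFun p q)}
    (hN : IsClosed (N : Set (SmoothFun p q))) (hNU : UInvariant N) (hNV : N ≤ V.toSubmodule)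
    (hNn : N ≤ wt p q n) (hWN : W.toSubmodule ⊓ wt p q n ≤ N) :
    ∃ M : Submodule ℂ (SmoothFun p q), IsClosed (M : Set (SmoothFun p q)) ∧
      (∀ g, ∀ f ∈ M, precomp g f ∈ M) ∧ W.toSubmodule ≤ M ∧ N ≤ M ∧
      ∀ f ∈ M, f ∈ wt p q n → f ∈ N := by
  have hVU := uInvariant_of_subrepresentation V
  have hVop := fun σ u v f => op_mem_of_subrepresentation V hV σ u v (f := f)
  have hM := isClosed_hull (n := n) hV hN
  refine ⟨hull V.toSubmodule N n, hM, fun g f hf => precomp_mem hp hq hM (uInvariant_hull hVU hNU)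
    (fun σ u v f hf => op_mem_hull hV hVU hVop hN hNU hNV hNn σ u v hf) g hf,
    le_hull_of_op_mem hW (uInvariant_of_subrepresentation W)
      (fun σ u v f => op_mem_of_subrepresentation W hW σ u v) hWV hWN,
    le_hull hNV hNn, fun f => mem_of_mem_hull⟩

theorem inf_le_or_inf_le_of_isTopIrreducible {V W : Subrepresentation (rho p q)}
    (hirr : IsTopIrreducible (subquotientRep V W)) {M : Submodule ℂ (SmoothFun p q)}
    (hM : IsClosed (M : Set (SmoothFun p q))) (hMO : ∀ g, ∀ f ∈ M, precomp g f ∈ M)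
    (hWM : W.toSubmodule ≤ M) :
    V.toSubmodule ⊓ M ≤ W.toSubmodule ∨ V.toSubmodule ≤ M := by
  rcases hirr.2 (subquotientImage V W M hMO)
    (isClosed_image (V := V.toSubmodule) (W := W.toSubmodule) hWM hM) with h | h
  · have h1 : image V.toSubmodule W.toSubmodule M = ⊥ := h
    exact Or.inl (inf_le_of_image_le le_rfl (h1.le.trans bot_le))
  · have h1 : image V.toSubmodule W.toSubmodule M = ⊤ := h
    have h2 : V.toSubmodule ⊓ ⊤ ≤ M := inf_le_of_image_le hWM (h1.ge.trans' le_top)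
    exact Or.inr ((le_inf le_rfl le_top).trans h2)

set_option maxHeartbeats 1000000 in
/-- The image of `S^{α,β}` in an irreducible constituent is zero or irreducible. -/
theorem isTopIrreducible_imageSab (hp : 2 ≤ p) (hq : 2 ≤ q) {α β : ℂ} {n : ℤ} (hn : α - β = n)
    {V W : Subrepresentation (rho p q)}
    (hV : IsClosed (V.toSubmodule : Set (SmoothFun p q)))
    (hW : IsClosed (W.toSubmodule : Set (SmoothFun p q)))
    (hWV : W.toSubmodule ≤ V.toSubmodule)
    (hVS : V.toSubmodule ≤ (S p q (α + β)).toSubmodule)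
    (hirr : IsTopIrreducible (subquotientRep V W))
    (hne : (imageSab V W α β).toSubmodule ≠ ⊥) :
    IsTopIrreducible (imageSab V W α β).toRepresentation := by
  refine ⟨Submodule.nontrivial_iff_ne_bot.2 hne, fun N hN => ?_⟩
  have hSab : V.toSubmodule ⊓ (Sab p q α β).toSubmodule = V.toSubmodule ⊓ wt p q n :=
    Submodule.ext fun f => and_congr_right fun hf => mem_Sab_iff hn (hVS hf)
  have hle0 : liftSab N ≤ V.toSubmodule ⊓ (Sab p q α β).toSubmodule := lift_le N.toSubmodule
  have hle : liftSab N ≤ V.toSubmodule ⊓ wt p q n := hle0.trans hSab.le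
  have hWN0 : W.toSubmodule ⊓ (Sab p q α β).toSubmodule ≤ liftSab N := inf_le_lift hWV N.toSubmodule
  have hWN : W.toSubmodule ⊓ wt p q n ≤ liftSab N :=
    (le_inf inf_le_left ((inf_le_inf_right _ hWV).trans (hSab.ge.trans inf_le_right))).trans hWN0
  have hcl : IsClosed ((V.toSubmodule ⊓ (Sab p q α β).toSubmodule : Submodule ℂ (SmoothFun p q)) :
      Set (SmoothFun p q)) := by
    rw [hSab]
    exact hV.inter (isClosed_wt n)
  have hc : IsClosed (liftSab N : Set (SmoothFun p q)) := isClosed_lift hcl hN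
  obtain ⟨M, hM, hMO, hWM, hNM, hMN⟩ := exists_invariant_hull hp hq hV hW hWV hc
    (uInvariant_liftSab N) (hle.trans inf_le_left) (hle.trans inf_le_right) hWN
  -- Either `M` adds nothing to `W` inside `V`, and then the lift of `N` dies in the quotient; or
  -- `M` contains `V`, and then every function of weight `n` in `V` already lies in the lift.
  rcases inf_le_or_inf_le_of_isTopIrreducible hirr hM hMO hWM with h | h
  · have h2 : liftSab N ≤ W.toSubmodule := (le_inf (hle.trans inf_le_left) hNM).trans h
    exact Or.inl (eq_bot_of_lift_le (V := V.toSubmodule) (W := W.toSubmodule)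
      (L := (Sab p q α β).toSubmodule) h2)
  · have h2 : V.toSubmodule ⊓ (Sab p q α β).toSubmodule ≤ liftSab N := fun f hf =>
      hMN f (h hf.1) (hSab.le hf).2
    exact Or.inr (eq_top_of_le_lift (V := V.toSubmodule) (W := W.toSubmodule)
      (L := (Sab p q α β).toSubmodule) h2)

end LightCone

end

theorem theorem4p2 (p q : ℕ) (hp : 2 ≤ p) (hq : 2 ≤ q) (α β : ℂ) (n : ℤ) (hn : α - β = n)
    (V W : Subrepresentation (LightCone.rho p q))
    (hV : IsClosed (V.toSubmodule : Set (LightCone.SmoothFun p q)))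
    (hW : IsClosed (W.toSubmodule : Set (LightCone.SmoothFun p q)))
    (hWV : W.toSubmodule ≤ V.toSubmodule)
    (hVS : V.toSubmodule ≤ (LightCone.S p q (α + β)).toSubmodule)
    (hirr : LightCone.IsTopIrreducible (LightCone.subquotientRep V W))
    (hne : (LightCone.imageSab V W α β).toSubmodule ≠ ⊥) :
    LightCone.IsTopIrreducible (LightCone.imageSab V W α β).toRepresentation :=
  LightCone.isTopIrreducible_imageSab hp hq hn hV hW hWV hVS hirr hne
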